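/- For $n\ge 3$ let $r=r(n)\ge 3$ and $k=k(n)\ge 2$ be integers. Assume that $r$ divides $kn$ and $r-1$ divides $n-1$ for infinitely many values of $n$, and take all limits as $n\to\infty$ along these values only. A simple $r$-uniform hypergraph on $[n]=\{1,\dots,n\}$ is a set of $r$-element subsets of $[n]$, called edges; it is $k$-regular if every vertex lies in exactly $k$ edges. A hypertree is a connected hypergraph (any two vertices are joined by a path $v_0,e_1,v_1,\dots,e_\ell,v_\ell$ with distinct vertices, distinct edges and $v_{i-1},v_i\in e_i$) that contains no cycle, where a $2$-cycle is a pair of distinct edges with at least two common vertices and, for $\ell\ge 3$, an $\ell$-cycle consists of distinct edges $e_1,\dots,e_\ell$ and distinct vertices $v_1,\dots,v_\ell$ with $v_i\in e_i\cap e_{i+1}$ (indices modulo $\ell$). A spanning hypertree of $H$ is a subhypergraph of $H$ that contains all vertices of $H$ and is a hypertree. Let $\mathbb{E}\,\tau^{(r)}_{n,k}$ be the expected number of spanning hypertrees in a uniformly random $k$-regular simple $r$-uniform hypergraph on $[n]$, and let \[ F^{(r)}(k,k)=\frac{(k-1)^{1/2}(r-1)}{n\,(kr-k-r)^{\frac{r+1}{2(r-1)}}}\left(\frac{k\,(r-1)^{k/r}(k-1)^{k-1}}{k^{\frac{kr-k}{r}}(kr-k-r)^{\frac{kr-k-r}{r(r-1)}}}\right)^{n}.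 \] If $r^5k^3=o\big((kr-k-r)n\big)$, then \[ \mathbb{E}\,\tau^{(r)}_{n,k}=F^{(r)}(k,k)\,\exp\left(\frac{kr-r-1}{2(k-1)}+O\left(\frac{r^5k^3}{(kr-k-r)n}\right)\right), \] where the constant implied by $O(\cdot)$ is absolute. -/

import Mathlib

open Filter Asymptotics

namespace RandomHypertree

/-- A hypergraph (a vertex set together with a set of subsets of it as edges, so that no edge has a
repeated vertex and no edge is repeated) is `r`-uniform if every edge has exactly `r` vertices. -/
def IsUniform {α : Type*} (H : Hypergraph α) (r : ℕ) : Prop :=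
  ∀ e ∈ H.edgeSet, e.encard = r

/-- The degree of a vertex: the number of edges that contain it. -/
noncomputable def degree {α : Type*} (H : Hypergraph α) (v : α) : ℕ :=
  {e | e ∈ H.edgeSet ∧ v ∈ e}.ncard

/-- There is a Berge path `v₀, e₁, v₁, …, e_ℓ, v_ℓ` from `x` to `y`: distinct vertices, distinct
edges, and `v_{i-1}, v_i ∈ e_i` for all `i`. -/
def HasPath {α : Type*} (H : Hypergraph α) (x y : α) : Prop :=
  ∃ (l : ℕ) (v : Fin (l + 1) → α) (e : Fin l → Set α),
    Function.Injective v ∧ Function.Injective e ∧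
    (∀ i, v i ∈ H.vertexSet) ∧ (∀ i, e i ∈ H.edgeSet) ∧
    (∀ i : Fin l, v i.castSucc ∈ e i ∧ v i.succ ∈ e i) ∧
    v 0 = x ∧ v (Fin.last l) = y

/-- Every two vertices are joined by a path. -/
def IsConnected {α : Type*} (H : Hypergraph α) : Prop :=
  ∀ x ∈ H.vertexSet, ∀ y ∈ H.vertexSet, HasPath H x y

/-- Two distinct edges that meet in at least two vertices. -/
def HasTwoCycle {α : Type*} (H : Hypergraph α) : Prop :=
  ∃ e ∈ H.edgeSet, ∃ f ∈ H.edgeSet, e ≠ f ∧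
    ∃ x y : α, x ≠ y ∧ x ∈ e ∧ x ∈ f ∧ y ∈ e ∧ y ∈ f

/-- A cycle of length `l + 1`: distinct edges `e_i` and distinct vertices `v_i` with
`v_i ∈ e_i ∩ e_{i+1}`, indices taken modulo `l + 1`. -/
def HasCycle {α : Type*} (H : Hypergraph α) (l : ℕ) : Prop :=
  ∃ (e : Fin (l + 1) → Set α) (v : Fin (l + 1) → α),
    Function.Injective e ∧ Function.Injective v ∧
    (∀ i, e i ∈ H.edgeSet) ∧ ∀ i, v i ∈ e i ∧ v i ∈ e (i + 1)

/-- No 2-cycles and no cycles of length at least 3. (A 1-cycle would be an edge with a repeated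
vertex; edges are sets here, so there is none.) -/
def IsAcyclic {α : Type*} (H : Hypergraph α) : Prop :=
  ¬ HasTwoCycle H ∧ ∀ l, 3 ≤ l + 1 → ¬ HasCycle H l

/-- A hypertree is a connected hypergraph without cycles. -/
def IsHypertree {α : Type*} (T : Hypergraph α) : Prop :=
  IsConnected T ∧ IsAcyclic T

/-- `T` is a spanning hypertree of `H`: a subhypergraph with all vertices of `H` that is a
hypertree. -/
def IsSpanningHypertree {α : Type*} (T H : Hypergraph α) : Prop :=
  T.vertexSet = H.vertexSet ∧ T.edgeSet ⊆ H.edgeSet ∧ IsHypertree T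

/-- The number of spanning hypertrees of `H`. -/
noncomputable def tau {α : Type*} (H : Hypergraph α) : ℕ :=
  {T : Hypergraph α | IsSpanningHypertree T H}.ncard

/-- There are finitely many hypergraphs on a finite vertex type. -/
theorem finite_hypergraph (α : Type*) [Finite α] : Finite (Hypergraph α) :=
  Finite.of_injective (fun H : Hypergraph α => (H.vertexSet, H.edgeSet)) fun _ _ h =>
    Hypergraph.ext (congrArg Prod.fst h) (congrArg Prod.snd h)

/-- The simple `r`-uniform hypergraphs on the vertex set `{1, …, n}` (as `Fin n`) with degree
sequence `d`. -/
def hypergraphsWithDegrees (n r : ℕ) (d : Fin n → ℕ) : Set (Hypergraph (Fin n)) :=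
  {H | H.vertexSet = Set.univ ∧ IsUniform H r ∧ ∀ v, degree H v = d v}

theorem finite_hypergraphsWithDegrees (n r : ℕ) (d : Fin n → ℕ) :
    (hypergraphsWithDegrees n r d).Finite :=
  haveI := finite_hypergraph (Fin n)
  Set.toFinite _

/-- The expected number of spanning hypertrees in a uniformly random simple `r`-uniform hypergraph
on `n` vertices with degree sequence `d`. -/
noncomputable def expectedTau (n r : ℕ) (d : Fin n → ℕ) : ℝ :=
  (∑ H ∈ (finite_hypergraphsWithDegrees n r d).toFinset, (tau H : ℝ)) /
    ((finite_hypergraphsWithDegrees n r d).toFinset.card : ℝ)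

/-- The expected number of spanning hypertrees in the `k`-regular case. -/
noncomputable def expectedTauRegular (n r k : ℕ) : ℝ :=
  expectedTau n r fun _ => k

/-- The function `F^{(r)}(k, k̂)` on `n` vertices. -/
noncomputable def F (n : ℕ) (r k khat : ℝ) : ℝ :=
  (k - 1) ^ ((1 : ℝ) / 2) * (r - 1) /
      (n * (k * r - k - r) ^ ((r + 1) / (2 * (r - 1)))) *
    (khat * (r - 1) ^ (k / r) * (k - 1) ^ (k - 1) /
      (k ^ ((k * r - k) / r) *
        (k * r - k - r) ^ ((k * r - k - r) / (r * (r - 1))))) ^ n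

end RandomHypertree

/-!
The expectation is the quotient of two counts. Let `t = (n - 1) / (r - 1)` be the number of edges
of a spanning hypertree and `m = k n / r - t` the number of the other edges of the hypergraph.
Then `𝔼 τ` is the sum, over all `r`-uniform hypertrees `E` on `[n]`, of the number of ways to
complete `E` by `m` edges to a `k`-regular hypergraph, divided by the number of `k`-regular
hypergraphs (`expectedTauRegular_eq`).

*Tables.* A hypergraph with `N` edges corresponds to `N! (r!)^N` tables with `N` rows of length `r`
whose rows have no repeated entry and are distinct as sets (`card_hypergraphs_mul`). Regard a table
as a colouring of its `N r` cells by vertices in which every colour is used a prescribed number of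
times; the first condition says that the colouring is proper for the graph `rowConflicts` of
conflicts between cells of a common row. The second condition costs only a factor
`1 - O(k³ N / m²)` (`card_not_simple_le`), since for `r ≥ 3` two equal rows force three
coincidences, as does a row that equals an edge of the hypertree.

*Proper colourings.* Let the conflict graph `B` have maximum degree at most `D`, and let each of the
colours be used `κ` times in colouring `M` slots. Insert the edges of `B` one at a time. Exchanging
the colour of one endpoint of the new edge with that of a random slot shows that the two endpoints
agree with frequency `(κ - 1) / M + O(D κ² / M²)`. Hence the number of proper colourings is the
multinomial coefficient `M! / (κ!)^n` times `exp (-|B| (κ - 1) / M + |B| O(D κ² / M²))`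
(`card_colorings_bounds`). With `κ = k` this gives the denominator.

*Hypertrees.* Root the hypertrees at a vertex. A hypertree with labelled edges is then coded by the
grouping of the other vertices into the blocks `edge minus parent` and by the parent of each block,
and a weighted form of Cayley's formula (`sum_acyc`), proved by induction on the set of blocks
attached to the root, yields the degree enumerator (`sum_hypertrees`): the degrees minus one of a
random hypertree are distributed like the fibre sizes of a uniformly random map `h` from `t - 1`
points to the vertices.

*Joint colourings.* For this reason the numerator need not be evaluated for each degree sequence
separately. A table that uses the vertex `v` exactly `k - 1 - #h⁻¹(v)` times, together with `h`, is a
colouring of `m r + t - 1 = (k - 1) n` slots in which every vertex is used exactly `k - 1` times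
(`sum_card_tables`). The estimate for proper colourings, now with `κ = k - 1`, evaluates the whole
sum at once.

The two exponents combine to `(k r - r - 1) / (2 (k - 1))` (`log_expectedTauRegular`), and Stirling's
formula turns the remaining factorials into `F` (`abs_logMainTerm_sub_log_F_le`). All errors are
`O(r² k² / n)`, which is stronger than the bound of the theorem because `k r - k - r ≤ k r`.
-/

namespace RandomHypertree

set_option linter.unusedSectionVars false

open Finset

/-! ### Colourings without conflicts and switchings -/

section Switching

variable {S V : Type*} [Fintype S] [DecidableEq S] [Fintype V] [DecidableEq V]

/-- The colourings of the slots `S` by `V` in which each colour `v` is used exactly `d v` times and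
which are proper for the conflict graph whose edge set is `B`. -/
def colorings (B : Finset (Sym2 S)) (d : V → ℕ) : Finset (S → V) :=
  univ.filter fun f => (∀ v, #{s | f s = v} = d v) ∧ ∀ a b, s(a, b) ∈ B → f a ≠ f b

lemma mem_colorings {B : Finset (Sym2 S)} {d : V → ℕ} {f : S → V} :
    f ∈ colorings B d ↔ (∀ v, #{s | f s = v} = d v) ∧ ∀ a b, s(a, b) ∈ B → f a ≠ f b := by
  simp [colorings]

lemma card_fiber_comp_equiv {T : Type*} [Fintype T] [DecidableEq T] (f : S → V) (σ : T ≃ S)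
    (v : V) : #{x | (f ∘ σ) x = v} = #{x | f x = v} :=
  Finset.card_equiv σ (by simp)

lemma swap_comp_apply_left (f : S → V) (s a : S) : (f ∘ Equiv.swap s a) s = f a := by simp

lemma swap_comp_apply_of_ne (f : S → V) {s a u : S} (h1 : u ≠ s) (h2 : u ≠ a) :
    (f ∘ Equiv.swap s a) u = f u := by simp [Equiv.swap_apply_of_ne_of_ne h1 h2]

lemma swap_comp_swap (f : S → V) (s a : S) :
    (f ∘ Equiv.swap s a) ∘ Equiv.swap s a = f := by
  ext x; simp

/-- If switching the colours of `s` and `a` destroys properness, then the new colour of `s` occurs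
at a neighbour of `s`, or the new colour of `a` occurs at a neighbour of `a`. -/
lemma exists_of_swap_notMem {B : Finset (Sym2 S)} {d : V → ℕ} {f : S → V}
    (hf : f ∈ colorings B d) {s a : S} (h : f ∘ Equiv.swap s a ∉ colorings B d) :
    (∃ u, s(s, u) ∈ B ∧ f u = f a) ∨ (∃ u, s(a, u) ∈ B ∧ u ≠ s ∧ f u = f s) := by
  rw [mem_colorings] at hf h
  by_contra! hcon
  refine h ⟨fun v => by rw [card_fiber_comp_equiv]; exact hf.1 v, fun x y hxy => ?_⟩
  have hyx : s(y, x) ∈ B := by rwa [Sym2.eq_swap]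
  have h1 := hf.2 x y hxy
  have h3 := hcon.1 y
  have h4 := hcon.1 x
  have h5 := hcon.2 y
  have h6 := hcon.2 x
  simp only [Function.comp_apply, Equiv.swap_apply_def]
  split_ifs <;> subst_vars <;> grind

/-- At most `2 D κ` of the switchings at a slot `s` destroy properness. -/
lemma card_swap_notMem_le {B : Finset (Sym2 S)} {d : V → ℕ} {D κ : ℕ}
    (hdeg : ∀ s, #{u | s(s, u) ∈ B} ≤ D) (hd : ∀ v, d v ≤ κ) {f : S → V}
    (hf : f ∈ colorings B d) (s : S) :
    #{a | f ∘ Equiv.swap s a ∉ colorings B d} ≤ 2 * D * κ := by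
  have hcol : ∀ v, #{x | f x = v} ≤ κ := fun v => by rw [(mem_colorings.1 hf).1 v]; exact hd v
  have hsub : ({a | f ∘ Equiv.swap s a ∉ colorings B d} : Finset S) ⊆
      (({u | s(s, u) ∈ B} : Finset S).biUnion fun u => {a | f a = f u}) ∪
      (({u | f u = f s} : Finset S).biUnion fun u => {a | s(u, a) ∈ B}) := by
    intro a ha
    rw [mem_filter] at ha
    rcases exists_of_swap_notMem hf ha.2 with ⟨u, h1, h2⟩ | ⟨u, h1, -, h2⟩
    · exact mem_union_left _ (by simp only [mem_biUnion, mem_filter, mem_univ, true_and]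
                                 exact ⟨u, h1, h2.symm⟩)
    · exact mem_union_right _ (by simp only [mem_biUnion, mem_filter, mem_univ, true_and]
                                  exact ⟨u, h2, by rwa [Sym2.eq_swap]⟩)
  refine (card_le_card hsub).trans ((card_union_le _ _).trans ?_)
  have h1 := card_biUnion_le_card_mul ({u | s(s, u) ∈ B} : Finset S)
    (fun u => ({a | f a = f u} : Finset S)) κ (fun u _ => hcol _)
  have h2 := card_biUnion_le_card_mul ({u | f u = f s} : Finset S)
    (fun u => ({a | s(u, a) ∈ B} : Finset S)) D (fun u _ => hdeg _)
  have h3 := Nat.mul_le_mul_right κ (hdeg s)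
  have h4 := Nat.mul_le_mul_right D (hcol (f s))
  nlinarith

/-- Double counting of the pairs of colourings related by a switching at the slot `s`. -/
lemma sum_card_swap (A A' : Finset (S → V)) (W : Finset S) (s : S) :
    ∑ f ∈ A', #{a ∈ W | f ∘ Equiv.swap s a ∈ A} =
      ∑ g ∈ A, #{a ∈ W | g ∘ Equiv.swap s a ∈ A'} := by
  simp only [card_filter]
  rw [sum_comm, sum_comm (s := A)]
  refine sum_congr rfl fun a _ => ?_
  rw [← card_filter, ← card_filter]
  refine card_bij' (fun f _ => f ∘ Equiv.swap s a) (fun f _ => f ∘ Equiv.swap s a) ?_ ?_ ?_ ?_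
  · intro f hf
    rw [mem_filter] at hf ⊢
    exact ⟨hf.2, by rw [swap_comp_swap]; exact hf.1⟩
  · intro f hf
    rw [mem_filter] at hf ⊢
    exact ⟨hf.2, by rw [swap_comp_swap]; exact hf.1⟩
  · intro f _; exact swap_comp_swap f s a
  · intro f _; exact swap_comp_swap f s a

/-- The basic switching inequality: among the proper colourings satisfying a condition `Q` that
involves only the slots in `W`, the slot `s ∉ W` has a colour `w` prescribed by `W` with frequency
at most about `κ' / |S|`, where `κ'` bounds the number of slots outside `W` of the colour `w`. -/
lemma card_prescribed_le {B : Finset (Sym2 S)} {d : V → ℕ} {D κ κ' : ℕ}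
    (hdeg : ∀ s, #{u | s(s, u) ∈ B} ≤ D) (hd : ∀ v, d v ≤ κ) {s : S} (W : Finset S)
    (hs : s ∉ W) (Q : (S → V) → Prop) [DecidablePred Q] (w : (S → V) → V)
    (hQ : ∀ f g, (∀ u ∈ W, f u = g u) → Q f → Q g)
    (hw : ∀ f g, (∀ u ∈ W, f u = g u) → w f = w g)
    (hκ : ∀ g ∈ colorings B d, Q g → #{a | a ∉ W ∧ g a = w g} ≤ κ') :
    (#{f ∈ colorings B d | Q f ∧ f s = w f} : ℝ) *
        ((Fintype.card S : ℝ) - 2 * D * κ - #W) ≤ κ' * #{f ∈ colorings B d | Q f} := by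
  set A := {f ∈ colorings B d | Q f} with hA
  set A' := {f ∈ colorings B d | Q f ∧ f s = w f} with hA'
  have hagree : ∀ (f : S → V) (a : S), a ∉ W → ∀ u ∈ W, f u = (f ∘ Equiv.swap s a) u := by
    intro f a ha u hu
    exact (swap_comp_apply_of_ne f (by rintro rfl; exact hs hu) (by rintro rfl; exact ha hu)).symm
  have key := sum_card_swap A A' Wᶜ s
  have hL : ∀ f ∈ A', (Fintype.card S : ℝ) - 2 * D * κ - #W ≤
      #{a ∈ Wᶜ | f ∘ Equiv.swap s a ∈ A} := by
    intro f hf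
    rw [hA', mem_filter] at hf
    have h1 := card_swap_notMem_le hdeg hd hf.1 s
    have h2 : Fintype.card S ≤ #{a ∈ Wᶜ | f ∘ Equiv.swap s a ∈ A} +
        #{a | f ∘ Equiv.swap s a ∉ colorings B d} + #W := by
      rw [← card_univ]
      refine (card_le_card (?_ : univ ⊆ ({a ∈ Wᶜ | f ∘ Equiv.swap s a ∈ A} ∪
        ({a | f ∘ Equiv.swap s a ∉ colorings B d} : Finset S)) ∪ W)).trans
        ((card_union_le _ _).trans (Nat.add_le_add_right (card_union_le _ _) _))
      intro a _
      by_cases haW : a ∈ W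
      · exact mem_union_right _ haW
      · refine mem_union_left _ ?_
        by_cases hc : f ∘ Equiv.swap s a ∈ colorings B d
        · refine mem_union_left _ ?_
          rw [mem_filter, hA, mem_filter]
          exact ⟨mem_compl.2 haW, hc, hQ f _ (hagree f a haW) hf.2.1⟩
        · exact mem_union_right _ (by simpa using hc)
    have h3 : (Fintype.card S : ℝ) ≤ (#{a ∈ Wᶜ | f ∘ Equiv.swap s a ∈ A} : ℝ) +
        #{a | f ∘ Equiv.swap s a ∉ colorings B d} + #W := by exact_mod_cast h2
    have h4 : (#{a | f ∘ Equiv.swap s a ∉ colorings B d} : ℝ) ≤ 2 * D * κ := by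
      exact_mod_cast h1
    linarith
  have hR : ∀ g ∈ A, #{a ∈ Wᶜ | g ∘ Equiv.swap s a ∈ A'} ≤ κ' := by
    intro g hg
    rw [hA, mem_filter] at hg
    refine (card_le_card ?_).trans (hκ g hg.1 hg.2)
    intro a ha
    rw [mem_filter, hA', mem_filter, mem_compl] at ha
    rw [mem_filter]
    refine ⟨mem_univ _, ha.1, ?_⟩
    have := ha.2.2.2
    rw [swap_comp_apply_left, ← hw g _ (hagree g a ha.1)] at this
    exact this
  have h5 := sum_le_sum hL
  rw [sum_const, nsmul_eq_mul] at h5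
  have h6 := sum_le_sum hR
  rw [← key, sum_const, smul_eq_mul] at h6
  refine h5.trans ?_
  rw [mul_comm (κ' : ℝ)]
  exact_mod_cast h6

lemma card_eq_prescribed_le_of_mem {B : Finset (Sym2 S)} {d : V → ℕ} {κ : ℕ}
    (hd : ∀ v, d v ≤ κ) {g : S → V} (hg : g ∈ colorings B d) (W : Finset S) (v : V) :
    #{a | a ∉ W ∧ g a = v} ≤ κ :=
  (card_le_card (by intro a; simp +contextual)).trans
    (((mem_colorings.1 hg).1 v).le.trans (hd v))

/-- Three slots outside `W` have colours prescribed by `W` with frequency `O((κ / |S|)³)`. -/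
lemma card_three_prescribed_le {B : Finset (Sym2 S)} {d : V → ℕ} {D κ : ℕ}
    (hdeg : ∀ s, #{u | s(s, u) ∈ B} ≤ D) (hd : ∀ v, d v ≤ κ) (W : Finset S) (x : Fin 3 → S)
    (hx : Function.Injective x) (hxW : ∀ i, x i ∉ W) (w : Fin 3 → (S → V) → V)
    (hw : ∀ i f g, (∀ u ∈ W, f u = g u) → w i f = w i g)
    (hpos : (0 : ℝ) ≤ (Fintype.card S : ℝ) - 2 * D * κ - #W - 2) :
    (#{f ∈ colorings B d | ∀ i, f (x i) = w i f} : ℝ) *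
        ((Fintype.card S : ℝ) - 2 * D * κ - #W - 2) ^ 3 ≤ κ ^ 3 * #(colorings B d) := by
  set L := (Fintype.card S : ℝ) - 2 * D * κ - #W - 2 with hL
  have h1 := card_prescribed_le hdeg hd W (hxW 0) (fun _ => True) (w 0) (fun _ _ _ h => h) (hw 0)
    (fun g hg _ => card_eq_prescribed_le_of_mem hd hg W _)
  have h2 := card_prescribed_le hdeg hd (insert (x 0) W) (s := x 1)
    (by simp only [mem_insert, not_or]; exact ⟨fun h => by simpa using hx h, hxW 1⟩)
    (fun f => f (x 0) = w 0 f) (w 1)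
    (fun f g h hf => by
      rw [← h _ (mem_insert_self _ _), hf, hw 0 f g fun u hu => h u (mem_insert_of_mem hu)])
    (fun f g h => hw 1 f g fun u hu => h u (mem_insert_of_mem hu))
    (fun g hg _ => card_eq_prescribed_le_of_mem hd hg _ _)
  have h3 := card_prescribed_le hdeg hd (insert (x 1) (insert (x 0) W)) (s := x 2)
    (by simp only [mem_insert, not_or]
        exact ⟨fun h => by simpa using hx h, fun h => by simpa using hx h, hxW 2⟩)
    (fun f => f (x 0) = w 0 f ∧ f (x 1) = w 1 f) (w 2)
    (fun f g h hf => by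
      have hW : ∀ u ∈ W, f u = g u := fun u hu => h u (by simp [hu])
      rw [← h (x 1) (by simp), ← h (x 0) (by simp), hf.1, hf.2, hw 0 f g hW, hw 1 f g hW]
      exact ⟨rfl, rfl⟩)
    (fun f g h => hw 2 f g fun u hu => h u (by simp [hu]))
    (fun g hg _ => card_eq_prescribed_le_of_mem hd hg _ _)
  have c1 : (#(insert (x 0) W) : ℝ) ≤ #W + 1 := by exact_mod_cast card_insert_le _ _
  have c2 : (#(insert (x 1) (insert (x 0) W)) : ℝ) ≤ #(insert (x 0) W) + 1 := by
    exact_mod_cast card_insert_le _ _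
  have e3 : {f ∈ colorings B d | ∀ i, f (x i) = w i f} =
      {f ∈ colorings B d | (f (x 0) = w 0 f ∧ f (x 1) = w 1 f) ∧ f (x 2) = w 2 f} := by
    refine filter_congr fun f _ => ?_
    rw [Fin.forall_fin_succ, Fin.forall_fin_two]
    simp [and_assoc]
  rw [e3]
  simp only [true_and, filter_true] at h1
  set a1 := #{f ∈ colorings B d | f (x 0) = w 0 f}
  set a2 := #{f ∈ colorings B d | f (x 0) = w 0 f ∧ f (x 1) = w 1 f}
  set a3 := #{f ∈ colorings B d | (f (x 0) = w 0 f ∧ f (x 1) = w 1 f) ∧ f (x 2) = w 2 f}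
  have g1 : (a1 : ℝ) * L ≤ κ * #(colorings B d) :=
    (mul_le_mul_of_nonneg_left (by rw [hL]; linarith) (by positivity)).trans h1
  have g2 : (a2 : ℝ) * L ≤ κ * a1 :=
    (mul_le_mul_of_nonneg_left (by rw [hL]; linarith) (by positivity)).trans h2
  have g3 : (a3 : ℝ) * L ≤ κ * a2 :=
    (mul_le_mul_of_nonneg_left (by rw [hL]; linarith) (by positivity)).trans h3
  calc (a3 : ℝ) * L ^ 3 = (a3 * L) * L ^ 2 := by ring
    _ ≤ (κ * a2) * L ^ 2 := by gcongr
    _ = κ * L * (a2 * L) := by ring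
    _ ≤ κ * L * (κ * a1) := by gcongr
    _ = κ ^ 2 * (a1 * L) := by ring
    _ ≤ κ ^ 2 * (κ * #(colorings B d)) := by gcongr
    _ = _ := by ring

end Switching

/-! ### The number of equitable proper colourings -/

section ProperCount

variable {S V : Type*} [Fintype S] [DecidableEq S] [Fintype V] [DecidableEq V]

lemma colorings_insert (B : Finset (Sym2 S)) (d : V → ℕ) (x y : S) :
    colorings (insert s(x, y) B) d = {f ∈ colorings B d | f x ≠ f y} := by
  ext f
  simp only [mem_filter, mem_colorings, mem_insert]
  constructor
  · rintro ⟨h1, h2⟩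
    exact ⟨⟨h1, fun a b hab => h2 a b (Or.inr hab)⟩, h2 x y (Or.inl rfl)⟩
  · rintro ⟨⟨h1, h2⟩, h3⟩
    refine ⟨h1, fun a b hab => ?_⟩
    rcases hab with hab | hab
    · rcases Sym2.eq_iff.1 hab with ⟨rfl, rfl⟩ | ⟨rfl, rfl⟩
      · exact h3
      · exact h3.symm
    · exact h2 a b hab

/-- Upper bound for the number of proper colourings in which two further slots agree. -/
lemma card_agree_le {B : Finset (Sym2 S)} {D κ : ℕ} (hdeg : ∀ s, #{u | s(s, u) ∈ B} ≤ D)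
    {x y : S} (hxy : x ≠ y) (hκ : 1 ≤ κ) :
    (#{f ∈ colorings B (fun _ : V => κ) | f x = f y} : ℝ) *
        ((Fintype.card S : ℝ) - 2 * D * κ - 1) ≤
      ((κ : ℝ) - 1) * #(colorings B (fun _ : V => κ)) := by
  have h := card_prescribed_le (V := V) hdeg (fun _ => le_refl κ) (s := x) {y}
    (by simpa using hxy) (fun _ => True) (fun f => f y) (fun _ _ _ h => h)
    (fun f g h => h y (by simp)) (κ' := κ - 1) (fun g hg _ => by
      have h1 := (mem_colorings.1 hg).1 (g y)
      have h2 : ({a | a ∉ ({y} : Finset S) ∧ g a = g y} : Finset S) =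
          ({a | g a = g y} : Finset S).erase y := by
        ext a; simp
      rw [h2, card_erase_of_mem (by simp), h1])
  simp only [true_and, filter_true, card_singleton, Nat.cast_one] at h
  rwa [Nat.cast_sub hκ, Nat.cast_one] at h

/-- Cruder bound for the number of proper colourings in which two slots agree. -/
lemma card_agree_le' {B : Finset (Sym2 S)} {D κ : ℕ} (hdeg : ∀ s, #{u | s(s, u) ∈ B} ≤ D)
    {x y : S} (hxy : x ≠ y) (hκ : 1 ≤ κ) (hM : 4 * D * κ + 6 ≤ Fintype.card S) :
    (#{f ∈ colorings B (fun _ : V => κ) | f x = f y} : ℝ) ≤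
      2 * κ / Fintype.card S * #(colorings B (fun _ : V => κ)) := by
  have h := card_agree_le (V := V) hdeg hxy hκ
  have hM' : (4 * D * κ + 6 : ℝ) ≤ Fintype.card S := by exact_mod_cast hM
  have hpos : (0 : ℝ) < Fintype.card S := by
    have : (0 : ℝ) ≤ 4 * D * κ := by positivity
    linarith
  rw [div_mul_eq_mul_div, le_div_iff₀ hpos]
  set a : ℝ := ((#{f ∈ colorings B (fun _ : V => κ) | f x = f y} : ℕ) : ℝ)
  set b : ℝ := ((#(colorings B (fun _ : V => κ)) : ℕ) : ℝ)
  have ha : 0 ≤ a := by positivity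
  have hb : 0 ≤ b := by positivity
  nlinarith

/-- Proper colourings with two prescribed coincidences. -/
lemma card_agree_agree_le {B : Finset (Sym2 S)} {D κ : ℕ}
    (hdeg : ∀ s, #{u | s(s, u) ∈ B} ≤ D) {x y a u : S} (hay : a ≠ y) (hux : u ≠ x)
    (huy : u ≠ y) (hua : u ≠ a) (hκ : 1 ≤ κ) (hM : 4 * D * κ + 6 ≤ Fintype.card S) :
    (#{f ∈ colorings B (fun _ : V => κ) | f a = f y ∧ f u = f x} : ℝ) ≤
      (2 * κ / Fintype.card S) ^ 2 * #(colorings B (fun _ : V => κ)) := by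
  have h1 := card_agree_le' (V := V) hdeg hay hκ hM
  have h := card_prescribed_le (V := V) hdeg (fun _ => le_refl κ) (s := u) {a, x, y}
    (by simp [*]) (fun f => f a = f y) (fun f => f x)
    (fun f g h hf => by rw [← h a (by simp), ← h y (by simp), hf])
    (fun f g h => h x (by simp))
    (fun g hg _ => card_eq_prescribed_le_of_mem (fun _ => le_rfl) hg _ _)
  have hM' : (4 * D * κ + 6 : ℝ) ≤ Fintype.card S := by exact_mod_cast hM
  have hpos : (0 : ℝ) < Fintype.card S := by
    have : (0 : ℝ) ≤ 4 * D * κ := by positivity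
    linarith
  have hc : (#({a, x, y} : Finset S) : ℝ) ≤ 3 := by exact_mod_cast card_le_three
  set p : ℝ := ((#{f ∈ colorings B (fun _ : V => κ) | f a = f y ∧ f u = f x} : ℕ) : ℝ)
  set q : ℝ := ((#{f ∈ colorings B (fun _ : V => κ) | f a = f y} : ℕ) : ℝ)
  set b : ℝ := ((#(colorings B (fun _ : V => κ)) : ℕ) : ℝ)
  have hp : 0 ≤ p := by positivity
  have h2 : p ≤ 2 * κ / Fintype.card S * q := by
    rw [div_mul_eq_mul_div, le_div_iff₀ hpos]
    nlinarith
  calc p ≤ 2 * κ / Fintype.card S * q := h2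
    _ ≤ 2 * κ / Fintype.card S * (2 * κ / Fintype.card S * b) := by gcongr
    _ = _ := by ring

/-- Lower bound for the number of proper colourings in which two further slots agree: almost every
switching that makes them agree keeps the colouring proper. -/
lemma le_card_agree {B : Finset (Sym2 S)} {D κ : ℕ} (hdeg : ∀ s, #{u | s(s, u) ∈ B} ≤ D)
    {x y : S} (hxy : x ≠ y) (hB : s(x, y) ∉ B) (hκ : 1 ≤ κ)
    (hM : 4 * D * κ + 6 ≤ Fintype.card S) :
    ((κ : ℝ) - 1 - 6 * D * κ ^ 2 / Fintype.card S) * #(colorings B (fun _ : V => κ)) ≤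
      #{f ∈ colorings B (fun _ : V => κ) | f x = f y} * (Fintype.card S : ℝ) := by
  set A := colorings B (fun _ : V => κ) with hA
  set A' := {f ∈ A | f x = f y} with hA'
  set M : ℝ := ((Fintype.card S : ℕ) : ℝ) with hMdef
  have hM' : (4 * D * κ + 6 : ℝ) ≤ M := by rw [hMdef]; exact_mod_cast hM
  have hpos : (0 : ℝ) < M := by
    have : (0 : ℝ) ≤ 4 * D * κ := by positivity
    linarith
  -- A switching at `x` leaves the colour of `y` alone as long as `y` itself is not exchanged.
  have key := sum_card_swap A A' {y}ᶜ x
  have hL : (∑ f ∈ A', #{a ∈ {y}ᶜ | f ∘ Equiv.swap x a ∈ A} : ℝ) ≤ #A' * M := by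
    rw [← nsmul_eq_mul]
    refine sum_le_card_nsmul _ _ _ fun f _ => ?_
    rw [hMdef]
    exact_mod_cast card_le_univ _
  -- the switchings that destroy properness, sorted by the conflict they create
  have hbad : ∀ g ∈ A, κ ≤ #{a ∈ {y}ᶜ | g ∘ Equiv.swap x a ∈ A'} + 1 +
      ((∑ u ∈ {u | s(x, u) ∈ B}, if g u = g y then κ else 0) +
        ∑ a : S, ∑ u ∈ {u | s(a, u) ∈ B},
          if a ≠ y ∧ u ≠ x ∧ u ≠ y ∧ u ≠ a ∧ g a = g y ∧ g u = g x then 1 else 0) := by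
    intro g hg
    have hg' := mem_colorings.1 hg
    have h1 : κ = #{a | g a = g y} := (hg'.1 (g y)).symm
    have hsub : ({a | g a = g y} : Finset S) ⊆
        ((({a ∈ ({y}ᶜ : Finset S) | g ∘ Equiv.swap x a ∈ A'} : Finset S) ∪ {y}) ∪
        ((({u | s(x, u) ∈ B} : Finset S).biUnion fun u =>
          if g u = g y then ({a | g a = g y} : Finset S) else ∅) ∪
        univ.biUnion fun a => ({u | s(a, u) ∈ B} : Finset S).biUnion fun u =>
          if a ≠ y ∧ u ≠ x ∧ u ≠ y ∧ u ≠ a ∧ g a = g y ∧ g u = g x then {a} else ∅)) := by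
      intro a ha
      rw [mem_filter] at ha
      have hay := ha.2
      by_cases h0 : a = y
      · simp [h0]
      by_cases h2 : g ∘ Equiv.swap x a ∈ A
      · refine mem_union_left _ (mem_union_left _ ?_)
        rw [mem_filter, hA', mem_filter]
        refine ⟨by simpa using h0, h2, ?_⟩
        rw [swap_comp_apply_left, swap_comp_apply_of_ne g hxy.symm (Ne.symm h0)]
        exact hay
      refine mem_union_right _ ?_
      rcases exists_of_swap_notMem hg h2 with ⟨u, h3, h4⟩ | ⟨u, h3, h4, h5⟩
      · refine mem_union_left _ (mem_biUnion.2 ⟨u, by simpa using h3, ?_⟩)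
        rw [if_pos (h4.trans hay)]
        simpa using hay
      · refine mem_union_right _ (mem_biUnion.2 ⟨a, mem_univ _, mem_biUnion.2
          ⟨u, by simpa using h3, ?_⟩⟩)
        have h6 := hg'.2 a u h3
        rw [if_pos ⟨h0, h4, fun h => h6 (by rw [h, hay]), fun h => h6 (by rw [h]), hay, h5⟩]
        simp
    have h7 := card_le_card hsub
    rw [← h1] at h7
    refine h7.trans ((card_union_le _ _).trans (Nat.add_le_add ?_ ?_))
    · exact (card_union_le _ _).trans (by simp)
    · refine (card_union_le _ _).trans (Nat.add_le_add ?_ ?_)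
      · refine card_biUnion_le.trans (sum_le_sum fun u _ => ?_)
        split_ifs
        · exact h1.symm.le
        · simp
      · refine card_biUnion_le.trans (sum_le_sum fun a _ => ?_)
        refine card_biUnion_le.trans (sum_le_sum fun u _ => ?_)
        split_ifs <;> simp
  have hsum := sum_le_sum hbad
  have hsumR : (κ : ℝ) * #A ≤ (∑ g ∈ A, (#{a ∈ {y}ᶜ | g ∘ Equiv.swap x a ∈ A'} : ℝ)) + #A +
      ((∑ u ∈ {u | s(x, u) ∈ B}, κ * (#{g ∈ A | g u = g y} : ℝ)) +
        ∑ a : S, ∑ u ∈ {u | s(a, u) ∈ B},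
          (#{g ∈ A | a ≠ y ∧ u ≠ x ∧ u ≠ y ∧ u ≠ a ∧ g a = g y ∧ g u = g x} : ℝ)) := by
    have e1 : ∑ g ∈ A, (∑ u ∈ {u | s(x, u) ∈ B}, if g u = g y then κ else 0) =
        ∑ u ∈ {u | s(x, u) ∈ B}, κ * #{g ∈ A | g u = g y} := by
      rw [sum_comm]
      refine sum_congr rfl fun u _ => ?_
      rw [← sum_filter, sum_const, smul_eq_mul, mul_comm]
    have e2 : ∑ g ∈ A, (∑ a : S, ∑ u ∈ {u | s(a, u) ∈ B},
          if a ≠ y ∧ u ≠ x ∧ u ≠ y ∧ u ≠ a ∧ g a = g y ∧ g u = g x then 1 else 0) =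
        ∑ a : S, ∑ u ∈ {u | s(a, u) ∈ B},
          #{g ∈ A | a ≠ y ∧ u ≠ x ∧ u ≠ y ∧ u ≠ a ∧ g a = g y ∧ g u = g x} := by
      rw [sum_comm]
      refine sum_congr rfl fun a _ => ?_
      rw [sum_comm]
      refine sum_congr rfl fun u _ => ?_
      rw [card_filter]
    rw [sum_add_distrib, sum_add_distrib, sum_add_distrib, e1, e2, sum_const, sum_const,
      smul_eq_mul, smul_eq_mul, mul_one, mul_comm (#A) κ] at hsum
    exact_mod_cast hsum
  -- On average over `g`, the new colour of `x` conflicts at a neighbour of `x` only if that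
  -- neighbour already agrees with `y`,
  have b1 : (∑ u ∈ {u | s(x, u) ∈ B}, κ * (#{g ∈ A | g u = g y} : ℝ)) ≤
      D * (κ * (2 * κ / M * #A)) := by
    refine (sum_le_card_nsmul _ _ (κ * (2 * κ / M * #A)) fun u hu => ?_).trans ?_
    · refine mul_le_mul_of_nonneg_left ?_ (by positivity)
      refine card_agree_le' hdeg ?_ hκ hM
      rintro rfl
      exact hB (by simpa using hu)
    · rw [nsmul_eq_mul]
      have := hdeg x
      gcongr
  -- and the new colour of `a` conflicts at a neighbour `u` of `a` only if two coincidences occur.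
  have b2 : (∑ a : S, ∑ u ∈ {u | s(a, u) ∈ B},
      (#{g ∈ A | a ≠ y ∧ u ≠ x ∧ u ≠ y ∧ u ≠ a ∧ g a = g y ∧ g u = g x} : ℝ)) ≤
      M * (D * ((2 * κ / M) ^ 2 * #A)) := by
    refine (sum_le_card_nsmul _ _ (D * ((2 * κ / M) ^ 2 * #A)) fun a _ => ?_).trans ?_
    · refine (sum_le_card_nsmul _ _ ((2 * κ / M) ^ 2 * #A) fun u _ => ?_).trans ?_
      · by_cases h : a ≠ y ∧ u ≠ x ∧ u ≠ y ∧ u ≠ a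
        · have := card_agree_agree_le (V := V) hdeg h.1 h.2.1 h.2.2.1 h.2.2.2 hκ hM
          simpa [h.1, h.2.1, h.2.2.1, h.2.2.2] using this
        · rw [filter_false_of_mem (fun g _ hg => h ⟨hg.1, hg.2.1, hg.2.2.1, hg.2.2.2.1⟩)]
          rw [card_empty, Nat.cast_zero]
          positivity
      · rw [nsmul_eq_mul]
        have := hdeg a
        gcongr
    · rw [nsmul_eq_mul, card_univ]
  have hkeyR : (∑ f ∈ A', (#{a ∈ {y}ᶜ | f ∘ Equiv.swap x a ∈ A} : ℝ)) =
      ∑ g ∈ A, (#{a ∈ {y}ᶜ | g ∘ Equiv.swap x a ∈ A'} : ℝ) := by exact_mod_cast key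
  have e3 : D * (κ * (2 * κ / M * #A)) + M * (D * ((2 * κ / M) ^ 2 * #A)) =
      6 * D * κ ^ 2 / M * #A := by
    field_simp; ring
  nlinarith

/-- Proved by comparing `(1 - q) (1 + q + q² / 2)` with one. -/
lemma exp_neg_sub_sq_le {q : ℝ} (h0 : 0 ≤ q) (h1 : q ≤ 1 / 2) :
    Real.exp (-q - q ^ 2) ≤ 1 - q := by
  have h2 : 0 < 1 - q := by linarith
  have h3 : -q - q ^ 2 ≤ Real.log (1 - q) := by
    have h4 := Real.one_sub_inv_le_log_of_pos (x := (1 - q) * (1 + q + q ^ 2 / 2)) (by positivity)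
    have h5 : Real.log ((1 - q) * (1 + q + q ^ 2 / 2)) =
        Real.log (1 - q) + Real.log (1 + q + q ^ 2 / 2) := Real.log_mul h2.ne' (by positivity)
    have h6 : Real.log (1 + q + q ^ 2 / 2) ≤ q := by
      rw [Real.log_le_iff_le_exp (by positivity)]
      exact Real.quadratic_le_exp_of_nonneg h0
    have h7 : ((1 - q) * (1 + q + q ^ 2 / 2))⁻¹ ≤ 1 + q ^ 2 := by
      rw [inv_le_comm₀ (by positivity) (by positivity), inv_le_iff_one_le_mul₀ (by positivity)]
      nlinarith [pow_nonneg h0 2, pow_nonneg h0 3, pow_nonneg h0 4, pow_nonneg h0 5,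
        mul_nonneg (pow_nonneg h0 2) (sub_nonneg.2 h1)]
    linarith
  exact (Real.exp_le_exp.2 h3).trans (Real.exp_log h2).le

/-- Adding one conflict to the graph multiplies the number of proper colourings by
`exp (-(κ - 1) / M + O(D κ² / M²))`. -/
lemma card_colorings_insert {B : Finset (Sym2 S)} {D κ : ℕ}
    (hdeg : ∀ s, #{u | s(s, u) ∈ B} ≤ D) {x y : S} (hxy : x ≠ y) (hB : s(x, y) ∉ B)
    (hκ : 1 ≤ κ) (hD : 1 ≤ D) (hM : 4 * D * κ + 6 ≤ Fintype.card S) :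
    #(colorings B (fun _ : V => κ)) * Real.exp (-((κ : ℝ) - 1) / Fintype.card S -
        10 * D * κ ^ 2 / (Fintype.card S : ℝ) ^ 2) ≤
      #(colorings (insert s(x, y) B) (fun _ : V => κ)) ∧
    #(colorings (insert s(x, y) B) (fun _ : V => κ)) ≤
      #(colorings B (fun _ : V => κ)) * Real.exp (-((κ : ℝ) - 1) / Fintype.card S +
        10 * D * κ ^ 2 / (Fintype.card S : ℝ) ^ 2) := by
  have h1 := card_agree_le (V := V) hdeg hxy hκ
  have h2 := le_card_agree (V := V) hdeg hxy hB hκ hM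
  have h3 : (#(colorings (insert s(x, y) B) (fun _ : V => κ)) : ℝ) =
      #(colorings B (fun _ : V => κ)) - #{f ∈ colorings B (fun _ : V => κ) | f x = f y} := by
    rw [colorings_insert, eq_sub_iff_add_eq', ← card_filter_add_card_filter_not (s := colorings B _)
      (fun f => f x = f y)]
    push_cast; rfl
  rw [h3]
  set a : ℝ := ((#{f ∈ colorings B (fun _ : V => κ) | f x = f y} : ℕ) : ℝ)
  set b : ℝ := ((#(colorings B (fun _ : V => κ)) : ℕ) : ℝ)
  set M : ℝ := ((Fintype.card S : ℕ) : ℝ) with hMdef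
  have hM' : (4 * D * κ + 6 : ℝ) ≤ M := by rw [hMdef]; exact_mod_cast hM
  have hκ' : (1 : ℝ) ≤ κ := by exact_mod_cast hκ
  have hD' : (1 : ℝ) ≤ D := by exact_mod_cast hD
  have hDκ : (κ : ℝ) ≤ D * κ := by nlinarith
  have hpos : 0 < M := by nlinarith
  have hL : 0 < M - 2 * D * κ - 1 := by nlinarith
  have ha : 0 ≤ a := by positivity
  rcases (show (0 : ℝ) ≤ b by positivity).eq_or_lt with hb | hb
  · have : a ≤ 0 := by
      by_contra! h
      rw [← hb] at h1
      nlinarith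
    rw [← hb]
    constructor <;> linarith
  obtain ⟨q, hq⟩ : ∃ q, a = q * b := ⟨a / b, by field_simp⟩
  rw [hq] at h1 h2 ha ⊢
  have hq0 : 0 ≤ q := nonneg_of_mul_nonneg_left ha hb
  have hq1 : q * (M - 2 * D * κ - 1) ≤ κ - 1 := by
    have : (q * (M - 2 * D * κ - 1)) * b ≤ (κ - 1) * b := by linarith
    exact le_of_mul_le_mul_right this hb
  have hq2 : (κ : ℝ) - 1 - 6 * D * κ ^ 2 / M ≤ q * M := by
    have : ((κ : ℝ) - 1 - 6 * D * κ ^ 2 / M) * b ≤ (q * M) * b := by linarith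
    exact le_of_mul_le_mul_right this hb
  have hqM : q ≤ 2 * κ / M := by
    rw [le_div_iff₀ hpos]; nlinarith
  have hqhalf : q ≤ 1 / 2 := by
    refine hqM.trans ?_
    rw [div_le_iff₀ hpos]; nlinarith
  have hsq : q ^ 2 ≤ 4 * κ ^ 2 / M ^ 2 := by
    calc q ^ 2 ≤ (2 * κ / M) ^ 2 := by gcongr
      _ = _ := by ring
  have hsq' : 4 * (κ : ℝ) ^ 2 / M ^ 2 ≤ 4 * D * κ ^ 2 / M ^ 2 := by
    gcongr; nlinarith
  constructor
  · have h5 : q ≤ (κ - 1) / M + 6 * D * κ ^ 2 / M ^ 2 := by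
      have h6 : q * M ≤ (κ - 1) + 6 * D * κ ^ 2 / M := by
        have : q * (2 * D * κ + 1) ≤ 6 * D * κ ^ 2 / M := by
          calc q * (2 * D * κ + 1) ≤ (2 * κ / M) * (3 * D * κ) := by
                gcongr; nlinarith
            _ = _ := by ring
        linarith
      have h7 : q = (q * M) / M := by field_simp
      rw [h7]
      calc (q * M) / M ≤ ((κ - 1) + 6 * D * κ ^ 2 / M) / M := by gcongr
        _ = _ := by field_simp
    have h8 := exp_neg_sub_sq_le hq0 hqhalf
    have h9 : Real.exp (-((κ : ℝ) - 1) / M - 10 * D * κ ^ 2 / M ^ 2) ≤ Real.exp (-q - q ^ 2) := by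
      rw [Real.exp_le_exp]
      have e1 : 10 * D * (κ : ℝ) ^ 2 / M ^ 2 = 6 * D * κ ^ 2 / M ^ 2 + 4 * D * κ ^ 2 / M ^ 2 := by
        ring
      rw [e1, neg_div]
      linarith
    nlinarith
  · have h5 : (κ - 1) / M - 6 * D * κ ^ 2 / M ^ 2 ≤ q := by
      have h7 : q = (q * M) / M := by field_simp
      rw [h7]
      calc _ = ((κ - 1) - 6 * D * κ ^ 2 / M) / M := by field_simp
        _ ≤ (q * M) / M := by gcongr
    have h8 := Real.one_sub_le_exp_neg q
    have h9 : Real.exp (-q) ≤ Real.exp (-((κ : ℝ) - 1) / M + 10 * D * κ ^ 2 / M ^ 2) := by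
      rw [Real.exp_le_exp]
      have e1 : 10 * D * (κ : ℝ) ^ 2 / M ^ 2 = 6 * D * κ ^ 2 / M ^ 2 + 4 * D * κ ^ 2 / M ^ 2 := by
        ring
      have : 0 ≤ 4 * D * (κ : ℝ) ^ 2 / M ^ 2 := by positivity
      rw [e1, neg_div]
      linarith
    nlinarith

/-- The number of equitable proper colourings of a conflict graph of maximum degree at most `D`,
by inserting the conflicts one at a time. -/
theorem card_colorings_bounds {D κ : ℕ} (hκ : 1 ≤ κ) (hD : 1 ≤ D)
    (hM : 4 * D * κ + 6 ≤ Fintype.card S) (B : Finset (Sym2 S)) (hB : ∀ e ∈ B, ¬ e.IsDiag)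
    (hdeg : ∀ s, #{u | s(s, u) ∈ B} ≤ D) :
    #(colorings (∅ : Finset (Sym2 S)) (fun _ : V => κ)) *
        Real.exp (#B * (-((κ : ℝ) - 1) / Fintype.card S -
        10 * D * κ ^ 2 / (Fintype.card S : ℝ) ^ 2)) ≤
      #(colorings B (fun _ : V => κ)) ∧
    #(colorings B (fun _ : V => κ)) ≤
      #(colorings (∅ : Finset (Sym2 S)) (fun _ : V => κ)) *
        Real.exp (#B * (-((κ : ℝ) - 1) / Fintype.card S +
        10 * D * κ ^ 2 / (Fintype.card S : ℝ) ^ 2)) := by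
  induction B using Finset.induction with
  | empty => simp
  | insert e B he ih =>
    have hdeg' : ∀ s, #{u | s(s, u) ∈ B} ≤ D := fun s =>
      (card_le_card (by intro u; simp +contextual)).trans (hdeg s)
    have ih := ih (fun e h => hB e (mem_insert_of_mem h)) hdeg'
    induction e using Sym2.ind with
    | _ x y =>
      have hxy : x ≠ y := by simpa using hB _ (mem_insert_self _ _)
      have h := card_colorings_insert (V := V) hdeg' hxy he hκ hD hM
      rw [card_insert_of_notMem he]
      push_cast
      have e1 : ∀ c : ℝ, Real.exp ((#B + 1) * c) = Real.exp (#B * c) * Real.exp c := fun c => by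
        rw [add_mul, one_mul, Real.exp_add]
      rw [e1, e1, ← mul_assoc, ← mul_assoc]
      exact ⟨(mul_le_mul_of_nonneg_right ih.1 (Real.exp_pos _).le).trans h.1,
        h.2.trans (mul_le_mul_of_nonneg_right ih.2 (Real.exp_pos _).le)⟩

end ProperCount

/-! ### Functions with prescribed fibre sizes -/

section FiberCount

variable {S V : Type*} [Fintype S] [DecidableEq S] [Fintype V] [DecidableEq V]

lemma exists_equiv_of_card_fiber_eq {f f₀ : S → V}
    (h : ∀ v, #{s | f s = v} = #{s | f₀ s = v}) : ∃ σ : Equiv.Perm S, f₀ ∘ σ = f := by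
  have hc : ∀ v, Nonempty ({s // f s = v} ≃ {s // f₀ s = v}) := fun v => by
    rw [← Fintype.card_eq, Fintype.card_subtype, Fintype.card_subtype]
    exact h v
  exact ⟨Equiv.ofFiberEquiv fun v => (hc v).some, funext fun s => Equiv.ofFiberEquiv_map _ _⟩

lemma colorings_empty_nonempty {d : V → ℕ} (hd : ∑ v, d v = Fintype.card S) :
    (colorings (∅ : Finset (Sym2 S)) d).Nonempty := by
  have e : S ≃ Σ v, Fin (d v) := Fintype.equivOfCardEq (by simp [hd])
  refine ⟨fun s => (e s).1, mem_colorings.2 ⟨fun v => ?_, by simp⟩⟩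
  have h1 : #{s | (e s).1 = v} = #{x : Σ v, Fin (d v) | x.1 = v} :=
    card_equiv e (by simp)
  have h2 : ({x : Σ v, Fin (d v) | x.1 = v} : Finset _) =
      univ.map (Function.Embedding.sigmaMk (β := fun v => Fin (d v)) v) := by
    ext ⟨a, b⟩
    simp only [mem_filter, mem_univ, true_and, Finset.mem_map, Function.Embedding.sigmaMk_apply]
    constructor
    · rintro rfl; exact ⟨b, rfl⟩
    · rintro ⟨c, hc⟩; exact (congrArg Sigma.fst hc).symm
  rw [h1, h2, card_map, card_univ, Fintype.card_fin]

/-- The multinomial count of the functions with prescribed fibre sizes. -/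
theorem card_colorings_empty {d : V → ℕ} (hd : ∑ v, d v = Fintype.card S) :
    #(colorings (∅ : Finset (Sym2 S)) d) * ∏ v, (d v).factorial =
      (Fintype.card S).factorial := by
  obtain ⟨f₀, hf₀⟩ := colorings_empty_nonempty (S := S) hd
  have hf₀' := (mem_colorings.1 hf₀).1
  have h1 : #(univ : Finset (Equiv.Perm S)) =
      ∑ f ∈ colorings (∅ : Finset (Sym2 S)) d, #{σ : Equiv.Perm S | f₀ ∘ ⇑σ = f} := by
    refine card_eq_sum_card_fiberwise (f := fun σ : Equiv.Perm S => f₀ ∘ ⇑σ) fun σ _ => ?_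
    exact mem_coe.2 (mem_colorings.2
      ⟨fun v => by rw [card_fiber_comp_equiv]; exact hf₀' v, by simp⟩)
  have h2 : ∀ f ∈ colorings (∅ : Finset (Sym2 S)) d,
      #{σ : Equiv.Perm S | f₀ ∘ ⇑σ = f} = ∏ v, (d v).factorial := by
    intro f hf
    obtain ⟨τ, hτ⟩ := exists_equiv_of_card_fiber_eq (f := f) (f₀ := f₀)
      (fun v => by rw [hf₀' v, (mem_colorings.1 hf).1 v])
    have h3 : #{σ : Equiv.Perm S | f₀ ∘ ⇑σ = f} =
        #{σ : Equiv.Perm S | f₀ ∘ ⇑σ = f₀} := by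
      refine card_equiv (Equiv.mulRight τ⁻¹) fun σ => ?_
      simp only [mem_filter, mem_univ, true_and, Equiv.coe_mulRight, Equiv.Perm.coe_mul]
      rw [← hτ, ← Function.comp_assoc]
      constructor
      · intro h; rw [h, Function.comp_assoc, ← Equiv.Perm.coe_mul]; simp
      · intro h
        nth_rewrite 2 [← h]
        rw [Function.comp_assoc, ← Equiv.Perm.coe_mul]; simp
    rw [h3, ← Fintype.card_subtype, DomMulAct.stabilizer_card]
    refine prod_congr rfl fun v _ => ?_
    rw [Fintype.card_subtype, hf₀' v]
  rw [sum_congr rfl h2, sum_const, smul_eq_mul, card_univ, Fintype.card_perm] at h1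
  exact h1.symm

end FiberCount

/-! ### The weighted Cayley formula -/

section Cayley

/-- Vertices are grouped into blocks by `g` (`none` is the root block), and every other block `j`
has a parent vertex `p j`. The parent map is acyclic if the blocks carry a rank that decreases
along it; equivalently, iterating it leads from every block to the root block. -/
def Acyc {V β : Type*} (g : V → Option β) (p : β → V) : Prop :=
  ∃ d : β → ℕ, ∀ j i, g (p j) = some i → d i < d j

variable {R : Type*} [CommRing R]

/-- The algebraic identity behind the induction in `sum_acyc`: the set `C` of the blocks attached to
the root contributes `x ^ #C`, and the weighted Cayley formula, applied to what remains, the other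
factor. -/
lemma sum_finset_ssubset_pow {β : Type*} [Fintype β] [DecidableEq β] {b : ℕ}
    (hb : Fintype.card β = b + 1) (w : β → R) (x : R) :
    x ^ (b + 1) + ∑ C ∈ (univ : Finset (Finset β)).erase univ,
      x ^ #C * ((∑ i ∈ C, w i) * (∑ i, w i) ^ (b - #C)) = x * (x + ∑ i, w i) ^ b := by
  set W := ∑ i, w i with hW
  set s : R := ∑ m ∈ range b, (b.choose m : R) * (x ^ (m + 1) * W ^ (b - (m + 1))) with hs
  have h1 : ∑ C ∈ (univ : Finset (Finset β)).erase univ,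
      x ^ #C * ((∑ i ∈ C, w i) * W ^ (b - #C)) = ∑ i, w i * s := by
    have h2 : ∀ C : Finset β, x ^ #C * ((∑ i ∈ C, w i) * W ^ (b - #C)) =
        ∑ i, if i ∈ C then w i * (x ^ #C * W ^ (b - #C)) else 0 := by
      intro C
      rw [← sum_filter, filter_mem_eq_inter, univ_inter, sum_mul, mul_sum]
      exact sum_congr rfl fun i _ => by ring
    rw [sum_congr rfl fun C _ => h2 C, sum_comm]
    refine sum_congr rfl fun i _ => ?_
    rw [← sum_filter, ← mul_sum]
    congr 1
    have h3 : ∑ C ∈ (univ : Finset (Finset β)).erase univ with i ∈ C, x ^ #C * W ^ (b - #C) =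
        ∑ C ∈ (univ.erase i : Finset β).powerset,
          if #C ≠ b then x ^ (#C + 1) * W ^ (b - (#C + 1)) else 0 := by
      have hcard : ∀ C ∈ (univ.erase i : Finset β).powerset, #(insert i C) = #C + 1 := by
        intro C hC
        exact card_insert_of_notMem fun h => by simpa using mem_powerset.1 hC h
      have h4 : ∀ C ∈ (univ.erase i : Finset β).powerset, (#C = b ↔ insert i C = univ) := by
        intro C hC
        rw [← card_eq_iff_eq_univ, hcard C hC, hb]
        simp
      rw [← sum_filter]
      refine (sum_bij' (fun C _ => insert i C) (fun C _ => C.erase i) ?_ ?_ ?_ ?_ ?_).symm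
      · intro C hC
        rw [mem_filter] at hC
        rw [mem_filter, mem_erase]
        exact ⟨⟨fun h => hC.2 ((h4 C hC.1).2 h), mem_univ _⟩, mem_insert_self _ _⟩
      · intro C hC
        rw [mem_filter, mem_erase] at hC
        have h5 : C.erase i ∈ (univ.erase i : Finset β).powerset :=
          mem_powerset.2 (erase_subset_erase _ (subset_univ _))
        rw [mem_filter, Ne, h4 _ h5, insert_erase hC.2]
        exact ⟨h5, hC.1.1⟩
      · intro C hC
        rw [mem_filter] at hC
        exact erase_insert fun h => by simpa using mem_powerset.1 hC.1 h
      · intro C hC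
        exact insert_erase (mem_filter.1 hC).2
      · intro C hC
        rw [hcard C (mem_filter.1 hC).1]
    rw [h3, sum_powerset_apply_card (fun m => if m ≠ b then x ^ (m + 1) * W ^ (b - (m + 1)) else 0),
      card_erase_of_mem (mem_univ _), card_univ, hb, Nat.add_sub_cancel, sum_range_succ]
    simp only [ne_eq, not_true_eq_false, if_false, smul_zero, add_zero, nsmul_eq_mul]
    refine sum_congr rfl fun m hm => ?_
    rw [if_pos (mem_range.1 hm).ne]
  have h2 : W * s = ∑ m ∈ range b, x * (x ^ m * W ^ (b - m) * (b.choose m : R)) := by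
    rw [hs, mul_sum]
    refine sum_congr rfl fun m hm => ?_
    have h3 : b - m = (b - (m + 1)) + 1 := by have := mem_range.1 hm; omega
    rw [h3]; ring
  rw [h1, ← sum_mul, ← hW, h2, add_pow, mul_sum, sum_range_succ]
  simp [pow_succ]
  ring

open Classical in
/-- The contribution to the weighted Cayley formula of the parent maps for which `C` is the set of
the blocks with parent in the root block. The other blocks form the same kind of structure again,
with the vertices of the blocks in `C` as its root block. -/
lemma sum_acyc_fiber {β V : Type*} [Fintype β] [Fintype V] (g : V → Option β) (z : V → R)
    (C : Finset β) :
    ∑ p : β → V with Acyc g p ∧ ({j | g (p j) = none} : Finset β) = C, ∏ j, z (p j) =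
      (∑ v with g v = none, z v) ^ #C *
      ∑ q : {j // j ∉ C} → {v // g v ≠ none} with
        Acyc (fun v : {v // g v ≠ none} => (g v).bind fun i =>
          if h : i ∈ C then none else some (⟨i, h⟩ : {j // j ∉ C})) q,
        ∏ j, z (q j) := by
  have e1 : (∑ v with g v = none, z v) ^ #C =
      ∑ a : {j // j ∈ C} → {v // g v = none}, ∏ j, z (a j) := by
    rw [← Fintype.card_coe C, ← card_univ, ← prod_const]
    have : (∑ v with g v = none, z v) = ∑ v : {v // g v = none}, z v := by
      rw [← sum_subtype_eq_sum_filter, subtype_univ]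
    rw [this, Finset.prod_univ_sum]
    simp
  rw [e1, sum_mul_sum, ← sum_product']
  have hC : ∀ {p : β → V}, ({j | g (p j) = none} : Finset β) = C → ∀ j, g (p j) = none ↔ j ∈ C := by
    rintro p rfl j; simp
  refine sum_bij'
    (fun p hp => (fun j => ⟨p j, ((hC (mem_filter.1 hp).2.2) j).2 j.2⟩,
      fun j => ⟨p j, fun h => j.2 (((hC (mem_filter.1 hp).2.2) j).1 h)⟩))
    (fun aq _ => fun j => if h : j ∈ C then (aq.1 ⟨j, h⟩ : V) else (aq.2 ⟨j, h⟩ : V)) ?_ ?_ ?_ ?_ ?_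
  · intro p hp
    obtain ⟨-, ⟨d, hd⟩, hp2⟩ := mem_filter.1 hp
    simp only [mem_product, mem_univ, true_and, mem_filter]
    refine ⟨fun j => d j, fun j i h => hd j i ?_⟩
    simp only [Option.bind_eq_some_iff] at h
    obtain ⟨i', h1, h2⟩ := h
    split_ifs at h2 with h3
    rw [h1, ← Option.some_inj.1 h2]
  · rintro ⟨a, q⟩ haq
    simp only [mem_product, mem_univ, true_and, mem_filter] at haq
    obtain ⟨d, hd⟩ := haq
    simp only [mem_filter, mem_univ, true_and]
    refine ⟨⟨fun j => if h : j ∈ C then 0 else d ⟨j, h⟩ + 1, fun j i h => ?_⟩, ?_⟩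
    · dsimp only at h ⊢
      by_cases hj : j ∈ C
      · rw [dif_pos hj, (a ⟨j, hj⟩).2] at h
        simp at h
      · rw [dif_neg hj] at h ⊢
        by_cases hi : i ∈ C
        · simp [hi]
        · rw [dif_neg hi]
          exact Nat.add_lt_add_right (hd ⟨j, hj⟩ ⟨i, hi⟩ (by simp [h, hi])) 1
    · ext j
      simp only [mem_filter, mem_univ, true_and]
      by_cases hj : j ∈ C
      · simp [hj, (a ⟨j, hj⟩).2]
      · simp [hj, (q ⟨j, hj⟩).2]
  · intro p hp
    ext j
    simp
  · rintro ⟨a, q⟩ haq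
    ext j
    · simp [j.2]
    · simp [j.2]
  · intro p hp
    simp only
    rw [← Fintype.prod_subtype_mul_prod_subtype (fun j => j ∈ C)]
    congr!

open Classical in
/-- **Weighted Cayley formula** for blocks: the sum of `∏ j, z (p j)` over all acyclic parent maps
`p` on `b + 1` blocks. The induction removes the set `C` of the blocks whose parent lies in the root
block; the vertices of these blocks form the root block of what remains. -/
theorem sum_acyc (b : ℕ) : ∀ {β V : Type} [Fintype β] [Fintype V] (g : V → Option β)
    (z : V → R), Fintype.card β = b + 1 →
    ∑ p : β → V with Acyc g p, ∏ j, z (p j) =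
      (∑ v with g v = none, z v) * (∑ v, z v) ^ b := by
  induction b using Nat.strong_induction_on with
  | _ b ih =>
    intro β V _ _ g z hβ
    set w : β → R := fun i => ∑ v with g v = some i, z v with hw
    set x : R := ∑ v with g v = none, z v with hx
    have htot : ∑ v, z v = x + ∑ i, w i := by
      rw [← sum_fiberwise univ g z, Fintype.sum_option]
    have hne : ∑ v : {v // g v ≠ none}, z v = ∑ i, w i := by
      have h1 : ∑ v : {v // g v ≠ none}, z v = ∑ v with g v ≠ none, z v := by
        rw [← sum_subtype_eq_sum_filter, subtype_univ]
      have h2 := sum_filter_add_sum_filter_not univ (fun v => g v = none) z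
      rw [htot] at h2
      rw [h1]
      exact add_left_cancel h2
    rw [htot, ← sum_finset_ssubset_pow hβ w x]
    have hsplit : ∑ p : β → V with Acyc g p, ∏ j, z (p j) = ∑ C : Finset β,
        ∑ p : β → V with Acyc g p ∧ ({j | g (p j) = none} : Finset β) = C, ∏ j, z (p j) := by
      rw [← sum_fiberwise _ (fun p : β → V => ({j | g (p j) = none} : Finset β))]
      simp only [filter_filter]
    rw [hsplit, ← add_sum_erase _ _ (mem_univ (univ : Finset β))]
    congr 1
    · rw [sum_acyc_fiber, ← hx, card_univ, hβ]
      have : IsEmpty {j : β // j ∉ (univ : Finset β)} := ⟨fun j => j.2 (mem_univ _)⟩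
      rw [sum_filter_of_ne fun q _ _ => ⟨fun j => this.elim j, fun j => this.elim j⟩]
      simp
    · refine sum_congr rfl fun C hC => ?_
      rw [sum_acyc_fiber, ← hx]
      congr 1
      have hlt : #C < b + 1 := by
        rw [← hβ]; exact (card_lt_iff_ne_univ C).2 (mem_erase.1 hC).1
      rcases C.eq_empty_or_nonempty with rfl | hCne
      · -- no block has its parent in the root block, against the rank of a lowest block
        rw [sum_empty, zero_mul, filter_false_of_mem, sum_empty]
        rintro q - ⟨d, hd⟩
        have : Nonempty {j : β // j ∉ (∅ : Finset β)} := by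
          obtain ⟨j⟩ : Nonempty β := Fintype.card_pos_iff.1 (by omega)
          exact ⟨⟨j, by simp⟩⟩
        obtain ⟨j, hj⟩ := Finite.exists_min d
        obtain ⟨i, hi⟩ := Option.ne_none_iff_exists'.1 (q j).2
        exact absurd (hd j ⟨i, by simp⟩ (by simp [hi])) (hj _).not_gt
      have h0 := hCne.card_pos
      have := ih (b - #C) (by omega) (β := {j // j ∉ C}) (V := {v // g v ≠ none})
        (fun v : {v // g v ≠ none} => (g v).bind fun i =>
          if h : i ∈ C then none else some (⟨i, h⟩ : {j // j ∉ C})) (fun v => z v)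
        (by rw [Fintype.card_subtype_compl, Fintype.card_coe, hβ]; omega)
      rw [hne] at this
      refine Eq.trans (by congr!) (this.trans ?_)
      congr 1
      have h2 : ∀ v, g v ≠ none → (((g v).bind fun i =>
          if h : i ∈ C then none else some (⟨i, h⟩ : {j // j ∉ C})) = none ↔ ∃ i ∈ C, g v = some i) := by
        intro v hv
        obtain ⟨i, hi⟩ := Option.ne_none_iff_exists'.1 hv
        simp [hi]
      have h3 : ∑ i ∈ C, w i = ∑ v with ∃ i ∈ C, g v = some i, z v := by
        have : ({v | ∃ i ∈ C, g v = some i} : Finset V) =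
            C.biUnion fun i => ({v | g v = some i} : Finset V) := by
          ext v; simp
        rw [this, sum_biUnion]
        intro i _ i' _ hii
        refine disjoint_left.2 fun v hv hv' => hii ?_
        simp only [mem_filter, mem_univ, true_and] at hv hv'
        exact Option.some_inj.1 (hv.symm.trans hv')
      rw [h3]
      refine sum_bij' (fun v _ => (v : V)) (fun v hv => ⟨v, ?_⟩) ?_ ?_ ?_ ?_ ?_
      · obtain ⟨i, -, hi⟩ := (mem_filter.1 hv).2
        simp [hi]
      · intro v hv
        rw [mem_filter] at hv ⊢
        exact ⟨mem_univ _, (h2 v v.2).1 hv.2⟩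
      · intro v hv
        rw [mem_filter] at hv ⊢
        obtain ⟨i, -, hi⟩ := hv.2
        exact ⟨mem_univ _, (h2 v (by simp [hi])).2 hv.2⟩
      all_goals simp

end Cayley

/-! ### Codes of rooted hypertrees -/

section Codes

open Classical in
/-- The weighted Cayley formula in terms of the numbers `#{j | p j = v}` of blocks below each
vertex, for a root block consisting of one vertex. With indeterminates for the weights, the formula
is an identity of polynomials, to which the linear map sending the monomial of exponent `m` to `φ m`
is applied. -/
theorem sum_acyc_card {b : ℕ} {β V : Type} [Fintype β] [Fintype V]
    {g : V → Option β} {ρ : V} (hg : ∀ v, g v = none ↔ v = ρ) (hβ : Fintype.card β = b + 1)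
    (φ : (V → ℕ) → ℝ) :
    ∑ p : β → V with Acyc g p, φ (fun v => #{j | p j = v}) =
      ∑ h : Fin b → V, φ (fun v => #{i | h i = v} + if v = ρ then 1 else 0) := by
  set Φ : MvPolynomial V ℝ →ₗ[ℝ] ℝ :=
    (MvPolynomial.basisMonomials V ℝ).constr ℝ (fun m => φ m) with hΦ
  have hmon : ∀ m : V →₀ ℕ, Φ (MvPolynomial.monomial m 1) = φ m := by
    intro m
    have := (MvPolynomial.basisMonomials V ℝ).constr_basis ℝ (fun m : V →₀ ℕ => φ m) m
    rwa [MvPolynomial.coe_basisMonomials] at this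
  have hprod : ∀ {γ : Type} [Fintype γ] (p : γ → V),
      (∏ j, (MvPolynomial.X (p j) : MvPolynomial V ℝ)) =
        MvPolynomial.monomial (∑ j, Finsupp.single (p j) 1) 1 := by
    intro γ _ p
    simp only [MvPolynomial.X]
    rw [MvPolynomial.monomial_sum_one]
  have hcount : ∀ {γ : Type} [Fintype γ] (p : γ → V) (v : V),
      (∑ j, Finsupp.single (p j) 1 : V →₀ ℕ) v = #{j | p j = v} := by
    intro γ _ p v
    rw [Finsupp.finsetSum_apply, card_filter]
    exact sum_congr rfl fun j _ => by rw [Finsupp.single_apply]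
  have key := congrArg Φ (sum_acyc (R := MvPolynomial V ℝ) b g MvPolynomial.X hβ)
  have hroot : ({v | g v = none} : Finset V) = {ρ} := by ext v; simp [hg]
  rw [hroot, sum_singleton, Finset.sum_pow', mul_sum, map_sum, map_sum] at key
  have e1 : ∀ p : β → V, Φ (∏ j, MvPolynomial.X (p j)) = φ (fun v => #{j | p j = v}) := by
    intro p
    rw [hprod, hmon]
    congr 1
    funext v
    exact hcount p v
  have e2 : ∀ h : Fin b → V, Φ (MvPolynomial.X ρ * ∏ i, MvPolynomial.X (h i)) =
      φ (fun v => #{i | h i = v} + if v = ρ then 1 else 0) := by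
    intro h
    rw [hprod, MvPolynomial.X, MvPolynomial.monomial_mul, one_mul, hmon]
    congr 1
    funext v
    rw [Finsupp.add_apply, hcount, add_comm, Finsupp.single_apply]
    simp only [eq_comm]
  simp only [e1, e2] at key
  rw [key]
  refine sum_congr ?_ fun _ _ => rfl
  ext; simp

/-- The number of ways to group the vertices other than `ρ` into blocks of size `s`. -/
lemma card_grouping {V : Type} [Fintype V] [DecidableEq V] (ρ : V) {t s : ℕ}
    (hV : Fintype.card V = t * s + 1) :
    #{g : V → Option (Fin t) | (∀ v, g v = none ↔ v = ρ) ∧ ∀ j, #{v | g v = some j} = s} *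
      s.factorial ^ t = (t * s).factorial := by
  have hcard : Fintype.card {v : V // v ≠ ρ} = t * s := by
    rw [Fintype.card_subtype_compl]; simp [hV]
  have h := card_colorings_empty (S := {v : V // v ≠ ρ}) (d := fun _ : Fin t => s)
    (by simp [hcard])
  rw [hcard] at h
  rw [← h]
  simp only [prod_const, card_univ, Fintype.card_fin]
  congr 1
  have hfib : ∀ (g : V → Option (Fin t)) (f : {v : V // v ≠ ρ} → Fin t), g ρ = none →
      (∀ v : {v : V // v ≠ ρ}, g v = some (f v)) →
      ∀ j, #{v | g v = some j} = #{v | f v = j} := by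
    intro g f h0 h1 j
    refine (card_bij (fun (v : {v : V // v ≠ ρ}) _ => (v : V)) ?_ ?_ ?_).symm
    · intro v hv
      simpa [h1] using hv
    · intro a _ b _ hab
      exact Subtype.ext hab
    · intro v hv
      rw [mem_filter] at hv
      have hvρ : v ≠ ρ := by rintro rfl; rw [h0] at hv; simp at hv
      refine ⟨⟨v, hvρ⟩, ?_, rfl⟩
      have := (h1 ⟨v, hvρ⟩).symm.trans hv.2
      simpa using this
  have hsome : ∀ {g : V → Option (Fin t)}, (∀ v, g v = none ↔ v = ρ) → ∀ v : {v : V // v ≠ ρ},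
      (g v).isSome := fun hg v => Option.isSome_iff_ne_none.2 fun h => v.2 ((hg v).1 h)
  refine card_bij' (fun g hg => fun v => (g v).get (hsome (mem_filter.1 hg).2.1 v))
    (fun f _ => fun v => if h : v = ρ then none else some (f ⟨v, h⟩)) ?_ ?_ ?_ ?_
  · intro g hg
    obtain ⟨-, h1, h2⟩ := mem_filter.1 hg
    rw [mem_colorings]
    refine ⟨fun j => ?_, by simp⟩
    exact (hfib g _ ((h1 ρ).2 rfl) (fun v => by simp) j).symm.trans (h2 j)
  · intro f hf
    rw [mem_colorings] at hf
    rw [mem_filter]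
    refine ⟨mem_univ _, fun v => by by_cases h : v = ρ <;> simp [h], fun j => ?_⟩
    rw [← hf.1 j]
    exact hfib _ f (by simp) (fun v => by simp [v.2]) j
  · intro g hg
    obtain ⟨-, h1, -⟩ := mem_filter.1 hg
    funext v
    by_cases h : v = ρ
    · simp [h, (h1 ρ).2 rfl]
    · simp [h]
  · intro f hf
    funext v
    simp [v.2]

/-- A code of a hypertree rooted at `ρ` with `t` labelled edges of size `s + 1`: the map `g` sends a
vertex other than `ρ` to the edge that leads from it towards `ρ`, and `p` sends an edge to its
vertex nearest to `ρ`. -/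
def IsCode {V : Type} [Fintype V] [DecidableEq V] (ρ : V) (s : ℕ) {t : ℕ}
    (g : V → Option (Fin t)) (p : Fin t → V) : Prop :=
  ((∀ v, g v = none ↔ v = ρ) ∧ ∀ j, #{v | g v = some j} = s) ∧ Acyc g p

open Classical in
/-- The degree enumerator of codes. In the hypertree of a code `(g, p)`, a vertex `v` lies in the
edges `j` with `p j = v` and, unless it is the root, in one further edge. -/
theorem sum_codes {V : Type} [Fintype V] (ρ : V) {b s : ℕ}
    (hV : Fintype.card V = (b + 1) * s + 1) (φ : (V → ℕ) → ℝ) :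
    (∑ c : (V → Option (Fin (b + 1))) × (Fin (b + 1) → V) with IsCode ρ s c.1 c.2,
      φ (fun v => #{j | c.2 j = v} + if v = ρ then 0 else 1)) * (s.factorial : ℝ) ^ (b + 1) =
      (Fintype.card V - 1).factorial * ∑ h : Fin b → V, φ (fun v => #{i | h i = v} + 1) := by
  have h1 : (∑ c : (V → Option (Fin (b + 1))) × (Fin (b + 1) → V) with IsCode ρ s c.1 c.2,
      φ (fun v => #{j | c.2 j = v} + if v = ρ then 0 else 1)) =
      ∑ g : V → Option (Fin (b + 1)) with (∀ v, g v = none ↔ v = ρ) ∧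
        ∀ j, #{v | g v = some j} = s, ∑ h : Fin b → V, φ (fun v => #{i | h i = v} + 1) := by
    rw [sum_filter, Fintype.sum_prod_type, sum_filter]
    refine sum_congr rfl fun g _ => ?_
    split_ifs with hg
    · have := sum_acyc_card hg.1 (b := b) (by simp)
        (fun c => φ (fun v => c v + if v = ρ then 0 else 1))
      have e : ∀ h : Fin b → V, (fun v => #{i | h i = v} + (if v = ρ then 1 else 0) +
          if v = ρ then 0 else 1) = fun v => #{i | h i = v} + 1 := by
        intro h; funext v; split_ifs <;> rfl
      simp only [e] at this
      rw [← this, sum_filter]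
      refine sum_congr (by ext; simp) fun p _ => ?_
      simp [IsCode, hg]
    · exact sum_eq_zero fun p _ => if_neg fun h => hg h.1
  have h2 := card_grouping ρ hV
  rw [h1, sum_const, nsmul_eq_mul, hV, Nat.add_sub_cancel, ← h2, Nat.cast_mul, Nat.cast_pow,
    mul_right_comm]

end Codes

/-! ### From codes to hypertrees -/

section Hypertrees

variable {V : Type} [Fintype V] [DecidableEq V]

/-- The hypergraph with all of `V` as vertex set and the given edges. -/
def toHyper (E : Finset (Finset V)) : Hypergraph V where
  vertexSet := Set.univ
  edgeSet := {s | ∃ e ∈ E, (e : Set V) = s}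
  subset_vertexSet_of_mem_edgeSet' := fun _ _ => Set.subset_univ _

lemma mem_edgeSet_toHyper {E : Finset (Finset V)} {s : Set V} :
    s ∈ (toHyper E).edgeSet ↔ ∃ e ∈ E, (e : Set V) = s := Iff.rfl

/-- The `j`-th edge of the hypertree with code `(g, p)`. -/
def treeEdge {t : ℕ} (g : V → Option (Fin t)) (p : Fin t → V) (j : Fin t) : Finset V :=
  insert (p j) (univ.filter fun v => g v = some j)

lemma mem_treeEdge {t : ℕ} {g : V → Option (Fin t)} {p : Fin t → V} {j : Fin t} {v : V} :
    v ∈ treeEdge g p j ↔ v = p j ∨ g v = some j := by simp [treeEdge]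

/-- A shortest walk alternating between vertices and edges is a Berge path. -/
lemma hasPath_of_reflTransGen {H : Hypergraph V} (hH : H.vertexSet = Set.univ) {x y : V}
    (h : Relation.ReflTransGen (fun a b => ∃ e ∈ H.edgeSet, a ∈ e ∧ b ∈ e) x y) :
    HasPath H x y := by
  classical
  have hex : ∃ l : ℕ, ∃ (v : ℕ → V) (e : ℕ → Set V), v 0 = x ∧ v l = y ∧
      ∀ i < l, e i ∈ H.edgeSet ∧ v i ∈ e i ∧ v (i + 1) ∈ e i := by
    induction h with
    | refl => exact ⟨0, fun _ => x, fun _ => ∅, rfl, rfl, by simp⟩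
    | @tail b c _ hbc ih =>
      obtain ⟨l, v, e, h0, hl, hi⟩ := ih
      obtain ⟨f, hf, hbf, hcf⟩ := hbc
      refine ⟨l + 1, fun i => if i ≤ l then v i else c, fun i => if i < l then e i else f,
        by simp [h0], by simp, fun i hil => ?_⟩
      rcases (Nat.lt_succ_iff.1 hil).lt_or_eq with h1 | rfl
      · have := hi i h1
        simpa [h1, h1.le, Nat.succ_le_of_lt h1] using this
      · simp [hf, hl, hbf, hcf]
  obtain ⟨v, e, h0, hl, hi⟩ := Nat.find_spec hex
  have hmin := fun m (hm : m < Nat.find hex) => Nat.find_min hex hm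
  set l := Nat.find hex
  -- cutting out the part of the walk between two equal vertices, or two equal edges
  have hv : ∀ a b, a < b → b ≤ l → v a ≠ v b := by
    intro a b hab hbl heq
    refine hmin (l - (b - a)) (by omega) ⟨fun i => if i ≤ a then v i else v (i + (b - a)),
      fun i => if i < a then e i else e (i + (b - a)), by simp [h0], ?_, fun i hil => ?_⟩
    · by_cases h1 : l - (b - a) ≤ a
      · have h2 : l = b := by omega
        have h3 : l - (b - a) = a := by omega
        simp only [h3, le_refl, if_true]
        rw [heq, ← h2, hl]
      · simp only [h1, if_false]
        rw [← hl]; congr 1; omega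
    · rcases lt_trichotomy i a with h1 | h1 | h1
      · have := hi i (by omega)
        simpa [h1, h1.le, Nat.succ_le_of_lt h1] using this
      · subst h1
        have := hi b (by omega)
        have h2 : i + (b - i) = b := by omega
        have h3 : i + 1 + (b - i) = b + 1 := by omega
        simpa [h2, h3, heq] using this
      · have := hi (i + (b - a)) (by omega)
        have h2 : i + 1 + (b - a) = i + (b - a) + 1 := by omega
        have h3 : ¬ i < a := by omega
        have h4 : ¬ i ≤ a := by omega
        have h5 : ¬ i + 1 ≤ a := by omega
        simpa only [h2, h3, h4, h5, if_false] using this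
  have he : ∀ a b, a < b → b < l → e a ≠ e b := by
    intro a b hab hbl heq
    refine hmin (l - (b - a)) (by omega) ⟨fun i => if i ≤ a then v i else v (i + (b - a)),
      fun i => if i < a then e i else e (i + (b - a)), by simp [h0], ?_, fun i hil => ?_⟩
    · have h1 : ¬ l - (b - a) ≤ a := by omega
      simp only [h1, if_false]
      rw [← hl]; congr 1; omega
    · rcases lt_trichotomy i a with h1 | h1 | h1
      · have := hi i (by omega)
        simpa [h1, h1.le, Nat.succ_le_of_lt h1] using this
      · subst h1
        have h6 := hi b (by omega)
        have h7 := hi i (by omega)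
        have h2 : i + (b - i) = b := by omega
        have h3 : i + 1 + (b - i) = b + 1 := by omega
        rw [heq] at h7
        simp [h2, h3, h6.1, h6.2.2, h7.2.1]
      · have := hi (i + (b - a)) (by omega)
        have h2 : i + 1 + (b - a) = i + (b - a) + 1 := by omega
        have h3 : ¬ i < a := by omega
        have h4 : ¬ i ≤ a := by omega
        have h5 : ¬ i + 1 ≤ a := by omega
        simpa only [h2, h3, h4, h5, if_false] using this
  refine ⟨l, fun i => v i, fun i => e i, ?_, ?_, fun i => by rw [hH]; trivial,
    fun i => (hi i i.2).1, fun i => by simpa using (hi i i.2).2, h0, by simpa using hl⟩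
  · intro a b hab
    by_contra hne
    rcases lt_or_gt_of_ne (fun h => hne (Fin.ext h) : (a : ℕ) ≠ b) with h1 | h1
    · exact hv a b h1 (by omega) hab
    · exact hv b a h1 (by omega) hab.symm
  · intro a b hab
    by_contra hne
    rcases lt_or_gt_of_ne (fun h => hne (Fin.ext h) : (a : ℕ) ≠ b) with h1 | h1
    · exact he a b h1 b.2 hab
    · exact he b a h1 a.2 hab.symm

lemma hasCycle_one_of_hasTwoCycle {H : Hypergraph V} (h : HasTwoCycle H) : HasCycle H 1 := by
  obtain ⟨e, he, f, hf, hef, x, y, hxy, hxe, hxf, hye, hyf⟩ := h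
  refine ⟨![e, f], ![x, y], ?_, ?_, ?_, ?_⟩
  · intro a b; fin_cases a <;> fin_cases b <;> simp [hef, hef.symm]
  · intro a b; fin_cases a <;> fin_cases b <;> simp [hxy, hxy.symm]
  · intro a; fin_cases a <;> simp [he, hf]
  · intro a; fin_cases a <;> simp [hxe, hxf, hye, hyf]

variable {ρ : V} {s t : ℕ} {g : V → Option (Fin t)} {p : Fin t → V}

lemma IsCode.parent_notMem (h : IsCode ρ s g p) (j : Fin t) : g (p j) ≠ some j := by
  obtain ⟨d, hd⟩ := h.2
  exact fun hj => (hd j j hj).false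

lemma IsCode.card_treeEdge (h : IsCode ρ s g p) (j : Fin t) : #(treeEdge g p j) = s + 1 := by
  rw [treeEdge, card_insert_of_notMem (by simpa using h.parent_notMem j), h.1.2 j]

lemma IsCode.treeEdge_injective (h : IsCode ρ s g p) (hs : 2 ≤ s) :
    Function.Injective (treeEdge g p) := by
  intro i j hij
  by_contra hne
  obtain ⟨a, ha, b, hb, hab⟩ := one_lt_card.1 (lt_of_lt_of_le (by omega : 1 < s) (h.1.2 i).ge)
  simp only [mem_filter, mem_univ, true_and] at ha hb
  have h1 : ∀ v, g v = some i → v = p j := by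
    intro v hv
    have : v ∈ treeEdge g p j := hij ▸ mem_treeEdge.2 (Or.inr hv)
    rcases mem_treeEdge.1 this with h2 | h2
    · exact h2
    · rw [hv] at h2; exact absurd (Option.some_inj.1 h2) hne
  exact hab ((h1 a ha).trans (h1 b hb).symm)

/-- In a cycle, an edge of maximal rank has a vertex other than its parent in common with another
edge of the cycle, which must have larger rank. -/
lemma IsCode.not_hasCycle (h : IsCode ρ s g p) (l : ℕ) (hl : 1 ≤ l) :
    ¬ HasCycle (toHyper (univ.image (treeEdge g p))) l := by
  rintro ⟨e, v, he, hv, hE, hve⟩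
  obtain ⟨d, hd⟩ := h.2
  have h1 : ∀ i, ∃ j, (treeEdge g p j : Set V) = e i := by
    intro i
    obtain ⟨f, hf, hfe⟩ := hE i
    obtain ⟨j, -, rfl⟩ := mem_image.1 hf
    exact ⟨j, hfe⟩
  choose j hj using h1
  have hjinj : Function.Injective j := fun a b hab => he (by rw [← hj, ← hj, hab])
  obtain ⟨i, hi⟩ := Finite.exists_max (d ∘ j)
  have hone : (1 : Fin (l + 1)) ≠ 0 := by
    intro h0
    have := congrArg Fin.val h0
    rw [Fin.val_one', Fin.val_zero, Nat.mod_eq_of_lt (by omega)] at this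
    omega
  have hne1 : i ≠ i - 1 := fun h0 => hone (sub_eq_self.1 h0.symm)
  have hne2 : i ≠ i + 1 := fun h0 => hone (add_eq_left.1 h0.symm)
  have hmem : ∀ (i' : Fin (l + 1)) (w : V), w ∈ e i' → w = p (j i') ∨ g w = some (j i') := by
    intro i' w hw
    rw [← hj] at hw
    exact mem_treeEdge.1 (mem_coe.1 hw)
  have key : ∀ (w : V) (i' : Fin (l + 1)), i ≠ i' → w ∈ e i' → g w ≠ some (j i) := by
    intro w i' hii hw hgw
    rcases hmem i' w hw with h2 | h2
    · exact (hd _ _ (h2 ▸ hgw)).not_ge (hi i')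
    · rw [hgw] at h2
      exact hii (hjinj (Option.some_inj.1 h2))
  have hprev := hve (i - 1)
  rw [sub_add_cancel] at hprev
  have h3 := (hmem i _ (hve i).1).resolve_right (key _ _ hne2 (hve i).2)
  have h4 := (hmem i _ hprev.2).resolve_right (key _ _ hne1 hprev.1)
  exact hne1 (hv (h3.trans h4.symm))

/-- Following the edges towards the root connects every vertex to the root. -/
lemma IsCode.isHypertree (h : IsCode ρ s g p) :
    IsHypertree (toHyper (univ.image (treeEdge g p))) := by
  refine ⟨fun x _ y _ => ?_, fun h2 => h.not_hasCycle 1 le_rfl (hasCycle_one_of_hasTwoCycle h2),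
    fun l hl => h.not_hasCycle l (by omega)⟩
  set r : V → V → Prop := fun a b =>
    ∃ e ∈ (toHyper (univ.image (treeEdge g p))).edgeSet, a ∈ e ∧ b ∈ e with hr
  have hsymm : Std.Symm r := ⟨fun a b ⟨e, he, ha, hb⟩ => ⟨e, he, hb, ha⟩⟩
  obtain ⟨d, hd⟩ := h.2
  have hroot : ∀ (n : ℕ) (x : V), (∀ j, g x = some j → d j < n) → Relation.ReflTransGen r x ρ := by
    intro n
    induction n with
    | zero =>
      intro x hx
      rw [(h.1.1 x).1 (Option.eq_none_iff_forall_ne_some.2 fun j hj => absurd (hx j hj) (by simp))]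
    | succ n ih =>
      intro x hx
      cases hgx : g x with
      | none => rw [(h.1.1 x).1 hgx]
      | some j =>
        refine Relation.ReflTransGen.head (b := p j) ?_ (ih (p j) fun i hi => ?_)
        · exact ⟨_, ⟨_, mem_image_of_mem _ (mem_univ j), rfl⟩,
            mem_coe.2 (mem_treeEdge.2 (Or.inr hgx)), mem_coe.2 (mem_treeEdge.2 (Or.inl rfl))⟩
        · have := hd j i hi
          have := hx j hgx
          omega
  have hroot' : ∀ x, Relation.ReflTransGen r x ρ := fun x =>
    hroot ((univ.sup d) + 1) x fun j _ => Nat.lt_succ_of_le (le_sup (mem_univ j))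
  exact hasPath_of_reflTransGen rfl
    ((hroot' x).trans (Relation.ReflTransGen.stdSymm.symm _ _ (hroot' y)))

/-- The labelled edges determine the code: by induction on the rank, the edge towards the root is the
only edge at a vertex of which that vertex is not the parent. -/
lemma IsCode.eq_of_treeEdge_eq {g' : V → Option (Fin t)} {p' : Fin t → V} (h : IsCode ρ s g p)
    (h' : IsCode ρ s g' p') (heq : treeEdge g p = treeEdge g' p') : g = g' ∧ p = p' := by
  obtain ⟨d, hd⟩ := h.2
  have hmem : ∀ j v, (v = p j ∨ g v = some j) ↔ (v = p' j ∨ g' v = some j) := fun j v => by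
    rw [← mem_treeEdge, ← mem_treeEdge, heq]
  have hg : ∀ (n : ℕ) (x : V), (∀ j, g x = some j → d j < n) → g x = g' x := by
    intro n
    induction n with
    | zero =>
      intro x hx
      have h1 : g x = none :=
        Option.eq_none_iff_forall_ne_some.2 fun j hj => absurd (hx j hj) (by simp)
      rw [h1, (h'.1.1 x).2 ((h.1.1 x).1 h1)]
    | succ n ih =>
      intro x hx
      cases hgx : g x with
      | none => rw [(h'.1.1 x).2 ((h.1.1 x).1 hgx)]
      | some j =>
        have h2 : g (p j) = g' (p j) := ih (p j) fun i hi => by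
          have := hd j i hi
          have := hx j hgx
          omega
        have h3 : p j = p' j := ((hmem j (p j)).1 (Or.inl rfl)).resolve_right fun h4 =>
          h.parent_notMem j (h2.trans h4)
        refine (((hmem j x).1 (Or.inr hgx)).resolve_left fun h4 => ?_).symm
        exact h.parent_notMem j (by rw [h3, ← h4, hgx])
  have hgg : g = g' := funext fun x =>
    hg ((univ.sup d) + 1) x fun j _ => Nat.lt_succ_of_le (le_sup (mem_univ j))
  refine ⟨hgg, funext fun j => ?_⟩
  exact ((hmem j (p j)).1 (Or.inl rfl)).resolve_right fun h4 =>
    h.parent_notMem j (by rw [hgg, h4])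

end Hypertrees

/-! ### From hypertrees to codes, through the incidence graph -/

section IncidenceGraph

variable {V : Type} [Fintype V] [DecidableEq V] {t : ℕ}

/-- The bipartite incidence graph of a hypergraph with labelled edges. -/
def incGraph (ε : Fin t → Finset V) : SimpleGraph (V ⊕ Fin t) where
  Adj x y := (∃ v j, x = Sum.inl v ∧ y = Sum.inr j ∧ v ∈ ε j) ∨
    ∃ v j, y = Sum.inl v ∧ x = Sum.inr j ∧ v ∈ ε j
  symm := ⟨fun _ _ h => h.symm⟩
  loopless := ⟨fun x h => by rcases h with ⟨v, j, h1, h2, -⟩ | ⟨v, j, h1, h2, -⟩ <;> simp [h1] at h2⟩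

variable {ε : Fin t → Finset V}

lemma incGraph_adj_inl {v : V} {y : V ⊕ Fin t} :
    (incGraph ε).Adj (Sum.inl v) y ↔ ∃ j, y = Sum.inr j ∧ v ∈ ε j := by
  simp [incGraph]

lemma incGraph_adj_inr {j : Fin t} {y : V ⊕ Fin t} :
    (incGraph ε).Adj (Sum.inr j) y ↔ ∃ v, y = Sum.inl v ∧ v ∈ ε j := by
  simp [incGraph]

/-- A walk that starts at a vertex alternates between vertices and edges. -/
lemma incGraph_walk_parity {v : V} {y : V ⊕ Fin t} (c : (incGraph ε).Walk (Sum.inl v) y) :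
    ∀ i ≤ c.length, (Even i → ∃ w, c.getVert i = Sum.inl w) ∧
      (¬ Even i → ∃ j, c.getVert i = Sum.inr j) := by
  intro i
  induction i with
  | zero => intro _; simp
  | succ i ih =>
    intro hi
    have h1 := ih (by omega)
    have h2 := c.adj_getVert_succ (show i < c.length by omega)
    rw [Nat.even_add_one]
    constructor
    · intro h
      obtain ⟨j, hj⟩ := h1.2 h
      rw [hj, incGraph_adj_inr] at h2
      obtain ⟨w, hw, -⟩ := h2
      exact ⟨w, hw⟩
    · intro h
      obtain ⟨w, hw⟩ := h1.1 (not_not.1 h)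
      rw [hw, incGraph_adj_inl] at h2
      obtain ⟨j, hj, -⟩ := h2
      exact ⟨j, hj⟩

/-- A cycle of length `2 l + 2` in the incidence graph is a Berge cycle of length `l + 1`; for `l = 1`
it consists of two edges with two common vertices. -/
lemma incGraph_isAcyclic (hε : Function.Injective ε) (h : IsAcyclic (toHyper (univ.image ε))) :
    (incGraph ε).IsAcyclic := by
  have hmain : ∀ (v : V) (c : (incGraph ε).Walk (Sum.inl v) (Sum.inl v)), ¬ c.IsCycle := by
    intro v c hc
    have hpar := incGraph_walk_parity c
    have hlen := hc.three_le_length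
    obtain ⟨L, hL⟩ : Even c.length := by
      by_contra hodd
      obtain ⟨j, hj⟩ := (hpar _ le_rfl).2 hodd
      rw [c.getVert_length] at hj
      exact absurd hj (by simp)
    obtain ⟨l, rfl⟩ : ∃ l, L = l + 1 := ⟨L - 1, by omega⟩
    have hve : ∀ i : Fin (l + 2), ∃ w, c.getVert (2 * i) = Sum.inl w := fun i =>
      (hpar (2 * i) (by omega)).1 (even_two_mul _)
    have hed : ∀ i : Fin (l + 1), ∃ j, c.getVert (2 * i + 1) = Sum.inr j := fun i =>
      (hpar (2 * i + 1) (by omega)).2 (by simp)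
    choose ve hve using hve
    choose ed hed using hed
    have hadj1 : ∀ i : Fin (l + 1), ve i.castSucc ∈ ε (ed i) := by
      intro i
      have h2 := c.adj_getVert_succ (show 2 * (i : ℕ) < c.length by omega)
      have h3 := hve i.castSucc
      rw [Fin.val_castSucc] at h3
      rw [h3, hed i, incGraph_adj_inl] at h2
      obtain ⟨j, hj, hm⟩ := h2
      rwa [← Sum.inr_injective hj] at hm
    have hadj2 : ∀ i : Fin (l + 1), ve i.succ ∈ ε (ed i) := by
      intro i
      have h2 := c.adj_getVert_succ (show 2 * (i : ℕ) + 1 < c.length by omega)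
      have h3 := hve i.succ
      rw [Fin.val_succ, mul_add, mul_one] at h3
      rw [h3, hed i, incGraph_adj_inr] at h2
      obtain ⟨j, hj, hm⟩ := h2
      rwa [← Sum.inl_injective hj] at hm
    have hinj := hc.getVert_injOn
    have hedinj : Function.Injective ed := by
      intro a b hab
      have := hinj (x₁ := 2 * (a : ℕ) + 1) (x₂ := 2 * (b : ℕ) + 1)
        (by rw [Set.mem_ofPred_eq]; omega) (by rw [Set.mem_ofPred_eq]; omega)
        (by rw [hed, hed, hab])
      exact Fin.ext (by omega)
    have hveinj : Function.Injective fun i : Fin (l + 1) => ve i.succ := by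
      intro a b hab
      have := hinj (x₁ := 2 * (a.succ : ℕ)) (x₂ := 2 * (b.succ : ℕ))
        (by rw [Set.mem_ofPred_eq, Fin.val_succ]; omega)
        (by rw [Set.mem_ofPred_eq, Fin.val_succ]; omega)
        (by rw [hve, hve]; exact congrArg _ hab)
      rw [Fin.val_succ, Fin.val_succ] at this
      exact Fin.ext (by omega)
    have hwrap : ve (Fin.last (l + 1)) = ve 0 := by
      have h1 := hve (Fin.last (l + 1))
      have h2 := hve 0
      rw [Fin.val_last, show 2 * (l + 1) = c.length by omega, c.getVert_length] at h1
      rw [Fin.val_zero, mul_zero, c.getVert_zero] at h2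
      exact Sum.inl_injective (h1.symm.trans h2)
    have hcyc : HasCycle (toHyper (univ.image ε)) l := by
      refine ⟨fun i => (ε (ed i) : Set V), fun i => ve i.succ, ?_, hveinj, ?_, ?_⟩
      · intro a b hab
        exact hedinj (hε (coe_injective hab))
      · intro i
        exact ⟨_, mem_image_of_mem _ (mem_univ _), rfl⟩
      · intro i
        refine ⟨mem_coe.2 (hadj2 i), mem_coe.2 ?_⟩
        change ve i.succ ∈ _
        by_cases hi : i = Fin.last l
        · subst hi
          rw [Fin.last_add_one, Fin.succ_last, hwrap]
          exact hadj1 0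
        · have h3 : ((i + 1 : Fin (l + 1)) : ℕ) = i + 1 :=
            Fin.val_add_one_of_lt (lt_of_le_of_ne (Fin.le_last i) hi)
          have h4 : i.succ = (i + 1 : Fin (l + 1)).castSucc := by
            apply Fin.ext
            rw [Fin.val_succ, Fin.val_castSucc, h3]
          rw [h4]
          exact hadj1 _
    rcases (show l = 1 ∨ 3 ≤ l + 1 by omega) with rfl | h3
    · obtain ⟨e, v, he, hv, hE, hvE⟩ := hcyc
      exact h.1 ⟨e 0, hE 0, e 1, hE 1, he.ne (by simp), v 0, v 1, hv.ne (by simp),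
        (hvE 0).1, (hvE 0).2, (hvE 1).2, (hvE 1).1⟩
    · exact h.2 l h3 hcyc
  rintro (v | j) c hc
  · exact hmain v c hc
  · have h1 := c.adj_getVert_succ (i := 0) (by have := hc.three_le_length; omega)
    rw [c.getVert_zero, incGraph_adj_inr] at h1
    obtain ⟨w, hw, -⟩ := h1
    have hmem : Sum.inl w ∈ c.support := hw ▸ c.getVert_mem_support _
    exact hmain w (c.rotate _ hmem) (hc.rotate hmem)

lemma incGraph_connected [Nonempty V] (hε : ∀ j, (ε j).Nonempty)
    (h : IsConnected (toHyper (univ.image ε))) : (incGraph ε).Connected := by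
  have hvv : ∀ x y : V, (incGraph ε).Reachable (Sum.inl x) (Sum.inl y) := by
    intro x y
    obtain ⟨l, v, e, -, -, -, he, hve, rfl, rfl⟩ := h x trivial y trivial
    have : ∀ i : Fin (l + 1), (incGraph ε).Reachable (Sum.inl (v 0)) (Sum.inl (v i)) := by
      intro i
      induction i using Fin.induction with
      | zero => exact SimpleGraph.Reachable.refl _
      | succ i ih =>
        obtain ⟨f, hf, hfe⟩ := he i
        obtain ⟨j, -, rfl⟩ := mem_image.1 hf
        have h1 := hve i
        rw [← hfe] at h1
        refine ih.trans (SimpleGraph.Reachable.trans (v := Sum.inr j) ?_ ?_)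
        · exact (incGraph_adj_inl.2 ⟨j, rfl, h1.1⟩).reachable
        · exact (incGraph_adj_inr.2 ⟨_, rfl, h1.2⟩).reachable
    exact this _
  obtain ⟨ρ⟩ := ‹Nonempty V›
  have hρ : ∀ x, (incGraph ε).Reachable (Sum.inl ρ) x := by
    rintro (v | j)
    · exact hvv _ _
    · obtain ⟨v, hv⟩ := hε j
      exact (hvv ρ v).trans (incGraph_adj_inl.2 ⟨j, rfl, hv⟩).reachable
  exact (SimpleGraph.connected_iff _).2
    ⟨fun x y => (hρ x).symm.trans (hρ y), ⟨Sum.inl ρ⟩⟩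

/-- In a tree, every vertex other than the root has exactly one neighbour nearer to the root. -/
lemma existsUnique_adj_dist_lt {W : Type*} {G : SimpleGraph W} (hG : G.IsTree) (r x : W)
    (hx : x ≠ r) : ∃! y, G.Adj x y ∧ G.dist r y < G.dist r x := by
  obtain ⟨c, hc⟩ := hG.connected.exists_walk_length_eq_dist x r
  cases c with
  | nil => exact absurd rfl hx
  | @cons _ y _ hxy c =>
    have hlen : c.length + 1 = G.dist r x := by
      rw [SimpleGraph.dist_comm, ← hc, SimpleGraph.Walk.length_cons]
    refine ⟨y, ⟨hxy, ?_⟩, ?_⟩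
    · rw [SimpleGraph.dist_comm]
      have := SimpleGraph.dist_le c
      omega
    · rintro z ⟨hxz, hz⟩
      obtain ⟨c', hc'⟩ := hG.connected.exists_walk_length_eq_dist z r
      have hp1 : (SimpleGraph.Walk.cons hxy c).IsPath :=
        SimpleGraph.Walk.isPath_of_length_eq_dist _ hc
      have hp2 : (SimpleGraph.Walk.cons hxz c').IsPath := by
        refine SimpleGraph.Walk.isPath_of_length_eq_dist _ (le_antisymm ?_ (SimpleGraph.dist_le _))
        rw [SimpleGraph.Walk.length_cons, hc', SimpleGraph.dist_comm, SimpleGraph.dist_comm (u := x)]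
        exact hz
      have := hG.existsUnique_path x r |>.unique hp1 hp2
      have h2 := congrArg SimpleGraph.Walk.snd this
      simpa using h2.symm

/-- Every hypertree with labelled edges has a code: the distances in the incidence tree from the root
determine the edge that leads from a vertex towards the root, and the parent of an edge. -/
lemma exists_isCode (ρ : V) {s : ℕ} (hinj : Function.Injective ε) (hcard : ∀ j, #(ε j) = s + 1)
    (h : IsHypertree (toHyper (univ.image ε))) :
    ∃ (g : V → Option (Fin t)) (p : Fin t → V), IsCode ρ s g p ∧ treeEdge g p = ε := by
  have hne : ∀ j, (ε j).Nonempty := fun j => card_pos.1 (by rw [hcard]; omega)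
  have : Nonempty V := ⟨ρ⟩
  set G := incGraph ε with hG
  have hT : G.IsTree := ⟨incGraph_connected hne h.1, incGraph_isAcyclic hinj h.2⟩
  set D : V ⊕ Fin t → ℕ := fun x => G.dist (Sum.inl ρ) x with hD
  have hpar : ∀ j, ∃! v, v ∈ ε j ∧ D (Sum.inl v) < D (Sum.inr j) := by
    intro j
    obtain ⟨y, ⟨hy1, hy2⟩, hy3⟩ := existsUnique_adj_dist_lt hT (Sum.inl ρ) (Sum.inr j) (by simp)
    obtain ⟨v, rfl, hv⟩ := incGraph_adj_inr.1 hy1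
    refine ⟨v, ⟨hv, hy2⟩, fun w hw => ?_⟩
    exact Sum.inl_injective (hy3 (Sum.inl w) ⟨incGraph_adj_inr.2 ⟨w, rfl, hw.1⟩, hw.2⟩)
  have hup : ∀ v, v ≠ ρ → ∃! j, v ∈ ε j ∧ D (Sum.inr j) < D (Sum.inl v) := by
    intro v hv
    obtain ⟨y, ⟨hy1, hy2⟩, hy3⟩ := existsUnique_adj_dist_lt hT (Sum.inl ρ) (Sum.inl v)
      (fun h => hv (Sum.inl_injective h))
    obtain ⟨j, rfl, hj⟩ := incGraph_adj_inl.1 hy1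
    refine ⟨j, ⟨hj, hy2⟩, fun i hi => ?_⟩
    exact Sum.inr_injective (hy3 (Sum.inr i) ⟨incGraph_adj_inl.2 ⟨i, rfl, hi.1⟩, hi.2⟩)
  have hDne : ∀ v j, v ∈ ε j → D (Sum.inl v) ≠ D (Sum.inr j) := fun v j hv heq =>
    hT.dist_ne_of_adj (Sum.inl ρ) (incGraph_adj_inl.2 ⟨j, rfl, hv⟩) heq
  choose p hp using hpar
  have hg : ∃ g : V → Option (Fin t), (∀ v, g v = none ↔ v = ρ) ∧
      ∀ v j, g v = some j ↔ v ∈ ε j ∧ D (Sum.inr j) < D (Sum.inl v) := by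
    choose f hf using hup
    refine ⟨fun v => if h : v = ρ then none else some (f v h), fun v => by simp, fun v j => ?_⟩
    by_cases hv : v = ρ
    · subst hv
      simp [hD]
    · simp only [hv, dif_neg, not_false_eq_true, Option.some_inj]
      constructor
      · rintro rfl; exact (hf v hv).1
      · intro h; exact ((hf v hv).2 j h).symm
  obtain ⟨g, hg1, hg2⟩ := hg
  have hedge : treeEdge g p = ε := by
    funext j
    ext v
    rw [mem_treeEdge, hg2]
    constructor
    · rintro (rfl | h1)
      · exact (hp j).1.1
      · exact h1.1
    · intro hv
      rcases lt_or_gt_of_ne (hDne v j hv) with h1 | h1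
      · exact Or.inl ((hp j).2 v ⟨hv, h1⟩)
      · exact Or.inr ⟨hv, h1⟩
  refine ⟨g, p, ⟨⟨hg1, fun j => ?_⟩, fun j => D (Sum.inr j), fun j i hi => ?_⟩, hedge⟩
  · have h1 : #(treeEdge g p j) = s + 1 := by rw [hedge, hcard]
    rw [treeEdge, card_insert_of_notMem] at h1
    · exact Nat.succ_injective h1
    · simp only [mem_filter, mem_univ, true_and]
      intro h2
      exact lt_asymm ((hg2 _ _).1 h2).2 (hp j).1.2
  · exact ((hg2 _ _).1 hi).2.trans (hp j).1.2

end IncidenceGraph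

/-! ### Counting hypertrees and hypergraphs by labelled edges -/

section LabelledEdges

lemma card_enumerations {α : Type*} [Fintype α] [DecidableEq α] {E : Finset α} {t : ℕ}
    (hE : #E = t) :
    #{ε : Fin t → α | Function.Injective ε ∧ univ.image ε = E} = t.factorial := by
  have h1 : #(univ : Finset (Fin t ≃ E)) = t.factorial := by
    rw [card_univ, Fintype.card_equiv (Fintype.equivOfCardEq (by simp [hE]))]
    simp
  rw [← h1]
  symm
  refine card_bij (fun (σ : Fin t ≃ E) _ => fun j => (σ j : α)) ?_ ?_ ?_
  · intro σ _
    rw [mem_filter]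
    refine ⟨mem_univ _, Subtype.val_injective.comp σ.injective, ?_⟩
    ext x
    simp only [mem_image, mem_univ, true_and]
    constructor
    · rintro ⟨j, rfl⟩; exact (σ j).2
    · intro hx; exact ⟨σ.symm ⟨x, hx⟩, by simp⟩
  · intro σ _ τ _ h
    ext j
    exact congrFun h j
  · intro ε hε
    obtain ⟨-, hinj, him⟩ := mem_filter.1 hε
    have hmem : ∀ j, ε j ∈ E := fun j => him ▸ mem_image_of_mem _ (mem_univ j)
    refine ⟨Equiv.ofBijective (fun j => (⟨ε j, hmem j⟩ : E)) ⟨fun a b hab => hinj ?_, ?_⟩,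
      mem_univ _, rfl⟩
    · exact congrArg Subtype.val hab
    · rintro ⟨x, hx⟩
      rw [← him] at hx
      obtain ⟨j, -, hj⟩ := mem_image.1 hx
      exact ⟨j, Subtype.ext hj⟩

variable {V : Type} [Fintype V] [DecidableEq V]

/-- The degree of a vertex in a finite set of edges. -/
def edgeDeg (E : Finset (Finset V)) (v : V) : ℕ := #{e ∈ E | v ∈ e}

lemma edgeDeg_image {t : ℕ} {ε : Fin t → Finset V} (hε : Function.Injective ε) (v : V) :
    edgeDeg (univ.image ε) v = #{j | v ∈ ε j} := by
  rw [edgeDeg, filter_image, card_image_of_injective _ hε]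

lemma degree_toHyper (E : Finset (Finset V)) (v : V) : degree (toHyper E) v = edgeDeg E v := by
  have : {e | e ∈ (toHyper E).edgeSet ∧ v ∈ e} =
      (fun e : Finset V => (e : Set V)) '' ({e ∈ E | v ∈ e} : Finset (Finset V)) := by
    ext s
    simp only [Set.mem_ofPred_eq, mem_edgeSet_toHyper, Set.mem_image, mem_coe, mem_filter]
    constructor
    · rintro ⟨⟨e, he, rfl⟩, hv⟩; exact ⟨e, ⟨he, hv⟩, rfl⟩
    · rintro ⟨e, ⟨he, hv⟩, rfl⟩; exact ⟨⟨e, he, rfl⟩, hv⟩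
  rw [degree, this, Set.ncard_image_of_injective _ coe_injective, Set.ncard_coe_finset, edgeDeg]

lemma sum_edgeDeg {E : Finset (Finset V)} {r : ℕ} (hE : ∀ e ∈ E, #e = r) :
    ∑ v, edgeDeg E v = #E * r := by
  simp only [edgeDeg, card_filter]
  rw [sum_comm, ← smul_eq_mul, ← sum_const]
  refine sum_congr rfl fun e he => ?_
  rw [← card_filter, ← hE e he]
  congr 1
  ext; simp

open Classical in
/-- The edge sets of the `r`-uniform hypertrees with vertex set `V`. -/
noncomputable def hypertrees (V : Type) [Fintype V] [DecidableEq V] (r : ℕ) :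
    Finset (Finset (Finset V)) :=
  univ.filter fun E => (∀ e ∈ E, #e = r) ∧ IsHypertree (toHyper E)

lemma mem_hypertrees {r : ℕ} {E : Finset (Finset V)} :
    E ∈ hypertrees V r ↔ (∀ e ∈ E, #e = r) ∧ IsHypertree (toHyper E) := by
  simp [hypertrees]

lemma IsCode.card_eq {ρ : V} {s t : ℕ} {g : V → Option (Fin t)} {p : Fin t → V}
    (h : IsCode ρ s g p) : Fintype.card V = t * s + 1 := by
  have h1 : #(univ : Finset V) = ∑ o : Option (Fin t), #{v | g v = o} :=
    card_eq_sum_card_fiberwise fun _ _ => mem_coe.2 (mem_univ _)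
  have h2 : ({v | g v = none} : Finset V) = {ρ} := by ext v; simp [h.1.1]
  rw [Fintype.sum_option, h2, sum_congr rfl fun j _ => h.1.2 j, card_univ] at h1
  simp at h1
  omega

lemma card_of_mem_hypertrees (ρ : V) {s t : ℕ} (hs : 1 ≤ s) (hV : Fintype.card V = t * s + 1)
    {E : Finset (Finset V)} (hE : E ∈ hypertrees V (s + 1)) : #E = t := by
  obtain ⟨h1, h2⟩ := mem_hypertrees.1 hE
  have him : univ.image (fun j => (E.equivFin.symm j : Finset V)) = E := by
    ext e
    simp only [mem_image, mem_univ, true_and]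
    constructor
    · rintro ⟨j, rfl⟩; exact (E.equivFin.symm j).2
    · intro he; exact ⟨E.equivFin ⟨e, he⟩, by simp⟩
  obtain ⟨g, p, hgp, -⟩ := exists_isCode (ε := fun j => (E.equivFin.symm j : Finset V)) ρ
    (Subtype.val_injective.comp E.equivFin.symm.injective) (fun j => h1 _ (E.equivFin.symm j).2)
    (by rw [him]; exact h2)
  have h3 := hgp.card_eq
  rw [hV] at h3
  exact (Nat.eq_of_mul_eq_mul_right hs (Nat.succ_injective h3)).symm

lemma IsCode.edgeDeg_eq {ρ : V} {s t : ℕ} {g : V → Option (Fin t)} {p : Fin t → V}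
    (h : IsCode ρ s g p) (hs : 2 ≤ s) (v : V) :
    edgeDeg (univ.image (treeEdge g p)) v = #{j | p j = v} + if v = ρ then 0 else 1 := by
  rw [edgeDeg_image (h.treeEdge_injective hs)]
  have h1 : ({j | v ∈ treeEdge g p j} : Finset (Fin t)) =
      ({j | p j = v} : Finset (Fin t)) ∪ ({j | g v = some j} : Finset (Fin t)) := by
    ext j
    simp only [mem_filter, mem_univ, true_and, mem_union, mem_treeEdge, eq_comm]
  have h2 : Disjoint ({j | p j = v} : Finset (Fin t)) ({j | g v = some j} : Finset (Fin t)) := by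
    rw [disjoint_left]
    intro j hj hj'
    simp only [mem_filter, mem_univ, true_and] at hj hj'
    exact h.parent_notMem j (hj ▸ hj')
  rw [h1, card_union_of_disjoint h2]
  congr 1
  by_cases hv : v = ρ
  · rw [(h.1.1 v).2 hv]; simp [hv]
  · obtain ⟨i, hi⟩ := Option.ne_none_iff_exists'.1 (fun h0 => hv ((h.1.1 v).1 h0))
    have h3 : ({j | i = j} : Finset (Fin t)) = {i} := by ext j; simp [eq_comm]
    simp [hi, hv, h3]

/-- **Degree enumerator of hypertrees**: a sum over all uniform hypertrees of a function of the
degree sequence. The numbers `#{i | h i = v}` are the degrees minus one. -/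
theorem sum_hypertrees (ρ : V) {b s : ℕ} (hs : 2 ≤ s) (hV : Fintype.card V = (b + 1) * s + 1)
    (φ : (V → ℕ) → ℝ) :
    (∑ E ∈ hypertrees V (s + 1), φ (edgeDeg E)) *
        ((b + 1).factorial * (s.factorial : ℝ) ^ (b + 1)) =
      (Fintype.card V - 1).factorial * ∑ h : Fin b → V, φ (fun v => #{i | h i = v} + 1) := by
  classical
  set codes := (univ : Finset ((V → Option (Fin (b + 1))) × (Fin (b + 1) → V))).filter
    fun c => IsCode ρ s c.1 c.2 with hcodes
  have hmemc : ∀ {c}, c ∈ codes ↔ IsCode ρ s c.1 c.2 := by intro c; simp [hcodes]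
  have h0 : (∑ c ∈ codes, φ (fun v => #{j | c.2 j = v} + if v = ρ then 0 else 1)) *
      (s.factorial : ℝ) ^ (b + 1) =
      (Fintype.card V - 1).factorial * ∑ h : Fin b → V, φ (fun v => #{i | h i = v} + 1) := by
    convert sum_codes ρ hV φ
  have h1 : ∑ c ∈ codes, φ (fun v => #{j | c.2 j = v} + if v = ρ then 0 else 1) =
      ∑ c ∈ codes, φ (edgeDeg (univ.image (treeEdge c.1 c.2))) := by
    refine sum_congr rfl fun c hc => ?_
    congr 1
    funext v
    exact ((hmemc.1 hc).edgeDeg_eq hs v).symm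
  have h2 : ∑ c ∈ codes, φ (edgeDeg (univ.image (treeEdge c.1 c.2))) =
      ∑ E ∈ hypertrees V (s + 1), ∑ c ∈ codes with univ.image (treeEdge c.1 c.2) = E,
        φ (edgeDeg (univ.image (treeEdge c.1 c.2))) := by
    refine (sum_fiberwise_of_maps_to (fun c hc => ?_) _).symm
    rw [mem_hypertrees]
    refine ⟨fun e he => ?_, (hmemc.1 hc).isHypertree⟩
    obtain ⟨j, -, rfl⟩ := mem_image.1 he
    exact (hmemc.1 hc).card_treeEdge j
  have h3 : ∀ E ∈ hypertrees V (s + 1), ∑ c ∈ codes with univ.image (treeEdge c.1 c.2) = E,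
      φ (edgeDeg (univ.image (treeEdge c.1 c.2))) = (b + 1).factorial * φ (edgeDeg E) := by
    intro E hE
    rw [sum_congr rfl (g := fun _ => φ (edgeDeg E)) fun c hc => by rw [(mem_filter.1 hc).2],
      sum_const, nsmul_eq_mul]
    congr 2
    rw [← card_enumerations (card_of_mem_hypertrees ρ (by omega) hV hE)]
    refine card_bij (fun c _ => treeEdge c.1 c.2) ?_ ?_ ?_
    · intro c hc
      rw [mem_filter, hmemc] at hc
      rw [mem_filter]
      exact ⟨mem_univ _, hc.1.treeEdge_injective hs, hc.2⟩
    · intro c hc c' hc' h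
      rw [mem_filter, hmemc] at hc hc'
      have := hc.1.eq_of_treeEdge_eq hc'.1 h
      exact Prod.ext this.1 this.2
    · intro ε hε
      obtain ⟨-, hinj, him⟩ := mem_filter.1 hε
      obtain ⟨hcard, htree⟩ := mem_hypertrees.1 hE
      obtain ⟨g, p, hgp, hgpε⟩ := exists_isCode ρ hinj
        (fun j => hcard _ (him ▸ mem_image_of_mem _ (mem_univ j))) (by rw [him]; exact htree)
      exact ⟨(g, p), mem_filter.2 ⟨hmemc.2 hgp, by rw [hgpε]; exact him⟩, hgpε⟩
  rw [h1, h2, sum_congr rfl h3, ← mul_sum] at h0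
  rw [← h0]
  ring

/-- The edges of the hypergraph given by a table of `m` ordered edges with `r` vertices each. -/
def rowSet {m r : ℕ} (f : Fin m × Fin r → V) (i : Fin m) : Finset V := univ.image fun a => f (i, a)

open Classical in
/-- A uniform hypergraph with `m` edges has `m! (r!)^m` tables: its edges are put in order, and so are
the vertices of each edge. -/
lemma card_uniform_mul (m r : ℕ) (P : Finset (Finset V) → Prop) :
    #{F : Finset (Finset V) | #F = m ∧ (∀ e ∈ F, #e = r) ∧ P F} *
        (m.factorial * r.factorial ^ m) =
      #{f : Fin m × Fin r → V | (∀ i, Function.Injective fun a => f (i, a)) ∧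
        Function.Injective (rowSet f) ∧ P (univ.image (rowSet f))} := by
  set A := (univ : Finset (Fin m × Fin r → V)).filter fun f =>
    (∀ i, Function.Injective fun a => f (i, a)) ∧
        Function.Injective (rowSet f) ∧ P (univ.image (rowSet f)) with hA
  set T := (univ : Finset (Fin m → Finset V)).filter fun ε =>
    Function.Injective ε ∧ (∀ i, #(ε i) = r) ∧ P (univ.image ε) with hT
  set U := (univ : Finset (Finset (Finset V))).filter fun F =>
    #F = m ∧ (∀ e ∈ F, #e = r) ∧ P F with hU
  have h1 : #A = ∑ ε ∈ T, #{f ∈ A | rowSet f = ε} := by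
    refine card_eq_sum_card_fiberwise fun f hf => ?_
    rw [mem_coe, hA, mem_filter] at hf
    rw [mem_coe, hT, mem_filter]
    refine ⟨mem_univ _, hf.2.2.1, fun i => ?_, hf.2.2.2⟩
    rw [rowSet, card_image_of_injective _ (hf.2.1 i)]
    simp
  have h2 : ∀ ε ∈ T, #{f ∈ A | rowSet f = ε} = r.factorial ^ m := by
    intro ε hε
    rw [hT, mem_filter] at hε
    have h3 : #(Fintype.piFinset fun i : Fin m =>
        ({h : Fin r → V | Function.Injective h ∧ univ.image h = ε i} : Finset (Fin r → V))) =
        r.factorial ^ m := by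
      rw [Fintype.card_piFinset, prod_congr rfl fun i _ => card_enumerations (hε.2.2.1 i)]
      simp
    rw [← h3]
    refine card_equiv (Equiv.curry _ _ _) fun f => ?_
    rw [Fintype.mem_piFinset, mem_filter, hA, mem_filter]
    simp only [mem_filter, mem_univ, true_and, Equiv.curry_apply]
    constructor
    · rintro ⟨⟨h4, -, -⟩, h5⟩ i
      exact ⟨h4 i, congrFun h5 i⟩
    · intro h
      have h5 : rowSet f = ε := funext fun i => (h i).2
      exact ⟨⟨fun i => (h i).1, by rw [h5]; exact hε.2.1, by rw [h5]; exact hε.2.2.2⟩, h5⟩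
  have h4 : #T = ∑ F ∈ U, #{ε ∈ T | univ.image ε = F} := by
    refine card_eq_sum_card_fiberwise (f := fun ε => univ.image ε) fun ε hε => ?_
    rw [mem_coe, hT, mem_filter] at hε
    rw [mem_coe, hU, mem_filter]
    refine ⟨mem_univ _, ?_, fun e he => ?_, hε.2.2.2⟩
    · rw [card_image_of_injective _ hε.2.1]; simp
    · obtain ⟨i, -, rfl⟩ := mem_image.1 he
      exact hε.2.2.1 i
  have h5 : ∀ F ∈ U, #{ε ∈ T | univ.image ε = F} = m.factorial := by
    intro F hF
    rw [hU, mem_filter] at hF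
    rw [← card_enumerations hF.2.1]
    congr 1
    ext ε
    rw [mem_filter, hT, mem_filter, mem_filter]
    constructor
    · rintro ⟨h6, h7⟩; exact ⟨mem_univ _, h6.2.1, h7⟩
    · rintro ⟨-, h6, h7⟩
      exact ⟨⟨mem_univ _, h6, fun i => hF.2.2.1 _ (h7 ▸ mem_image_of_mem _ (mem_univ i)),
        by rw [h7]; exact hF.2.2.2⟩, h7⟩
  rw [h1, sum_congr rfl h2, sum_const, h4, sum_congr rfl h5, sum_const, smul_eq_mul, smul_eq_mul]
  ring

lemma edgeDeg_rowSet {m r : ℕ} {f : Fin m × Fin r → V} (h1 : ∀ i, Function.Injective fun a => f (i, a))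
    (h2 : Function.Injective (rowSet f)) (v : V) :
    edgeDeg (univ.image (rowSet f)) v = #{x | f x = v} := by
  rw [edgeDeg_image h2]
  symm
  refine card_bij (fun x _ => x.1) ?_ ?_ ?_
  · rintro ⟨i, a⟩ h
    simp only [mem_filter, mem_univ, true_and, rowSet, mem_image] at h ⊢
    exact ⟨a, h⟩
  · rintro ⟨i, a⟩ h ⟨j, b⟩ h' hij
    simp only [mem_filter, mem_univ, true_and] at h h' hij
    subst hij
    rw [h1 i (h.trans h'.symm)]
  · intro i hi
    simp only [mem_filter, mem_univ, true_and, rowSet, mem_image] at hi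
    obtain ⟨a, ha⟩ := hi
    exact ⟨(i, a), by simpa using ha, rfl⟩

/-- The pairs of distinct slots that lie in the same row of an `m × r` table. -/
def rowConflicts (m r : ℕ) : Finset (Sym2 (Fin m × Fin r)) :=
  ((univ : Finset (Fin m)) ×ˢ ({e | ¬ e.IsDiag} : Finset (Sym2 (Fin r)))).image
    fun q => q.2.map (Prod.mk q.1)

lemma mem_rowConflicts {m r : ℕ} {i j : Fin m} {a b : Fin r} :
    s((i, a), (j, b)) ∈ rowConflicts m r ↔ i = j ∧ a ≠ b := by
  simp only [rowConflicts, mem_image, mem_product, mem_univ, true_and, mem_filter, Prod.exists]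
  constructor
  · rintro ⟨l, e, he, h⟩
    induction e using Sym2.ind with
    | _ x y =>
      rw [Sym2.mk_isDiag_iff] at he
      rw [Sym2.map_mk] at h
      rcases Sym2.eq_iff.1 h with ⟨h1, h2⟩ | ⟨h1, h2⟩
      · simp only [Prod.mk.injEq] at h1 h2
        exact ⟨h1.1.symm.trans h2.1, by rw [← h1.2, ← h2.2]; exact he⟩
      · simp only [Prod.mk.injEq] at h1 h2
        exact ⟨h2.1.symm.trans h1.1, by rw [← h1.2, ← h2.2]; exact Ne.symm he⟩
  · rintro ⟨rfl, h⟩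
    exact ⟨i, s(a, b), by simpa using h, by simp⟩

lemma card_rowConflicts (m r : ℕ) : #(rowConflicts m r) = m * r.choose 2 := by
  rw [rowConflicts, card_image_of_injOn, card_product, card_univ, Fintype.card_fin]
  · congr 1
    rw [← Fintype.card_subtype, Sym2.card_subtype_not_diag, Fintype.card_fin]
  · rintro ⟨i, e⟩ - ⟨j, e'⟩ - h
    simp only at h
    have hij : i = j := by
      induction e using Sym2.ind with
      | _ x y =>
        have : (i, x) ∈ Sym2.map (Prod.mk j) e' := by rw [← h]; simp
        obtain ⟨z, -, hz⟩ := Sym2.mem_map.1 this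
        exact (congrArg Prod.fst hz).symm
    subst hij
    rw [Sym2.map.injective (Prod.mk_right_injective i) h]

lemma mem_colorings_rowConflicts {m r : ℕ} {d : V → ℕ} {f : Fin m × Fin r → V} :
    f ∈ colorings (rowConflicts m r) d ↔
      (∀ v, #{x | f x = v} = d v) ∧ ∀ i, Function.Injective fun a => f (i, a) := by
  rw [mem_colorings]
  refine and_congr_right fun _ => ⟨fun h i a b hab => ?_, fun h => ?_⟩
  · by_contra hne
    exact h (i, a) (i, b) (mem_rowConflicts.2 ⟨rfl, hne⟩) hab
  · rintro ⟨i, a⟩ ⟨j, b⟩ hab heq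
    obtain ⟨rfl, hne⟩ := mem_rowConflicts.1 hab
    exact hne (h i heq)

open Classical in
/-- `card_uniform_mul` for the hypergraphs with degrees `d` that avoid the edges in `X`, in terms of
colourings. -/
theorem card_hypergraphs_mul {m r : ℕ} (hr : 1 ≤ r) {d : V → ℕ} (hd : ∑ v, d v = m * r)
    (X : Finset (Finset V)) :
    #{F : Finset (Finset V) | (∀ e ∈ F, #e = r) ∧ Disjoint F X ∧ ∀ v, edgeDeg F v = d v} *
        (m.factorial * r.factorial ^ m) =
      #{f ∈ colorings (rowConflicts m r) d |
        Function.Injective (rowSet f) ∧ ∀ i, rowSet f i ∉ X} := by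
  have h := card_uniform_mul (V := V) m r fun F => Disjoint F X ∧ ∀ v, edgeDeg F v = d v
  convert h using 2
  · congr 1
    ext F
    simp only [mem_filter, mem_univ, true_and]
    constructor
    · rintro ⟨h1, h2, h3⟩
      refine ⟨Nat.eq_of_mul_eq_mul_right hr ?_, h1, h2, h3⟩
      rw [← hd, ← sum_edgeDeg h1]
      exact sum_congr rfl fun v _ => h3 v
    · rintro ⟨-, h1, h2, h3⟩
      exact ⟨h1, h2, h3⟩
  · ext f
    simp only [mem_filter, mem_univ, true_and, mem_colorings_rowConflicts]
    have hdis : Disjoint (univ.image (rowSet f)) X ↔ ∀ i, rowSet f i ∉ X := by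
      rw [disjoint_left]; simp
    constructor
    · rintro ⟨⟨h1, h2⟩, h3, h4⟩
      exact ⟨h2, h3, hdis.2 h4, fun v => by rw [edgeDeg_rowSet h2 h3, h1]⟩
    · rintro ⟨h2, h3, h4, h5⟩
      exact ⟨⟨fun v => by rw [← edgeDeg_rowSet h2 h3, h5], h2⟩, h3, hdis.1 h4⟩

end LabelledEdges

/-! ### Repeated edges are rare -/

section Repeats

variable {V : Type} [Fintype V] [DecidableEq V]

lemma card_rowConflicts_neighbor_le {m r : ℕ} (x : Fin m × Fin r) :
    #{u | s(x, u) ∈ rowConflicts m r} ≤ r := by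
  obtain ⟨i, a⟩ := x
  calc #{u | s((i, a), u) ∈ rowConflicts m r}
      ≤ #((univ : Finset (Fin r)).image fun b => (i, b)) := by
        refine card_le_card ?_
        rintro ⟨j, b⟩ h
        obtain ⟨rfl, -⟩ := mem_rowConflicts.1 (mem_filter.1 h).2
        exact mem_image_of_mem _ (mem_univ _)
    _ ≤ r := card_image_le.trans (by simp)

/-- Three prescribed slots: each coincidence costs a factor `2 κ / (m r)`. -/
lemma card_three_prescribed_le' {m r κ : ℕ} {d : V → ℕ} (hd : ∀ v, d v ≤ κ)
    (hM : 4 * r * κ + 10 ≤ m * r) (W : Finset (Fin m × Fin r)) (hW : #W ≤ 3)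
    (x : Fin 3 → Fin m × Fin r) (hx : Function.Injective x) (hxW : ∀ i, x i ∉ W)
    (w : Fin 3 → (Fin m × Fin r → V) → V) (hw : ∀ i f g, (∀ u ∈ W, f u = g u) → w i f = w i g) :
    (#{f ∈ colorings (rowConflicts m r) d | ∀ i, f (x i) = w i f} : ℝ) ≤
      (2 * κ / (m * r)) ^ 3 * #(colorings (rowConflicts m r) d) := by
  have hM' : (4 * r * κ + 10 : ℝ) ≤ m * r := by exact_mod_cast hM
  have hW' : (#W : ℝ) ≤ 3 := by exact_mod_cast hW
  have h0 : (0 : ℝ) ≤ r * κ := by positivity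
  have h := card_three_prescribed_le (V := V) card_rowConflicts_neighbor_le hd W x hx hxW w hw
    (by simp only [Fintype.card_prod, Fintype.card_fin]; push_cast; linarith)
  simp only [Fintype.card_prod, Fintype.card_fin] at h
  push_cast at h
  set a : ℝ := ((#{f ∈ colorings (rowConflicts m r) d | ∀ i, f (x i) = w i f} : ℕ) : ℝ)
  have hpos : (0 : ℝ) < m * r := by linarith
  have h1 : a * (m * r / 2) ^ 3 ≤ κ ^ 3 * #(colorings (rowConflicts m r) d) := by
    refine le_trans ?_ h
    gcongr
    linarith
  have h2 : (2 * (κ : ℝ) / (m * r)) ^ 3 = κ ^ 3 / (m * r / 2) ^ 3 := by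
    rw [← div_pow]; congr 1; field_simp
  rw [h2, div_mul_eq_mul_div, le_div_iff₀ (by positivity)]
  exact h1

/-- Among the tables without repeated entries in a row, few have two rows with the same set of
entries or a row whose set of entries belongs to `X`: already three coincidences are rare. -/
lemma card_not_simple_le {m r κ : ℕ} (hr : 3 ≤ r) {d : V → ℕ} (hd : ∀ v, d v ≤ κ)
    (hM : 4 * r * κ + 10 ≤ m * r) {X : Finset (Finset V)} (hX : ∀ e ∈ X, #e = r) :
    (#{f ∈ colorings (rowConflicts m r) d |
        ¬ (Function.Injective (rowSet f) ∧ ∀ i, rowSet f i ∉ X)} : ℝ) ≤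
      ((m : ℝ) ^ 2 * r ^ 3 + m * #X * r ^ 3) * (2 * κ / (m * r)) ^ 3 *
        #(colorings (rowConflicts m r) d) := by
  classical
  set L := colorings (rowConflicts m r) d with hL
  set c : ℝ := (2 * κ / (m * r)) ^ 3 * #L with hc
  have hc0 : 0 ≤ c := by positivity
  let a : Fin 3 → Fin r := fun l => ⟨l, by omega⟩
  have ha : Function.Injective a := fun x y h => Fin.ext (by simpa [a] using h)
  -- two rows with the same entries
  set T1 : Fin m × Fin m × (Fin 3 → Fin r) → Finset (Fin m × Fin r → V) := fun q =>
    if q.1 = q.2.1 then ∅ else {f ∈ L | ∀ l, f (q.1, a l) = f (q.2.1, q.2.2 l)} with hT1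
  -- a row whose entries form an edge of `X`
  set T2 : Fin m × Finset V → Finset (Fin m × Fin r → V) := fun q =>
    (Fintype.piFinset fun _ : Fin 3 => q.2).biUnion fun w => {f ∈ L | ∀ l, f (q.1, a l) = w l}
    with hT2
  have hsub : {f ∈ L | ¬ (Function.Injective (rowSet f) ∧ ∀ i, rowSet f i ∉ X)} ⊆
      univ.biUnion T1 ∪ (univ ×ˢ X).biUnion T2 := by
    intro f hf
    obtain ⟨hfL, hf⟩ := mem_filter.1 hf
    rw [mem_union, mem_biUnion, mem_biUnion]
    by_cases hinj : Function.Injective (rowSet f)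
    · right
      have : ∃ i, rowSet f i ∈ X := by
        by_contra! h; exact hf ⟨hinj, h⟩
      obtain ⟨i, hi⟩ := this
      refine ⟨(i, rowSet f i), mem_product.2 ⟨mem_univ _, hi⟩, mem_biUnion.2
        ⟨fun l => f (i, a l), ?_, by simp [hfL]⟩⟩
      rw [Fintype.mem_piFinset]
      exact fun l => mem_image_of_mem _ (mem_univ _)
    · left
      have : ∃ i j, rowSet f i = rowSet f j ∧ i ≠ j := by
        unfold Function.Injective at hinj; push Not at hinj; exact hinj
      obtain ⟨i, j, hij, hne⟩ := this
      have h1 : ∀ l, ∃ u, f (i, a l) = f (j, u) := by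
        intro l
        have : f (i, a l) ∈ rowSet f j := hij ▸ mem_image_of_mem _ (mem_univ _)
        obtain ⟨u, -, hu⟩ := mem_image.1 this
        exact ⟨u, hu.symm⟩
      choose u hu using h1
      exact ⟨(i, j, u), mem_univ _, by simp [hT1, hne, hfL, hu]⟩
  have hT1c : ∀ q, (#(T1 q) : ℝ) ≤ c := by
    rintro ⟨i, j, u⟩
    by_cases hij : i = j
    · simp [hT1, hij, hc0]
    · simp only [hT1, hij, if_false]
      refine card_three_prescribed_le' hd hM (univ.image fun l => (j, u l))
        (card_image_le.trans (by simp)) (fun l => (i, a l))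
        (fun x y h => ha (congrArg Prod.snd h)) (fun l h => ?_) (fun l f => f (j, u l))
        (fun l f g h => h _ (mem_image_of_mem _ (mem_univ _)))
      obtain ⟨l', -, hl'⟩ := mem_image.1 h
      exact hij (congrArg Prod.fst hl').symm
  have hT2c : ∀ q ∈ (univ : Finset (Fin m)) ×ˢ X, (#(T2 q) : ℝ) ≤ r ^ 3 * c := by
    rintro ⟨i, e⟩ hq
    have he := hX e (mem_product.1 hq).2
    have h1 : (#(T2 (i, e)) : ℝ) ≤
        ∑ w ∈ Fintype.piFinset fun _ : Fin 3 => e, (#{f ∈ L | ∀ l, f (i, a l) = w l} : ℝ) := by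
      exact_mod_cast card_biUnion_le
    refine h1.trans ((sum_le_card_nsmul _ _ c fun w _ => ?_).trans_eq ?_)
    · exact card_three_prescribed_le' hd hM ∅ (by simp) (fun l => (i, a l))
        (fun x y h => ha (congrArg Prod.snd h)) (by simp) (fun l _ => w l) (fun _ _ _ _ => rfl)
    · rw [Fintype.card_piFinset, nsmul_eq_mul]
      simp [he]
  have h1 : (#(univ.biUnion T1) : ℝ) ≤ m ^ 2 * r ^ 3 * c := by
    have h2 : (#(univ.biUnion T1) : ℝ) ≤ ∑ q, (#(T1 q) : ℝ) := by exact_mod_cast card_biUnion_le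
    refine h2.trans ((sum_le_card_nsmul _ _ c fun q _ => hT1c q).trans_eq ?_)
    have h3 : (Fintype.card (Fin m × Fin m × (Fin 3 → Fin r)) : ℝ) = m ^ 2 * r ^ 3 := by
      simp; ring
    rw [nsmul_eq_mul, card_univ, h3]
  have h2 : (#((univ ×ˢ X).biUnion T2) : ℝ) ≤ m * #X * (r ^ 3 * c) := by
    have h3 : (#((univ ×ˢ X).biUnion T2) : ℝ) ≤ ∑ q ∈ univ ×ˢ X, (#(T2 q) : ℝ) := by
      exact_mod_cast card_biUnion_le
    refine h3.trans ((sum_le_card_nsmul _ _ _ hT2c).trans_eq ?_)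
    rw [nsmul_eq_mul, card_product]
    simp
  have h3 : (#{f ∈ L | ¬ (Function.Injective (rowSet f) ∧ ∀ i, rowSet f i ∉ X)} : ℝ) ≤
      #(univ.biUnion T1) + #((univ ×ˢ X).biUnion T2) := by
    exact_mod_cast (card_le_card hsub).trans (card_union_le _ _)
  calc _ ≤ m ^ 2 * r ^ 3 * c + m * #X * (r ^ 3 * c) := h3.trans (add_le_add h1 h2)
    _ = _ := by rw [hc]; ring

end Repeats

/-! ### The expectation as a quotient -/

section Expectation

variable {V : Type} [Fintype V] [DecidableEq V]

open Classical in
/-- The `k`-regular `r`-uniform hypergraphs on `V`, given by their edge sets. -/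
noncomputable def regularHypergraphs (V : Type) [Fintype V] [DecidableEq V] (r k : ℕ) :
    Finset (Finset (Finset V)) :=
  univ.filter fun F => (∀ e ∈ F, #e = r) ∧ ∀ v, edgeDeg F v = k

open Classical in
/-- The edge sets that complement the edge set `E` to that of a `k`-regular `r`-uniform
hypergraph. -/
noncomputable def completions (r k : ℕ) (E : Finset (Finset V)) : Finset (Finset (Finset V)) :=
  univ.filter fun F => (∀ e ∈ F, #e = r) ∧ Disjoint F E ∧ ∀ v, edgeDeg F v + edgeDeg E v = k

lemma mem_regularHypergraphs {r k : ℕ} {F : Finset (Finset V)} :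
    F ∈ regularHypergraphs V r k ↔ (∀ e ∈ F, #e = r) ∧ ∀ v, edgeDeg F v = k := by
  simp [regularHypergraphs]

lemma mem_completions {r k : ℕ} {E F : Finset (Finset V)} :
    F ∈ completions r k E ↔
      (∀ e ∈ F, #e = r) ∧ Disjoint F E ∧ ∀ v, edgeDeg F v + edgeDeg E v = k := by
  simp [completions]

lemma toHyper_injective : Function.Injective (toHyper : Finset (Finset V) → Hypergraph V) := by
  intro E F h
  ext e
  have h1 := congrArg Hypergraph.edgeSet h
  have h2 : ((e : Set V) ∈ (toHyper E).edgeSet) ↔ (e : Set V) ∈ (toHyper F).edgeSet := by rw [h1]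
  simpa [mem_edgeSet_toHyper] using h2

lemma exists_toHyper_eq (H : Hypergraph V) (hH : H.vertexSet = Set.univ) :
    ∃ E, toHyper E = H := by
  classical
  refine ⟨univ.filter fun e : Finset V => (e : Set V) ∈ H.edgeSet, Hypergraph.ext hH.symm ?_⟩
  ext s
  rw [mem_edgeSet_toHyper]
  constructor
  · rintro ⟨e, he, rfl⟩; exact (mem_filter.1 he).2
  · intro hs
    exact ⟨s.toFinset, by simpa using hs, by simp⟩

lemma isUniform_toHyper {E : Finset (Finset V)} {r : ℕ} :
    IsUniform (toHyper E) r ↔ ∀ e ∈ E, #e = r := by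
  constructor
  · intro h e he
    have := h e ⟨e, he, rfl⟩
    rw [Set.encard_coe_eq_coe_finsetCard] at this
    exact_mod_cast this
  · rintro h _ ⟨e, he, rfl⟩
    rw [Set.encard_coe_eq_coe_finsetCard, h e he]

lemma tau_toHyper {F : Finset (Finset V)} {r : ℕ} (hF : ∀ e ∈ F, #e = r) :
    tau (toHyper F) = #{E ∈ hypertrees V r | E ⊆ F} := by
  have : {T : Hypergraph V | IsSpanningHypertree T (toHyper F)} =
      toHyper '' ({E ∈ hypertrees V r | E ⊆ F} : Finset (Finset (Finset V))) := by
    ext T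
    simp only [Set.mem_ofPred_eq, Set.mem_image, mem_coe, mem_filter, mem_hypertrees]
    constructor
    · rintro ⟨h1, h2, h3⟩
      obtain ⟨E, rfl⟩ := exists_toHyper_eq T h1
      have hsub : E ⊆ F := by
        intro e he
        have : (e : Set V) ∈ (toHyper F).edgeSet := h2 ⟨e, he, rfl⟩
        simpa [mem_edgeSet_toHyper] using this
      exact ⟨E, ⟨⟨fun e he => hF e (hsub he), h3⟩, hsub⟩, rfl⟩
    · rintro ⟨E, ⟨⟨h1, h2⟩, h3⟩, rfl⟩
      refine ⟨rfl, ?_, h2⟩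
      rintro _ ⟨e, he, rfl⟩
      exact ⟨e, h3 he, rfl⟩
  rw [tau, this, Set.ncard_image_of_injective _ toHyper_injective, Set.ncard_coe_finset]

lemma edgeDeg_sdiff {E F : Finset (Finset V)} (h : E ⊆ F) (v : V) :
    edgeDeg (F \ E) v + edgeDeg E v = edgeDeg F v := by
  rw [edgeDeg, edgeDeg, edgeDeg, ← card_union_of_disjoint, ← filter_union, sdiff_union_of_subset h]
  exact disjoint_filter_filter sdiff_disjoint

/-- Removing the edges of `E` turns the regular hypergraphs that contain `E` into completions. -/
lemma card_regular_superset {r k : ℕ} {E : Finset (Finset V)} (hE : ∀ e ∈ E, #e = r) :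
    #{F ∈ regularHypergraphs V r k | E ⊆ F} = #(completions r k E) := by
  refine card_bij' (fun F _ => F \ E) (fun F _ => F ∪ E) ?_ ?_ ?_ ?_
  · intro F hF
    simp only [mem_regularHypergraphs, mem_completions, mem_filter] at hF ⊢
    exact ⟨fun e he => hF.1.1 e (mem_sdiff.1 he).1, sdiff_disjoint,
      fun v => by rw [edgeDeg_sdiff hF.2, hF.1.2]⟩
  · intro F hF
    simp only [mem_regularHypergraphs, mem_completions, mem_filter] at hF ⊢
    refine ⟨⟨fun e he => ?_, fun v => ?_⟩, subset_union_right⟩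
    · rcases mem_union.1 he with h | h
      · exact hF.1 e h
      · exact hE e h
    · rw [← edgeDeg_sdiff (E := E) (F := F ∪ E) subset_union_right, union_sdiff_right,
        hF.2.1.sdiff_eq_left, hF.2.2]
  · intro F hF
    exact sdiff_union_of_subset (mem_filter.1 hF).2
  · intro F hF
    rw [union_sdiff_right, (mem_completions.1 hF).2.1.sdiff_eq_left]

/-- The expectation as a quotient of two counts. -/
theorem expectedTauRegular_eq (n r k : ℕ) : expectedTauRegular n r k =
    (∑ E ∈ hypertrees (Fin n) r, (#(completions r k E) : ℝ)) /
      #(regularHypergraphs (Fin n) r k) := by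
  classical
  have himg : (finite_hypergraphsWithDegrees n r fun _ => k).toFinset =
      (regularHypergraphs (Fin n) r k).image toHyper := by
    ext H
    simp only [Set.Finite.mem_toFinset, hypergraphsWithDegrees, Set.mem_ofPred_eq, mem_image,
      mem_regularHypergraphs]
    constructor
    · rintro ⟨h1, h2, h3⟩
      obtain ⟨E, rfl⟩ := exists_toHyper_eq H h1
      exact ⟨E, ⟨isUniform_toHyper.1 h2, fun v => by rw [← degree_toHyper]; exact h3 v⟩, rfl⟩
    · rintro ⟨E, ⟨h1, h2⟩, rfl⟩
      exact ⟨rfl, isUniform_toHyper.2 h1, fun v => by rw [degree_toHyper]; exact h2 v⟩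
  rw [expectedTauRegular, expectedTau, himg, card_image_of_injective _ toHyper_injective,
    sum_image toHyper_injective.injOn]
  congr 1
  have h1 : ∀ F ∈ regularHypergraphs (Fin n) r k, tau (toHyper F) =
      #{E ∈ hypertrees (Fin n) r | E ⊆ F} := fun F hF =>
    tau_toHyper (mem_regularHypergraphs.1 hF).1
  rw [← Nat.cast_sum, sum_congr rfl h1, ← Nat.cast_sum]
  congr 1
  simp only [card_filter]
  rw [sum_comm]
  refine sum_congr rfl fun E hE => ?_
  rw [← card_filter]
  exact card_regular_superset (mem_hypertrees.1 hE).1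

end Expectation

/-! ### Joint colourings of tables and degree records -/

section Joint

variable {V : Type} [Fintype V] [DecidableEq V]

/-- The tables without repeated entries in a row that use the vertex `v` exactly `k - c v` times
(none if `c v > k` for some `v`). -/
def tables (m r k : ℕ) (c : V → ℕ) : Finset (Fin m × Fin r → V) :=
  univ.filter fun f => (∀ v, #{x | f x = v} + c v = k) ∧ ∀ i, Function.Injective fun a => f (i, a)

lemma tables_eq_colorings {m r k : ℕ} {c : V → ℕ} (hc : ∀ v, c v ≤ k) :
    tables m r k c = colorings (rowConflicts m r) fun v => k - c v := by
  ext f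
  rw [mem_colorings_rowConflicts, tables, mem_filter]
  simp only [mem_univ, true_and]
  refine and_congr_left fun _ => forall_congr' fun v => ?_
  have := hc v
  omega

lemma tables_eq_empty {m r k : ℕ} {c : V → ℕ} {v : V} (hc : k < c v) : tables m r k c = ∅ := by
  rw [tables, filter_false_of_mem]
  rintro f - ⟨h, -⟩
  have := h v
  omega

lemma card_fiber_sum {S T : Type*} [Fintype S] [Fintype T] (f : S ⊕ T → V) (v : V) :
    #{x | f x = v} = #{s | f (Sum.inl s) = v} + #{t | f (Sum.inr t) = v} := by
  simp only [card_filter]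
  exact Fintype.sum_sum_type _

lemma mem_image_map_inl {S T : Type*} [Fintype S] [Fintype T] [DecidableEq S] [DecidableEq T]
    {B : Finset (Sym2 S)} {x y : S ⊕ T} :
    s(x, y) ∈ B.image (Sym2.map Sum.inl) ↔ ∃ a b, x = Sum.inl a ∧ y = Sum.inl b ∧ s(a, b) ∈ B := by
  rw [mem_image]
  constructor
  · rintro ⟨e, he, h⟩
    induction e using Sym2.ind with
    | _ a b =>
      rw [Sym2.map_mk] at h
      rcases Sym2.eq_iff.1 h with ⟨h1, h2⟩ | ⟨h1, h2⟩
      · exact ⟨a, b, h1.symm, h2.symm, he⟩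
      · exact ⟨b, a, h2.symm, h1.symm, by rwa [Sym2.eq_swap]⟩
  · rintro ⟨a, b, rfl, rfl, h⟩
    exact ⟨_, h, Sym2.map_mk _ _ _⟩

/-- Summing over the `h` that record the degrees of the hypertrees merges the table and `h` into one
equitable colouring, in which every vertex is used `k - 1` times. -/
theorem sum_card_tables (m r k b : ℕ) (hk : 1 ≤ k) :
    ∑ h : Fin b → V, #(tables m r k fun v => #{i | h i = v} + 1) =
      #(colorings ((rowConflicts m r).image (Sym2.map (Sum.inl : _ → (Fin m × Fin r) ⊕ Fin b)))
        fun _ : V => k - 1) := by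
  rw [← card_sigma]
  refine card_bij' (fun q _ => Sum.elim q.2 q.1) (fun f _ => ⟨f ∘ Sum.inr, f ∘ Sum.inl⟩) ?_ ?_ ?_ ?_
  · rintro ⟨h, f⟩ hq
    rw [mem_sigma, tables, mem_filter] at hq
    obtain ⟨-, -, h1, h2⟩ := hq
    rw [mem_colorings]
    refine ⟨fun v => ?_, fun x y hxy => ?_⟩
    · rw [card_fiber_sum]
      have := h1 v
      change #{x | f x = v} + (#{i | h i = v} + 1) = k at this
      change #{x | f x = v} + #{i | h i = v} = k - 1
      omega
    · obtain ⟨⟨i, a⟩, ⟨j, b⟩, rfl, rfl, hab⟩ := mem_image_map_inl.1 hxy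
      obtain ⟨rfl, hne⟩ := mem_rowConflicts.1 hab
      exact fun heq => hne (h2 i heq)
  · intro f hf
    rw [mem_colorings] at hf
    rw [mem_sigma, tables, mem_filter]
    refine ⟨mem_univ _, mem_univ _, fun v => ?_, fun i a b hab => ?_⟩
    · have := hf.1 v
      rw [card_fiber_sum] at this
      simp only [Function.comp_apply]
      omega
    · by_contra hne
      exact hf.2 (Sum.inl (i, a)) (Sum.inl (i, b))
        (mem_image_map_inl.2 ⟨_, _, rfl, rfl, mem_rowConflicts.2 ⟨rfl, hne⟩⟩) hab
  · rintro ⟨h, f⟩ _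
    rfl
  · intro f _
    exact Sum.elim_comp_inl_inr f

end Joint

/-! ### Elementary bounds for logarithms -/

section LogBounds

lemma abs_log_sub_log_le {a x η : ℝ} (ha : 0 < a) (hη : η ≤ 1 / 2) (h1 : (1 - η) * a ≤ x)
    (h2 : x ≤ a) : 0 < x ∧ |Real.log x - Real.log a| ≤ 2 * η := by
  have hx : 0 < x := lt_of_lt_of_le (by nlinarith) h1
  have hη0 : 0 ≤ η := by nlinarith
  refine ⟨hx, ?_⟩
  have h3 : Real.log x ≤ Real.log a := Real.log_le_log hx h2
  rw [abs_of_nonpos (by linarith)]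
  have h4 := Real.one_sub_inv_le_log_of_pos (div_pos hx ha)
  rw [Real.log_div hx.ne' ha.ne', inv_div] at h4
  have h5 : a / x ≤ 1 + 2 * η := by
    rw [div_le_iff₀ hx]
    nlinarith
  linarith

lemma abs_log_sub_le_of_exp {a x u ε : ℝ} (ha : 0 < a) (h1 : a * Real.exp (u - ε) ≤ x)
    (h2 : x ≤ a * Real.exp (u + ε)) : 0 < x ∧ |Real.log x - (Real.log a + u)| ≤ ε := by
  have hx : 0 < x := lt_of_lt_of_le (by positivity) h1
  refine ⟨hx, ?_⟩
  have h3 := Real.log_le_log (by positivity) h1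
  have h4 := Real.log_le_log hx h2
  rw [Real.log_mul ha.ne' (Real.exp_pos _).ne', Real.log_exp] at h3 h4
  rw [abs_le]
  constructor <;> linarith

end LogBounds

/-! ### Counts of regular hypergraphs and of completions -/

section Counts

variable {V : Type} [Fintype V] [DecidableEq V]

lemma coincidence_bound_eq {m r k x : ℝ} (hm : m ≠ 0) (hr : r ≠ 0) :
    (m ^ 2 * r ^ 3 + m * x * r ^ 3) * (2 * k / (m * r)) ^ 3 = 8 * k ^ 3 * (m + x) / m ^ 2 := by
  field_simp
  ring

/-- The number of simple hypergraphs with degrees `d` that avoid the edges in `X`, up to the factor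
for the labellings, is nearly the number of tables without repeated entries in a row. -/
lemma card_simple_bounds {m r κ : ℕ} (hr : 3 ≤ r) {d : V → ℕ} (hd : ∀ v, d v ≤ κ)
    (hsum : ∑ v, d v = m * r) (hM : 4 * r * κ + 10 ≤ m * r) {X : Finset (Finset V)}
    (hX : ∀ e ∈ X, #e = r) {Y : ℕ}
    (hYc : Y = #(univ.filter fun F : Finset (Finset V) =>
      (∀ e ∈ F, #e = r) ∧ Disjoint F X ∧ ∀ v, edgeDeg F v = d v)) :
    (1 - 8 * (κ : ℝ) ^ 3 * (m + #X) / (m : ℝ) ^ 2) * #(colorings (rowConflicts m r) d) ≤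
        Y * (m.factorial * (r.factorial : ℝ) ^ m) ∧
      Y * (m.factorial * (r.factorial : ℝ) ^ m) ≤ #(colorings (rowConflicts m r) d) := by
  classical
  have h1 := card_hypergraphs_mul (V := V) (m := m) (by omega : 1 ≤ r) hsum X
  have h2 := card_not_simple_le hr hd hM hX
  have h3 := card_filter_add_card_filter_not (s := colorings (rowConflicts m r) d)
    (fun f => Function.Injective (rowSet f) ∧ ∀ i, rowSet f i ∉ X)
  have hmr : m ≠ 0 := by rintro rfl; omega
  rw [coincidence_bound_eq (by exact_mod_cast hmr) (by norm_cast; omega)] at h2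
  have h4 : Y * (m.factorial * r.factorial ^ m) = #{f ∈ colorings (rowConflicts m r) d |
        Function.Injective (rowSet f) ∧ ∀ i, rowSet f i ∉ X} := by
    rw [← h1, hYc]
  have h5 : (Y * (m.factorial * (r.factorial : ℝ) ^ m) : ℝ) =
      #{f ∈ colorings (rowConflicts m r) d |
        Function.Injective (rowSet f) ∧ ∀ i, rowSet f i ∉ X} := by exact_mod_cast h4
  have h6 : (#{f ∈ colorings (rowConflicts m r) d |
        Function.Injective (rowSet f) ∧ ∀ i, rowSet f i ∉ X} : ℝ) +
      #{f ∈ colorings (rowConflicts m r) d |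
        ¬ (Function.Injective (rowSet f) ∧ ∀ i, rowSet f i ∉ X)} =
      #(colorings (rowConflicts m r) d) := by exact_mod_cast h3
  rw [h5]
  have h7 : (0 : ℝ) ≤ #{f ∈ colorings (rowConflicts m r) d |
        ¬ (Function.Injective (rowSet f) ∧ ∀ i, rowSet f i ∉ X)} := by positivity
  constructor
  · rw [sub_mul, one_mul]
    refine sub_le_iff_le_add.2 ?_
    rw [← h6] at h2 ⊢
    linarith
  · linarith

lemma card_regular_bounds {N r k : ℕ} (hr : 3 ≤ r) (hN : Fintype.card V * k = N * r)
    (hM : 4 * r * k + 10 ≤ N * r) :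
    (1 - 8 * (k : ℝ) ^ 3 / N) * #(colorings (rowConflicts N r) fun _ : V => k) ≤
        #(regularHypergraphs V r k) * (N.factorial * (r.factorial : ℝ) ^ N) ∧
      #(regularHypergraphs V r k) * (N.factorial * (r.factorial : ℝ) ^ N) ≤
        #(colorings (rowConflicts N r) fun _ : V => k) := by
  have hN0 : (N : ℝ) ≠ 0 := by
    have : N ≠ 0 := by rintro rfl; omega
    exact_mod_cast this
  have h := card_simple_bounds (V := V) (m := N) hr (d := fun _ => k) (κ := k) (fun _ => le_rfl)
    (by simp [hN]) hM (X := ∅) (by simp) (Y := #(regularHypergraphs V r k))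
    (by congr 1; ext F; simp [mem_regularHypergraphs])
  have e : 8 * (k : ℝ) ^ 3 * (N + (#(∅ : Finset (Finset V)) : ℕ)) / (N : ℝ) ^ 2 =
      8 * (k : ℝ) ^ 3 / N := by
    rw [card_empty]; field_simp; simp
  rwa [e] at h

lemma card_completions_bounds {m t r k : ℕ} (hr : 3 ≤ r) {E : Finset (Finset V)}
    (hE : ∀ e ∈ E, #e = r) (hEt : #E = t) (hN : Fintype.card V * k = (m + t) * r)
    (hM : 4 * r * k + 10 ≤ m * r) :
    (1 - 8 * (k : ℝ) ^ 3 * (m + t) / (m : ℝ) ^ 2) * #(tables m r k (edgeDeg E)) ≤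
        #(completions r k E) * (m.factorial * (r.factorial : ℝ) ^ m) ∧
      #(completions r k E) * (m.factorial * (r.factorial : ℝ) ^ m) ≤
        #(tables m r k (edgeDeg E)) := by
  by_cases hc : ∀ v, edgeDeg E v ≤ k
  · rw [tables_eq_colorings hc, ← hEt]
    refine card_simple_bounds hr (fun v => Nat.sub_le _ _) ?_ hM hE ?_
    · have h1 : ∑ v, (k - edgeDeg E v) + ∑ v, edgeDeg E v = Fintype.card V * k := by
        rw [← sum_add_distrib, sum_congr rfl fun v _ => Nat.sub_add_cancel (hc v)]
        simp
      rw [sum_edgeDeg hE, hEt, hN, add_mul] at h1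
      omega
    · congr 1
      ext F
      rw [mem_completions, mem_filter]
      simp only [mem_univ, true_and]
      refine and_congr_right fun _ => and_congr_right fun _ => forall_congr' fun v => ?_
      have := hc v
      omega
  · -- If some degree of `E` exceeds `k`, there are neither completions nor tables.
    push Not at hc
    obtain ⟨v, hv⟩ := hc
    have h1 : completions r k E = ∅ := by
      rw [eq_empty_iff_forall_notMem]
      intro F hF
      have := (mem_completions.1 hF).2.2 v
      omega
    rw [tables_eq_empty hv, h1]
    simp

end Counts

/-! ### The main term in factorials -/

section MainEstimate

variable {n r k b s m : ℕ}

/-- The joint conflict graph for a table of `m` rows and `b` free slots. -/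
abbrev jointConflicts (m r b : ℕ) : Finset (Sym2 ((Fin m × Fin r) ⊕ Fin b)) :=
  (rowConflicts m r).image (Sym2.map Sum.inl)

lemma card_jointConflicts (m r b : ℕ) : #(jointConflicts m r b) = m * r.choose 2 := by
  rw [jointConflicts, card_image_of_injective _ (Sym2.map.injective Sum.inl_injective),
    card_rowConflicts]

lemma not_isDiag_of_mem_rowConflicts {m r : ℕ} (e : Sym2 (Fin m × Fin r))
    (he : e ∈ rowConflicts m r) : ¬ e.IsDiag := by
  induction e using Sym2.ind with
  | _ x y =>
    obtain ⟨i, a⟩ := x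
    obtain ⟨j, c⟩ := y
    obtain ⟨rfl, hne⟩ := mem_rowConflicts.1 he
    simpa using hne

lemma not_isDiag_of_mem_jointConflicts (e : Sym2 ((Fin m × Fin r) ⊕ Fin b))
    (he : e ∈ jointConflicts m r b) : ¬ e.IsDiag := by
  obtain ⟨e', he', rfl⟩ := mem_image.1 he
  have := not_isDiag_of_mem_rowConflicts e' he'
  induction e' using Sym2.ind with
  | _ x y => simpa using this

lemma card_jointConflicts_neighbor_le (x : (Fin m × Fin r) ⊕ Fin b) :
    #{u | s(x, u) ∈ jointConflicts m r b} ≤ r := by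
  rcases x with x | i
  · calc #{u | s(Sum.inl x, u) ∈ jointConflicts m r b}
        ≤ #(({u | s(x, u) ∈ rowConflicts m r} : Finset (Fin m × Fin r)).image
            (Sum.inl : _ → (Fin m × Fin r) ⊕ Fin b)) := by
          refine card_le_card fun u hu => ?_
          obtain ⟨a, c, h1, rfl, h2⟩ := mem_image_map_inl.1 (mem_filter.1 hu).2
          rw [Sum.inl_injective h1]
          exact mem_image_of_mem _ (by simpa using h2)
      _ ≤ r := card_image_le.trans (card_rowConflicts_neighbor_le x)
  · rw [filter_false_of_mem]
    · simp
    · intro u _ hu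
      obtain ⟨a, c, h1, -⟩ := mem_image_map_inl.1 hu
      simp at h1

lemma log_card_colorings_empty {S V : Type*} [Fintype S] [DecidableEq S] [Fintype V]
    [DecidableEq V] {κ : ℕ} (h : Fintype.card V * κ = Fintype.card S) :
    (0 : ℝ) < #(colorings (∅ : Finset (Sym2 S)) fun _ : V => κ) ∧
    Real.log #(colorings (∅ : Finset (Sym2 S)) fun _ : V => κ) =
      Real.log (Fintype.card S).factorial - Fintype.card V * Real.log κ.factorial := by
  have h1 := card_colorings_empty (S := S) (d := fun _ : V => κ) (by simp [h])
  have h2 : (#(colorings (∅ : Finset (Sym2 S)) fun _ : V => κ) : ℝ) *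
      (κ.factorial : ℝ) ^ Fintype.card V = (Fintype.card S).factorial := by
    rw [← h1]; push_cast; simp
  have hpos : (0 : ℝ) < #(colorings (∅ : Finset (Sym2 S)) fun _ : V => κ) := by
    have := colorings_empty_nonempty (S := S) (d := fun _ : V => κ) (by simp [h])
    exact_mod_cast this.card_pos
  refine ⟨hpos, ?_⟩
  have hκ : (0 : ℝ) < κ.factorial := by exact_mod_cast κ.factorial_pos
  rw [← h2, Real.log_mul hpos.ne' (by positivity), Real.log_pow]
  ring

/-- The logarithm of the main term `k^n r^t ((k-1)n)! (n-1)! (m+t)! / (t! m! (kn)!)`, in which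
`t = b + 1` and `m` are the numbers of edges inside and outside the hypertree. -/
noncomputable def logMainTerm (n r k b m : ℕ) : ℝ :=
  n * Real.log k + (b + 1) * Real.log r + Real.log ((k - 1) * n).factorial +
    Real.log (n - 1).factorial + Real.log (m + (b + 1)).factorial -
    Real.log (b + 1).factorial - Real.log m.factorial - Real.log (k * n).factorial

/-- Numerical consequences of `n` being large. The first one says that the hypergraph outside the
hypertree has at least a quarter of the `k n` incidences. -/
lemma numeric_bounds (hs : 2 ≤ s) (hr : r = s + 1) (hk : 2 ≤ k) (hn : n = (b + 1) * s + 1)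
    (hm : n * k = (m + (b + 1)) * r) (hbig : 1000 * r ^ 2 * k ^ 2 ≤ n) :
    (k : ℝ) * n ≤ 4 * (m * r) ∧ 4 * r * k + 10 ≤ m * r ∧
      8 * (k : ℝ) ^ 3 * (m + (b + 1 : ℕ)) / (m : ℝ) ^ 2 ≤ 128 * r ^ 2 * k ^ 2 / n ∧
      8 * (k : ℝ) ^ 3 / (m + (b + 1) : ℕ) ≤ 8 * r ^ 2 * k ^ 2 / n := by
  have hs' : (2 : ℝ) ≤ s := by exact_mod_cast hs
  have hk' : (2 : ℝ) ≤ k := by exact_mod_cast hk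
  have hr' : (r : ℝ) = s + 1 := by exact_mod_cast hr
  have hn' : (n : ℝ) = (b + 1) * s + 1 := by exact_mod_cast hn
  have hm' : (n : ℝ) * k = (m + (b + 1)) * r := by exact_mod_cast hm
  have hbig' : 1000 * (r : ℝ) ^ 2 * k ^ 2 ≤ n := by exact_mod_cast hbig
  have hb0 : (0 : ℝ) ≤ b := by positivity
  have h1 : (k : ℝ) * n ≤ 4 * (m * r) := by
    have h2 : ((b : ℝ) + 1) * r ≤ 3 / 2 * n := by
      rw [hr', hn']; nlinarith
    nlinarith
  have hr3 : (3 : ℝ) ≤ r := by linarith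
  have hnpos : (0 : ℝ) < n := lt_of_lt_of_le (by positivity) hbig'
  have hmr : 0 < (m : ℝ) * r := by nlinarith [mul_pos (by linarith : (0 : ℝ) < k) hnpos]
  have hmpos : (0 : ℝ) < m := pos_of_mul_pos_left hmr (by linarith)
  refine ⟨h1, ?_, ?_, ?_⟩
  · have h3 : (r : ℝ) * k ≤ r ^ 2 * k ^ 2 := by
      have : (1 : ℝ) ≤ r * k := by nlinarith
      nlinarith
    have h4 : (4 : ℝ) * r * k + 10 ≤ m * r := by nlinarith
    exact_mod_cast h4
  · rw [div_le_div_iff₀ (by positivity) hnpos]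
    push_cast
    have e1 : 8 * (k : ℝ) ^ 3 * (m + (b + 1)) * n * r = 8 * k ^ 2 * (k * n) ^ 2 := by
      calc _ = 8 * (k : ℝ) ^ 3 * n * ((m + (b + 1)) * r) := by ring
        _ = _ := by rw [← hm']; ring
    have e2 : ((k : ℝ) * n) ^ 2 ≤ (4 * (m * r)) ^ 2 := by gcongr
    have e3 : 8 * (k : ℝ) ^ 3 * (m + (b + 1)) * n * r ≤ 128 * r ^ 2 * k ^ 2 * m ^ 2 * 1 := by
      rw [e1]; nlinarith [sq_nonneg (k : ℝ)]
    have e4 : 8 * (k : ℝ) ^ 3 * (m + (b + 1)) * n * 1 ≤ 8 * (k : ℝ) ^ 3 * (m + (b + 1)) * n * r := by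
      gcongr; linarith
    linarith
  · push_cast
    rw [div_le_div_iff₀ (by positivity) hnpos]
    have e1 : 8 * (k : ℝ) ^ 3 * n = 8 * k ^ 2 * r * (m + (b + 1)) := by
      calc _ = 8 * (k : ℝ) ^ 2 * (n * k) := by ring
        _ = _ := by rw [hm']; ring
    rw [e1]
    have e2 : (r : ℝ) ≤ r ^ 2 := by nlinarith
    have : 8 * (k : ℝ) ^ 2 * r * (m + (b + 1)) ≤ 8 * (k : ℝ) ^ 2 * r ^ 2 * (m + (b + 1)) := by
      gcongr
    linarith

end MainEstimate

/-! ### The logarithm of the expectation -/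

section LogExpectation

variable {n r k b s m : ℕ}

lemma cast_choose_two (r : ℕ) : ((r.choose 2 : ℕ) : ℝ) = r * (r - 1) / 2 := by
  exact_mod_cast Nat.cast_choose_two ℝ r

/-- The number of tables for `k`-regular hypergraphs: the `N r (r - 1) / 2` conflicts contribute
`-(k - 1) / (n k)` each to the logarithm. -/
lemma log_card_regular_tables (hr : 3 ≤ r) (hk : 1 ≤ k) {N : ℕ} (hN : n * k = N * r)
    (hM : 4 * r * k + 6 ≤ N * r) :
    (0 : ℝ) < #(colorings (rowConflicts N r) fun _ : Fin n => k) ∧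
    |Real.log #(colorings (rowConflicts N r) fun _ : Fin n => k) -
      (Real.log (k * n).factorial - n * Real.log k.factorial - (r - 1) * (k - 1) / 2)| ≤
      5 * r ^ 2 * k ^ 2 / n := by
  have hcard : Fintype.card (Fin N × Fin r) = N * r := by simp
  have hn0 : 0 < n := by
    rcases Nat.eq_zero_or_pos n with rfl | h
    · omega
    · exact h
  have hnpos : (0 : ℝ) < n := by exact_mod_cast hn0
  have hkpos : (1 : ℝ) ≤ k := by exact_mod_cast hk
  have hrpos : (3 : ℝ) ≤ r := by exact_mod_cast hr
  have hNr : (N : ℝ) * r = n * k := by exact_mod_cast hN.symm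
  obtain ⟨h0pos, h0⟩ := log_card_colorings_empty (S := Fin N × Fin r) (V := Fin n) (κ := k)
    (by rw [hcard, Fintype.card_fin, hN])
  obtain ⟨h1, h2⟩ := card_colorings_bounds (V := Fin n) hk (by omega : 1 ≤ r)
    (by rw [hcard]; exact hM) (rowConflicts N r) not_isDiag_of_mem_rowConflicts
    card_rowConflicts_neighbor_le
  rw [mul_sub] at h1
  rw [mul_add] at h2
  obtain ⟨hpos, h3⟩ := abs_log_sub_le_of_exp h0pos h1 h2
  refine ⟨hpos, ?_⟩
  rw [h0, hcard, Fintype.card_fin, card_rowConflicts] at h3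
  push_cast at h3
  rw [cast_choose_two, hNr] at h3
  have e1 : (N : ℝ) * (r * (r - 1) / 2) = n * k * (r - 1) / 2 := by rw [← hNr]; ring
  rw [e1] at h3
  have e2 : (n : ℝ) * k * (r - 1) / 2 * (-((k : ℝ) - 1) / (n * k)) = -((r - 1) * (k - 1) / 2) := by
    field_simp
  have e3 : (n : ℝ) * k * (r - 1) / 2 * (10 * r * k ^ 2 / (n * k) ^ 2) = 5 * r * (r - 1) * k / n := by
    field_simp; ring
  rw [e2, e3, ← hN, mul_comm n k] at h3
  refine (le_trans (le_of_eq ?_) h3).trans ?_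
  · congr 1
  · refine div_le_div_of_nonneg_right ?_ hnpos.le
    have g1 : (r : ℝ) * (r - 1) ≤ r ^ 2 := by nlinarith
    have g2 : (k : ℝ) ≤ k ^ 2 := by nlinarith
    have g3 := mul_le_mul g1 g2 (by linarith) (sq_nonneg (r : ℝ))
    linarith

lemma degree_correction_le {x y z : ℝ} (hx : 3 ≤ x) (hy : 2 ≤ y) (hz : 0 < z) :
    x * (y - 2) / (2 * (y - 1) * z) ≤ x ^ 2 * y ^ 2 / z := by
  have hy1 : 0 < y - 1 := by linarith
  have h1 : x * (y - 2) / (2 * (y - 1)) ≤ x := by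
    rw [div_le_iff₀ (by linarith)]
    nlinarith
  have h2 : x * 1 ≤ x ^ 2 * y ^ 2 :=
    mul_le_mul (by nlinarith) (by nlinarith) zero_le_one (sq_nonneg x)
  rw [← div_div]
  exact div_le_div_of_nonneg_right (by linarith) hz.le

set_option maxHeartbeats 400000 in
/-- The number of joint colourings: the `m r (r - 1) / 2` conflicts contribute
`-(k - 2) / ((k - 1) n)` each to the logarithm. -/
lemma log_card_joint (hs : 2 ≤ s) (hr : r = s + 1) (hk : 2 ≤ k) (hn : n = (b + 1) * s + 1)
    (hm : n * k = (m + (b + 1)) * r) (hM : 4 * r * k + 10 ≤ m * r) :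
    (0 : ℝ) < #(colorings (jointConflicts m r b) fun _ : Fin n => k - 1) ∧
    |Real.log #(colorings (jointConflicts m r b) fun _ : Fin n => k - 1) -
      (Real.log ((k - 1) * n).factorial - n * Real.log (k - 1).factorial -
        (k * r - k - r) * (k - 2) / (2 * (k - 1)))| ≤ 6 * r ^ 2 * k ^ 2 / n := by
  have hS : m * r + b = (k - 1) * n := by
    obtain ⟨κ, rfl⟩ : ∃ κ, k = κ + 1 := ⟨k - 1, by omega⟩
    rw [Nat.add_sub_cancel]
    subst hr
    nlinarith
  have hcard : Fintype.card ((Fin m × Fin r) ⊕ Fin b) = (k - 1) * n := by simp [hS]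
  have hk1 : ((k - 1 : ℕ) : ℝ) = k - 1 := by
    rw [Nat.cast_sub (by omega)]; simp
  have hn0 : 0 < n := by omega
  have hnpos : (0 : ℝ) < n := by exact_mod_cast hn0
  have hkpos : (2 : ℝ) ≤ k := by exact_mod_cast hk
  have hrs : (r : ℝ) = s + 1 := by exact_mod_cast hr
  have hs' : (2 : ℝ) ≤ s := by exact_mod_cast hs
  have hrpos : (3 : ℝ) ≤ r := by linarith
  have hn' : (n : ℝ) = (b + 1) * s + 1 := by exact_mod_cast hn
  have hm' : (n : ℝ) * k = (m + (b + 1)) * r := by exact_mod_cast hm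
  have hmr : (m : ℝ) * r * (r - 1) = n * (k * r - k - r) + r := by
    have h1 : (m : ℝ) * r = n * k - (b + 1) * r := by rw [hm']; ring
    have h2 : ((b : ℝ) + 1) * (r - 1) = n - 1 := by rw [hn', hrs]; ring
    rw [h1, sub_mul, mul_right_comm _ (r : ℝ), h2]; ring
  have hmr' : (m : ℝ) * r ≤ n * k := by
    rw [hm']; gcongr; linarith [show (0 : ℝ) ≤ b from by positivity]
  obtain ⟨h0pos, h0⟩ := log_card_colorings_empty (S := (Fin m × Fin r) ⊕ Fin b) (V := Fin n)
    (κ := k - 1) (by rw [hcard, Fintype.card_fin, mul_comm])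
  have hM' : 4 * r * (k - 1) + 6 ≤ Fintype.card ((Fin m × Fin r) ⊕ Fin b) := by
    rw [hcard, ← hS]
    have : 4 * r * (k - 1) ≤ 4 * r * k := Nat.mul_le_mul_left _ (Nat.sub_le _ _)
    omega
  obtain ⟨h1, h2⟩ := card_colorings_bounds (V := Fin n) (by omega : 1 ≤ k - 1) (by omega : 1 ≤ r)
    hM' (jointConflicts m r b) not_isDiag_of_mem_jointConflicts card_jointConflicts_neighbor_le
  rw [mul_sub] at h1
  rw [mul_add] at h2
  obtain ⟨hpos, h3⟩ := abs_log_sub_le_of_exp h0pos h1 h2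
  refine ⟨hpos, ?_⟩
  rw [h0, hcard, Fintype.card_fin, card_jointConflicts] at h3
  push_cast at h3
  rw [hk1, cast_choose_two] at h3
  have hk0 : (k : ℝ) - 1 ≠ 0 := by linarith
  have e2 : (m : ℝ) * (r * (r - 1) / 2) * (-((k : ℝ) - 1 - 1) / ((k - 1) * n)) =
      -((k * r - k - r) * (k - 2) / (2 * (k - 1))) - r * (k - 2) / (2 * (k - 1) * n) := by
    have : (m : ℝ) * (r * (r - 1) / 2) = (n * (k * r - k - r) + r) / 2 := by rw [← hmr]; ring
    rw [this]
    field_simp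
    ring
  have e3 : (m : ℝ) * (r * (r - 1) / 2) * (10 * r * (k - 1) ^ 2 / ((k - 1) * n) ^ 2) =
      5 * (m * r) * (r * (r - 1)) / n ^ 2 := by
    field_simp; ring
  rw [e2, e3] at h3
  have e4 : 5 * ((m : ℝ) * r) * (r * (r - 1)) / n ^ 2 ≤ 5 * r ^ 2 * k ^ 2 / n := by
    rw [div_le_div_iff₀ (by positivity) hnpos]
    have f1 : 5 * ((m : ℝ) * r) * (r * (r - 1)) ≤ 5 * (n * k) * (r * r) := by
      have g0 : (0 : ℝ) ≤ r * (r - 1) := by nlinarith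
      have g1 : (r : ℝ) * (r - 1) ≤ r * r := by nlinarith
      exact mul_le_mul (mul_le_mul_of_nonneg_left hmr' (by norm_num)) g1 g0 (by positivity)
    have f2 : 5 * ((n : ℝ) * k) * (r * r) ≤ 5 * r ^ 2 * k ^ 2 * n := by
      have : (k : ℝ) ≤ k ^ 2 := by nlinarith
      calc 5 * ((n : ℝ) * k) * (r * r) = 5 * n * r ^ 2 * k := by ring
        _ ≤ 5 * n * r ^ 2 * k ^ 2 := mul_le_mul_of_nonneg_left this (by positivity)
        _ = _ := by ring
    calc _ ≤ 5 * r ^ 2 * k ^ 2 * n * (n : ℝ) :=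
          mul_le_mul_of_nonneg_right (f1.trans f2) hnpos.le
      _ = _ := by ring
  have e5 : 0 ≤ (r : ℝ) * (k - 2) / (2 * (k - 1) * n) := by
    apply div_nonneg
    · nlinarith
    · have : (0 : ℝ) ≤ k - 1 := by linarith
      positivity
  have e6 : (r : ℝ) * (k - 2) / (2 * (k - 1) * n) ≤ r ^ 2 * k ^ 2 / n :=
    degree_correction_le hrpos hkpos hnpos
  have e7 : 6 * (r : ℝ) ^ 2 * k ^ 2 / n = 5 * r ^ 2 * k ^ 2 / n + r ^ 2 * k ^ 2 / n := by ring
  rw [e7]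
  rw [abs_le] at h3 ⊢
  constructor <;> linarith [h3.1, h3.2]

set_option maxHeartbeats 800000 in
/-- The logarithm of the expected number of spanning hypertrees, with the main term still in
factorials. -/
theorem log_expectedTauRegular (hs : 2 ≤ s) (hr : r = s + 1) (hk : 2 ≤ k)
    (hn : n = (b + 1) * s + 1) (hm : n * k = (m + (b + 1)) * r)
    (hbig : 1000 * r ^ 2 * k ^ 2 ≤ n) :
    0 < expectedTauRegular n r k ∧
    |Real.log (expectedTauRegular n r k) -
      (logMainTerm n r k b m + (k * r - r - 1) / (2 * (k - 1)))| ≤ 300 * r ^ 2 * k ^ 2 / n := by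
  obtain ⟨-, hM, hη1, hη2⟩ := numeric_bounds hs hr hk hn hm hbig
  have hr3 : 3 ≤ r := by omega
  have hn0 : 0 < n := by omega
  have hnpos : (0 : ℝ) < n := by exact_mod_cast hn0
  have hkpos : (2 : ℝ) ≤ k := by exact_mod_cast hk
  have hbig' : 1000 * (r : ℝ) ^ 2 * k ^ 2 ≤ n := by exact_mod_cast hbig
  have hx0 : (0 : ℝ) ≤ (r : ℝ) ^ 2 * k ^ 2 / n := by positivity
  have hx1 : (r : ℝ) ^ 2 * k ^ 2 / n ≤ 1 / 1000 := by
    rw [div_le_iff₀ hnpos]; linarith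
  set x : ℝ := (r : ℝ) ^ 2 * k ^ 2 / n with hx
  have hcx : ∀ c : ℝ, c * (r : ℝ) ^ 2 * k ^ 2 / n = c * x := fun c => by rw [hx]; ring
  rw [hcx] at hη1 hη2 ⊢
  have hrs : (r : ℝ) = s + 1 := by exact_mod_cast hr
  -- the denominator
  have hMN : 4 * r * k + 10 ≤ (m + (b + 1)) * r := by rw [add_mul]; omega
  obtain ⟨hDpos, hD⟩ := log_card_regular_tables (n := n) hr3 (by omega : 1 ≤ k) hm (by omega)
  rw [hcx] at hD
  obtain ⟨hY1, hY2⟩ := card_regular_bounds (V := Fin n) hr3 (by simpa using hm) hMN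
  obtain ⟨hYpos, hY⟩ := abs_log_sub_log_le hDpos (by linarith) hY1 hY2
  set Dn : ℝ := ((#(colorings (rowConflicts (m + (b + 1)) r) fun _ : Fin n => k) : ℕ) : ℝ)
  -- the numerator
  obtain ⟨hJpos, hJ⟩ := log_card_joint hs hr hk hn hm hM
  rw [hcx] at hJ
  have hT := sum_hypertrees (V := Fin n) ⟨0, hn0⟩ hs (by simpa using hn)
    (fun c => (#(tables m r k c) : ℝ))
  rw [← hr, ← Nat.cast_sum, ← Nat.cast_sum, sum_card_tables m r k b (by omega),
    Fintype.card_fin] at hT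
  change _ = ((n - 1).factorial : ℝ) *
    ((#(colorings (jointConflicts m r b) fun _ : Fin n => k - 1) : ℕ) : ℝ) at hT
  set Jn : ℝ := ((#(colorings (jointConflicts m r b) fun _ : Fin n => k - 1) : ℕ) : ℝ)
  push_cast at hT
  set T : ℝ := ∑ E ∈ hypertrees (Fin n) r, (#(tables m r k (edgeDeg E)) : ℝ) with hTdef
  have hfac : ∀ a : ℕ, (0 : ℝ) < a.factorial := fun a => by exact_mod_cast a.factorial_pos
  have hTpos : 0 < T := by
    have h1 : 0 < T * ((b + 1).factorial * (s.factorial : ℝ) ^ (b + 1)) := by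
      rw [hT]; exact mul_pos (hfac _) hJpos
    exact pos_of_mul_pos_left h1 (mul_pos (hfac _) (pow_pos (hfac _) _)).le
  have hlogT : Real.log T = Real.log (n - 1).factorial + Real.log Jn -
      Real.log (b + 1).factorial - (b + 1) * Real.log s.factorial := by
    have h1 := congrArg Real.log hT
    rw [Real.log_mul hTpos.ne' (mul_pos (hfac _) (pow_pos (hfac _) _)).ne',
      Real.log_mul (hfac _).ne' (pow_pos (hfac _) _).ne', Real.log_pow,
      Real.log_mul (hfac _).ne' hJpos.ne'] at h1
    push_cast at h1
    linarith
  set X : ℝ := ∑ E ∈ hypertrees (Fin n) r, (#(completions r k E) : ℝ) with hXdef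
  set Y : ℝ := ((#(regularHypergraphs (Fin n) r k) : ℕ) : ℝ)
  have hcomp : ∀ E ∈ hypertrees (Fin n) r, _ := fun E hE =>
    card_completions_bounds (m := m) (t := b + 1) (k := k) hr3 (mem_hypertrees.1 hE).1
      (card_of_mem_hypertrees (⟨0, hn0⟩ : Fin n) (by omega : 1 ≤ s) (by simpa using hn) (hr ▸ hE))
      (by simpa using hm) hM
  have hX1 : (1 - 8 * (k : ℝ) ^ 3 * (m + (b + 1 : ℕ)) / (m : ℝ) ^ 2) * T ≤
      X * (m.factorial * (r.factorial : ℝ) ^ m) := by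
    rw [hTdef, hXdef, mul_sum, sum_mul]
    exact sum_le_sum fun E hE => (hcomp E hE).1
  have hX2 : X * (m.factorial * (r.factorial : ℝ) ^ m) ≤ T := by
    rw [hTdef, hXdef, sum_mul]
    exact sum_le_sum fun E hE => (hcomp E hE).2
  obtain ⟨hXpos, hX⟩ := abs_log_sub_log_le hTpos (by linarith) hX1 hX2
  have hfm : (0 : ℝ) < m.factorial * (r.factorial : ℝ) ^ m := mul_pos (hfac _) (pow_pos (hfac _) _)
  have hfN : (0 : ℝ) < (m + (b + 1)).factorial * (r.factorial : ℝ) ^ (m + (b + 1)) :=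
    mul_pos (hfac _) (pow_pos (hfac _) _)
  have hX0 : 0 < X := pos_of_mul_pos_left hXpos hfm.le
  have hY0 : 0 < Y := pos_of_mul_pos_left hYpos hfN.le
  rw [expectedTauRegular_eq]
  refine ⟨div_pos hX0 hY0, ?_⟩
  rw [Real.log_div hX0.ne' hY0.ne']
  rw [Real.log_mul hX0.ne' hfm.ne', Real.log_mul (hfac _).ne' (pow_pos (hfac _) _).ne',
    Real.log_pow] at hX
  rw [Real.log_mul hY0.ne' hfN.ne', Real.log_mul (hfac _).ne' (pow_pos (hfac _) _).ne',
    Real.log_pow] at hY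
  have hlk : Real.log k.factorial = Real.log k + Real.log (k - 1).factorial := by
    obtain ⟨κ, rfl⟩ : ∃ κ, k = κ + 1 := ⟨k - 1, by omega⟩
    rw [Nat.factorial_succ, Nat.cast_mul, Real.log_mul (by positivity) (hfac _).ne',
      Nat.add_sub_cancel]
  have hlr : Real.log r.factorial = Real.log r + Real.log s.factorial := by
    rw [hr, Nat.factorial_succ, Nat.cast_mul, Real.log_mul (by positivity) (hfac _).ne']
  have hk0 : (k : ℝ) - 1 ≠ 0 := by linarith
  -- The exponents of `log_card_regular_tables` and `log_card_joint` combine.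
  have hexp : ((k : ℝ) * r - r - 1) / (2 * (k - 1)) =
      (r - 1) * (k - 1) / 2 - (k * r - k - r) * (k - 2) / (2 * (k - 1)) := by
    field_simp; ring
  rw [hexp, logMainTerm]
  push_cast at hX hY hη1 hη2
  rw [hlk] at hD
  rw [hlogT] at hX
  have hNr : ((m : ℝ) + (b + 1)) * Real.log r.factorial =
      m * Real.log r.factorial + (b + 1) * (Real.log r + Real.log s.factorial) := by
    rw [add_mul, hlr]
  rw [hNr] at hY
  rw [abs_le] at hX hY hJ hD ⊢
  constructor <;> linarith [hX.1, hX.2, hY.1, hY.2, hJ.1, hJ.2, hD.1, hD.2]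

end LogExpectation

/-! ### Stirling's formula -/

section Stirling

/-- Stirling's formula with an explicit error term. -/
lemma abs_log_factorial_sub_le {a : ℕ} (ha : a ≠ 0) :
    |Real.log a.factorial - (a * Real.log a - a + Real.log a / 2 + Real.log (2 * Real.pi) / 2)| ≤
      1 / (12 * a) := by
  have hlow := Stirling.le_log_factorial_stirling ha
  have hform := Stirling.log_stirlingSeq_formula a
  obtain ⟨c, rfl⟩ := Nat.exists_eq_succ_of_ne_zero ha
  -- `log (stirlingSeq n) - 1 / (12 n)` increases to `log √π`
  have hmono : Monotone fun n : ℕ =>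
      Real.log (Stirling.stirlingSeq (n + 1)) - 1 / (12 * ((n : ℝ) + 1)) := by
    refine monotone_nat_of_le_succ fun n => ?_
    have h1 := Stirling.log_stirlingSeq_sdiff_le (n + 1)
    have h2 : 1 / (12 * ((n : ℝ) + 1)) - 1 / (12 * (((n + 1 : ℕ) : ℝ) + 1)) =
        1 / (12 * ((n : ℝ) + 1) * (n + 1 + 1)) := by
      push_cast
      field_simp
      ring
    push_cast at h1 h2 ⊢
    linarith
  have hlim : Tendsto (fun n : ℕ =>
      Real.log (Stirling.stirlingSeq (n + 1)) - 1 / (12 * ((n : ℝ) + 1))) atTop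
      (nhds (Real.log (√Real.pi) - 0)) := by
    refine Tendsto.sub ?_ ?_
    · exact ((tendsto_add_atTop_iff_nat 1).2 Stirling.tendsto_stirlingSeq_sqrt_pi).log
        (by positivity)
    · have h1 := (tendsto_one_div_add_atTop_nhds_zero_nat (𝕜 := ℝ)).const_mul (1 / 12)
      rw [mul_zero] at h1
      refine h1.congr fun n => ?_
      field_simp
  have hle := hmono.ge_of_tendsto hlim c
  have hc : (0 : ℝ) < (c : ℝ) + 1 := by positivity
  rw [Real.log_sqrt Real.pi_pos.le, sub_zero] at hle
  have hs : ((c.succ : ℕ) : ℝ) = c + 1 := by push_cast; ring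
  rw [hs] at hlow hform ⊢
  rw [Real.log_mul two_ne_zero hc.ne', Real.log_div hc.ne' (Real.exp_pos 1).ne', Real.log_exp,
    Nat.succ_eq_add_one] at hform
  rw [Real.log_mul two_ne_zero Real.pi_pos.ne'] at hlow ⊢
  rw [abs_le]
  constructor
  · have : 0 ≤ 1 / (12 * ((c : ℝ) + 1)) := by positivity
    linarith
  · rw [hform] at hle
    linarith

end Stirling

/-! ### Comparison with the closed form -/

section LogF

lemma log_F {n : ℕ} {r k : ℝ} (hn : 0 < n) (hr : 3 ≤ r) (hk : 2 ≤ k) :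
    0 < F n r k k ∧ Real.log (F n r k k) =
      Real.log (k - 1) / 2 + Real.log (r - 1) - Real.log n -
        (r + 1) / (2 * (r - 1)) * Real.log (k * r - k - r) +
      n * (Real.log k + k / r * Real.log (r - 1) + (k - 1) * Real.log (k - 1) -
        (k * r - k) / r * Real.log k -
        (k * r - k - r) / (r * (r - 1)) * Real.log (k * r - k - r)) := by
  have hn' : (0 : ℝ) < n := by exact_mod_cast hn
  have hk0 : 0 < k := by linarith
  have hk1 : 0 < k - 1 := by linarith
  have hr1 : 0 < r - 1 := by linarith
  have hq : 0 < k * r - k - r := by nlinarith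
  have hp : ∀ {x : ℝ} (y : ℝ), 0 < x → x ^ y ≠ 0 := fun y hx => (Real.rpow_pos_of_pos hx y).ne'
  refine ⟨by unfold F; positivity, ?_⟩
  unfold F
  rw [Real.log_mul (by positivity) (by positivity), Real.log_div (by positivity) (by positivity),
    Real.log_mul (hp _ hk1) hr1.ne', Real.log_mul hn'.ne' (hp _ hq), Real.log_pow,
    Real.log_div (by positivity) (by positivity), Real.log_mul (by positivity) (hp _ hk1),
    Real.log_mul hk0.ne' (hp _ hr1), Real.log_mul (hp _ hk0) (hp _ hq), Real.log_rpow hk1,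
    Real.log_rpow hq, Real.log_rpow hr1, Real.log_rpow hk1, Real.log_rpow hk0, Real.log_rpow hq]
  ring

/-- The terms of order `log` cancel exactly when the numbers `t = (n - 1) / (r - 1)` and
`m = (q n + r) / (r (r - 1))` of edges inside and outside the hypertree are replaced, under the
logarithm, by `n / (r - 1)` and `q n / (r (r - 1))`, where `q = k r - k - r`. The letters `x` stand
for the logarithms. -/
lemma main_term_identity {n k r t m : ℝ} (hr : 3 ≤ r) (ht : t * (r - 1) = n - 1)
    (hm : m * (r * (r - 1)) = n * (k * r - k - r) + r) (xn xk xk1 xr xr1 xq : ℝ) :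
    n * xk + t * xr + ((k - 1) * n + 1 / 2) * (xk1 + xn) + (n + 1 / 2) * xn - xn +
        (m + t + 1 / 2) * (xk + xn - xr) - (t + 1 / 2) * (xn - xr1) -
        (m + 1 / 2) * (xq + xn - xr - xr1) - (k * n + 1 / 2) * (xk + xn) =
      xk1 / 2 + xr1 - xn - (r + 1) / (2 * (r - 1)) * xq +
      n * (xk + k / r * xr1 + (k - 1) * xk1 - (k * r - k) / r * xk -
        (k * r - k - r) / (r * (r - 1)) * xq) := by
  have h0 : r ≠ 0 := by linarith
  have h1 : r - 1 ≠ 0 := by linarith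
  have ht' : t = (n - 1) / (r - 1) := by rw [eq_div_iff h1, ht]
  have hm' : m = (n * (k * r - k - r) + r) / (r * (r - 1)) := by
    rw [eq_div_iff (mul_ne_zero h0 h1), hm]
  rw [ht', hm']
  field_simp
  ring

lemma log_sub_log_bounds {x y : ℝ} (hx : 0 < x) (hy : 0 < y) :
    (x - y) / x ≤ Real.log x - Real.log y ∧ Real.log x - Real.log y ≤ (x - y) / y := by
  have h1 := Real.one_sub_inv_le_log_of_pos (div_pos hx hy)
  have h2 := Real.log_le_sub_one_of_pos (div_pos hx hy)
  rw [Real.log_div hx.ne' hy.ne'] at h1 h2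
  have e1 : 1 - (x / y)⁻¹ = (x - y) / x := by field_simp
  have e2 : x / y - 1 = (x - y) / y := by field_simp
  constructor <;> linarith

/-- Bounds for the change of `(x + 1 / 2) log x` when `x` is replaced by `y` under the logarithm. -/
lemma add_half_mul_log_bounds {x y : ℝ} (hx : 0 < x) (hy : 0 < y) :
    x - y + (x - y) / x / 2 ≤ (x + 1 / 2) * Real.log x - (x + 1 / 2) * Real.log y ∧
      (x + 1 / 2) * Real.log x - (x + 1 / 2) * Real.log y ≤
        x - y + (x - y) ^ 2 / y + (x - y) / y / 2 := by
  obtain ⟨h1, h2⟩ := log_sub_log_bounds hx hy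
  have h3 := mul_le_mul_of_nonneg_left h1 hx.le
  have h4 := mul_le_mul_of_nonneg_left h2 hx.le
  have e1 : x * ((x - y) / x) = x - y := by field_simp
  have e2 : x * ((x - y) / y) = x - y + (x - y) ^ 2 / y := by field_simp; ring
  constructor <;> linarith

/-- The errors made by replacing `t = (n - 1) / (r - 1)` by `n / (r - 1)` under the logarithm. -/
lemma shift_errors {n r t : ℝ} (hn : 0 < n) (hn2 : 2 ≤ n) (hr : 3 ≤ r) (ht : 0 < t)
    (htn : t * (r - 1) = n - 1) :
    -(r / n) ≤ -(1 / (r - 1)) / t ∧ (-(1 / (r - 1))) ^ 2 / (n / (r - 1)) ≤ r / n ∧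
      -(1 / (r - 1)) / (n / (r - 1)) ≤ 0 := by
  have hr1 : 0 < r - 1 := by linarith
  refine ⟨?_, ?_, ?_⟩
  · have e : -(1 / (r - 1)) / t = -(1 / (n - 1)) := by rw [← htn]; field_simp
    rw [e, neg_le_neg_iff, div_le_div_iff₀ (by linarith) hn]
    nlinarith
  · have e : (-(1 / (r - 1))) ^ 2 / (n / (r - 1)) = 1 / (r - 1) / n := by field_simp
    rw [e]
    refine div_le_div_of_nonneg_right ?_ hn.le
    rw [div_le_iff₀ hr1]
    nlinarith
  · rw [neg_div]
    exact neg_nonpos.2 (by positivity)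

/-- The errors made by replacing `m = (q n + r) / (r (r - 1))` by `q n / (r (r - 1))` under the
logarithm. -/
lemma shift_errors' {n r q : ℝ} (hn : 0 < n) (hr : 3 ≤ r) (hq : 1 ≤ q) :
    1 / (r - 1) / (q * n / (r * (r - 1))) ≤ r / n ∧
      (1 / (r - 1)) ^ 2 / (q * n / (r * (r - 1))) ≤ r / n := by
  have hr1 : 0 < r - 1 := by linarith
  have hqn : r / (q * n) ≤ r / n :=
    div_le_div_of_nonneg_left (by linarith) hn (le_mul_of_one_le_left hn.le hq)
  have e1 : 1 / (r - 1) / (q * n / (r * (r - 1))) = r / (q * n) := by field_simp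
  have e2 : (1 / (r - 1)) ^ 2 / (q * n / (r * (r - 1))) = r / (q * n) / (r - 1) := by field_simp
  rw [e1, e2]
  exact ⟨hqn, (div_le_self (by positivity) (by linarith)).trans hqn⟩

/-- The main term, with factorials replaced by Stirling's formula, agrees with `log F` up to
`O(r / n)`. -/
lemma stirling_main_term_bounds {n : ℕ} {k r t m : ℝ} (hn : 0 < n) (hr : 3 ≤ r) (hk : 2 ≤ k)
    (ht : 0 < t) (hm : 0 < m) (htn : t * (r - 1) = n - 1) (hn2 : (2 : ℝ) ≤ n)
    (hmn : m * (r * (r - 1)) = n * (k * r - k - r) + r) :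
    |n * Real.log k + t * Real.log r + ((k - 1) * n + 1 / 2) * Real.log ((k - 1) * n) +
        (n + 1 / 2) * Real.log n - Real.log n + (m + t + 1 / 2) * Real.log (m + t) -
        (t + 1 / 2) * Real.log t - (m + 1 / 2) * Real.log m -
        (k * n + 1 / 2) * Real.log (k * n) - Real.log (F n r k k)| ≤ 4 * (r / n) := by
  have hnpos : (0 : ℝ) < n := by exact_mod_cast hn
  have hr1 : (0 : ℝ) < r - 1 := by linarith
  have hk1pos : (0 : ℝ) < k - 1 := by linarith
  have hkpos : (0 : ℝ) < k := by linarith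
  have hrpos : (0 : ℝ) < r := by linarith
  have id := main_term_identity hr htn hmn (Real.log n) (Real.log k) (Real.log (k - 1))
    (Real.log r) (Real.log (r - 1)) (Real.log (k * r - k - r))
  rw [← (log_F hn hr hk).2] at id
  have d3 : m + t = k * n / r := by
    rw [eq_div_iff hrpos.ne']
    apply mul_right_cancel₀ hr1.ne'
    linear_combination hmn + r * htn
  have hq1 : 1 ≤ k * r - k - r := by nlinarith
  generalize k * r - k - r = q at *
  have d1 : t - n / (r - 1) = -(1 / (r - 1)) := by
    rw [show t = (n - 1) / (r - 1) by rw [eq_div_iff hr1.ne', htn]]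
    ring
  have d2 : m - q * n / (r * (r - 1)) = 1 / (r - 1) := by
    rw [show m = (n * q + r) / (r * (r - 1)) by
      rw [eq_div_iff (mul_pos hrpos hr1).ne', hmn]]
    field_simp
    ring
  have hq0 : 0 < q := by linarith
  have L3 : Real.log (m + t) = Real.log k + Real.log n - Real.log r := by
    rw [d3, Real.log_div (by positivity) hrpos.ne', Real.log_mul hkpos.ne' hnpos.ne']
  have L1 : Real.log ((k - 1) * n) = Real.log (k - 1) + Real.log n :=
    Real.log_mul hk1pos.ne' hnpos.ne'
  have L6 : Real.log (k * n) = Real.log k + Real.log n := Real.log_mul hkpos.ne' hnpos.ne'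
  have L4 : Real.log (n / (r - 1)) = Real.log n - Real.log (r - 1) :=
    Real.log_div hnpos.ne' hr1.ne'
  have L5 : Real.log (q * n / (r * (r - 1))) =
      Real.log q + Real.log n - Real.log r - Real.log (r - 1) := by
    rw [Real.log_div (by positivity) (by positivity), Real.log_mul (by positivity) hnpos.ne',
      Real.log_mul hrpos.ne' hr1.ne']
    ring
  obtain ⟨B1, B2⟩ := add_half_mul_log_bounds ht (show 0 < (n : ℝ) / (r - 1) by positivity)
  obtain ⟨B3, B4⟩ := add_half_mul_log_bounds hm
    (show 0 < q * n / (r * (r - 1)) by positivity)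
  rw [L4, d1] at B1 B2
  rw [L5, d2] at B3 B4
  rw [L1, L3, L6, ← id]
  -- each error term is at most `r / n`
  set y : ℝ := r / n with hy
  obtain ⟨U1, U2, U3⟩ := shift_errors hnpos hn2 hr ht htn
  obtain ⟨U4, U5⟩ := shift_errors' hnpos hr hq1
  have U6 : 0 ≤ 1 / (r - 1) / m := by positivity
  have hy0 : 0 < y := by positivity
  rw [abs_le]
  constructor <;> linarith

/-- Stirling's formula turns the main term into `F`, up to a relative error `O(r / n)`. -/
theorem abs_logMainTerm_sub_log_F_le {n r k b s m : ℕ} (hs : 2 ≤ s) (hr : r = s + 1) (hk : 2 ≤ k)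
    (hn : n = (b + 1) * s + 1) (hm : n * k = (m + (b + 1)) * r)
    (hbig : 1000 * r ^ 2 * k ^ 2 ≤ n) :
    |logMainTerm n r k b m - Real.log (F n r k k)| ≤ 10 * (r / n) := by
  obtain ⟨hkm, -, -, -⟩ := numeric_bounds hs hr hk hn hm hbig
  have hn0 : 0 < n := by omega
  have hn2' : 2 ≤ n := by
    have : 1 * s ≤ (b + 1) * s := Nat.mul_le_mul_right _ (by omega)
    omega
  have hnpos : (0 : ℝ) < n := by exact_mod_cast hn0
  have hk2 : (2 : ℝ) ≤ k := by exact_mod_cast hk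
  have hrs : (r : ℝ) = s + 1 := by exact_mod_cast hr
  have hs2 : (2 : ℝ) ≤ s := by exact_mod_cast hs
  have hr3 : (3 : ℝ) ≤ r := by linarith
  have hn' : (n : ℝ) = (b + 1) * s + 1 := by exact_mod_cast hn
  have hm' : (n : ℝ) * k = (m + (b + 1)) * r := by exact_mod_cast hm
  have hmpos : (0 : ℝ) < m := by
    have h1 : 0 < (k : ℝ) * n := by positivity
    have h2 : 0 < (m : ℝ) * r := by linarith
    exact pos_of_mul_pos_left h2 (by linarith)
  have hm0 : m ≠ 0 := by rintro rfl; simp at hmpos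
  have S1 := abs_log_factorial_sub_le (a := (k - 1) * n) (Nat.mul_ne_zero (by omega) (by omega))
  have S2 := abs_log_factorial_sub_le (a := n) (by omega)
  have S3 := abs_log_factorial_sub_le (a := m + (b + 1)) (by omega)
  have S4 := abs_log_factorial_sub_le (a := b + 1) (by omega)
  have S5 := abs_log_factorial_sub_le (a := m) hm0
  have S6 := abs_log_factorial_sub_le (a := k * n) (Nat.mul_ne_zero (by omega) (by omega))
  have hfac : Real.log n.factorial = Real.log n + Real.log (n - 1).factorial := by
    rw [← Nat.mul_factorial_pred hn0.ne', Nat.cast_mul, Real.log_mul hnpos.ne'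
      (by exact_mod_cast (Nat.factorial_ne_zero _))]
  have hk1 : ((k - 1 : ℕ) : ℝ) = k - 1 := by rw [Nat.cast_sub (by omega)]; simp
  rw [logMainTerm]
  push_cast at S1 S2 S3 S4 S5 S6
  rw [hk1] at S1
  rw [hfac] at S2
  generalize hL1 : Real.log (((k - 1) * n).factorial : ℝ) = l1 at *
  generalize hL2 : Real.log ((n - 1).factorial : ℝ) = l2 at *
  generalize hL3 : Real.log ((m + (b + 1)).factorial : ℝ) = l3 at *
  generalize hL4 : Real.log ((b + 1).factorial : ℝ) = l4 at *
  generalize hL5 : Real.log (m.factorial : ℝ) = l5 at *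
  generalize hL6 : Real.log ((k * n).factorial : ℝ) = l6 at *
  have htpos : (0 : ℝ) < (b : ℝ) + 1 := by positivity
  generalize (b : ℝ) + 1 = t at *
  have hts : t * (r - 1) = n - 1 := by rw [hn', hrs]; ring
  have hmq : (m : ℝ) * (r * (r - 1)) = n * (k * r - k - r) + r := by
    linear_combination (1 - (r : ℝ)) * hm' - r * hts
  have hmain := stirling_main_term_bounds hn0 hr3 hk2 htpos hmpos hts (by exact_mod_cast hn2') hmq
  have hSy : ∀ x : ℝ, 0 < x → (n : ℝ) ≤ 12 * x * r → 1 / (12 * x) ≤ r / n := fun x hx h => by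
    rw [div_le_div_iff₀ (by positivity) hnpos]; linarith
  have hrn : (n : ℝ) ≤ n * r := le_mul_of_one_le_right hnpos.le (by linarith)
  have hkn : (n : ℝ) * 2 ≤ k * n := by rw [mul_comm]; exact mul_le_mul_of_nonneg_right hk2 hnpos.le
  have hkn0 : (0 : ℝ) ≤ (k * n) * (r - 3) := mul_nonneg (by positivity) (by linarith)
  have hn2 : (2 : ℝ) ≤ n := by exact_mod_cast hn2'
  have hnrk : (0 : ℝ) ≤ (n * r) * (k - 2) := mul_nonneg (by positivity) (by linarith)
  have hk1pos : (0 : ℝ) < k - 1 := by linarith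
  have T1 := hSy ((k - 1) * n) (by positivity) (by linarith)
  have T2 := hSy n hnpos (by linarith)
  have T3 := hSy (m + t) (by positivity) (by linarith)
  have T4 := hSy t htpos (by linarith)
  have T5 := hSy m hmpos (by linarith)
  have T6 := hSy (k * n) (by positivity) (by linarith)
  rw [abs_le] at S1 S2 S3 S4 S5 S6 hmain ⊢
  constructor
  · linarith [S1.1, S2.1, S3.1, S4.2, S5.2, S6.2, hmain.1]
  · linarith [S1.2, S2.2, S3.2, S4.1, S5.1, S6.1, hmain.2]

end LogF

/-! ### The uniform estimate -/

section Uniform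

/-- The estimate with explicit constants, for a single triple `n`, `r`, `k`. -/
theorem abs_log_expectedTauRegular_sub_le {n r k : ℕ} (hn : 3 ≤ n) (hr : 3 ≤ r) (hk : 2 ≤ k)
    (hrk : r ∣ k * n) (hrn : r - 1 ∣ n - 1) (hbig : 1000 * r ^ 2 * k ^ 2 ≤ n) :
    0 < expectedTauRegular n r k ∧ 0 < F n r k k ∧
    |Real.log (expectedTauRegular n r k) - Real.log (F n r k k) -
      ((k : ℝ) * r - r - 1) / (2 * (k - 1))| ≤ 310 * (r ^ 2 * k ^ 2 / n) := by
  obtain ⟨t, ht⟩ := hrn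
  obtain ⟨N, hN⟩ := hrk
  obtain ⟨s, rfl⟩ : ∃ s, r = s + 1 := ⟨r - 1, by omega⟩
  rw [Nat.add_sub_cancel] at ht
  obtain ⟨b, rfl⟩ : ∃ b, t = b + 1 := by
    refine Nat.exists_eq_succ_of_ne_zero ?_
    rintro rfl
    omega
  have hn' : n = (b + 1) * s + 1 := by rw [mul_comm]; omega
  -- the hypertree has at most as many edges as the hypergraph
  have hNb : b + 1 ≤ N := by
    have h1 : 2 * n ≤ k * n := Nat.mul_le_mul_right n hk
    have h2 : (s + 1) * (b + 1) ≤ (s + 1) * N := by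
      rw [← hN]
      refine le_trans ?_ h1
      have h3 : (b + 1) * 1 ≤ (b + 1) * s := Nat.mul_le_mul_left _ (by omega)
      rw [hn', add_mul, mul_comm s]
      omega
    exact Nat.le_of_mul_le_mul_left h2 (by omega)
  obtain ⟨m, rfl⟩ := Nat.exists_eq_add_of_le' hNb
  have hm : n * k = (m + (b + 1)) * (s + 1) := by rw [mul_comm, hN, mul_comm]
  have hnpos : (0 : ℝ) < n := by exact_mod_cast (by omega : 0 < n)
  obtain ⟨hpos, h1⟩ := log_expectedTauRegular (by omega) rfl hk hn' hm hbig
  have h2 := abs_logMainTerm_sub_log_F_le (by omega) rfl hk hn' hm hbig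
  generalize s + 1 = r at *
  have hr' : (3 : ℝ) ≤ r := by exact_mod_cast hr
  have hk' : (2 : ℝ) ≤ k := by exact_mod_cast hk
  refine ⟨hpos, (log_F (by omega) hr' hk').1, ?_⟩
  have h3 : (r : ℝ) / n ≤ r ^ 2 * k ^ 2 / n := by
    refine div_le_div_of_nonneg_right ?_ hnpos.le
    calc (r : ℝ) = r * 1 := (mul_one _).symm
      _ ≤ r ^ 2 * k ^ 2 := mul_le_mul (by nlinarith) (by nlinarith) zero_le_one (sq_nonneg _)
  have h4 : 300 * (r : ℝ) ^ 2 * k ^ 2 / n = 300 * (r ^ 2 * k ^ 2 / n) := by ring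
  rw [h4] at h1
  rw [abs_le] at h1 h2 ⊢
  constructor <;> linarith [h1.1, h1.2, h2.1, h2.2]

end Uniform

end RandomHypertree

/-- The limit is along the set `S` of those `n ≥ 3` for which `r ∣ k n` and `r - 1 ∣ n - 1`. The
implied constant `C` is absolute. -/
theorem mainTheorem2 :
    ∃ C : ℝ, ∀ (r k : ℕ → ℕ) (S : Set ℕ),
      (∀ n, 3 ≤ n → 3 ≤ r n) →
      (∀ n, 3 ≤ n → 2 ≤ k n) →
      S = {n : ℕ | 3 ≤ n ∧ r n ∣ k n * n ∧ r n - 1 ∣ n - 1} →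
      S.Infinite →
      (fun n : ℕ => (r n : ℝ) ^ 5 * (k n : ℝ) ^ 3) =o[atTop ⊓ 𝓟 S]
        (fun n : ℕ => ((k n : ℝ) * r n - k n - r n) * n) →
      ∃ δ : ℕ → ℝ,
        IsBigOWith C (atTop ⊓ 𝓟 S) δ
          (fun n : ℕ =>
            (r n : ℝ) ^ 5 * (k n : ℝ) ^ 3 / (((k n : ℝ) * r n - k n - r n) * n)) ∧
        ∀ᶠ n : ℕ in atTop ⊓ 𝓟 S,
          RandomHypertree.expectedTauRegular n (r n) (k n) =
            RandomHypertree.F n (r n) (k n) (k n) *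
              Real.exp (((k n : ℝ) * r n - r n - 1) / (2 * ((k n : ℝ) - 1)) + δ n) := by
  refine ⟨310, fun r k S hr hk hS _ ho => ?_⟩
  have hev : ∀ᶠ n : ℕ in atTop ⊓ 𝓟 S, n ∈ S ∧
      ‖(r n : ℝ) ^ 5 * (k n : ℝ) ^ 3‖ ≤ 1 / 1000 * ‖((k n : ℝ) * r n - k n - r n) * n‖ :=
    Filter.Eventually.and (Filter.mem_inf_of_right (Filter.mem_principal_self S))
      (ho.bound (by norm_num))
  have key : ∀ᶠ n : ℕ in atTop ⊓ 𝓟 S,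
      0 < RandomHypertree.expectedTauRegular n (r n) (k n) ∧
      0 < RandomHypertree.F n (r n) (k n) (k n) ∧
      |Real.log (RandomHypertree.expectedTauRegular n (r n) (k n)) -
        Real.log (RandomHypertree.F n (r n) (k n) (k n)) -
        ((k n : ℝ) * r n - r n - 1) / (2 * ((k n : ℝ) - 1))| ≤
      310 * ((r n : ℝ) ^ 5 * (k n : ℝ) ^ 3 / (((k n : ℝ) * r n - k n - r n) * n)) := by
    filter_upwards [hev] with n hn
    obtain ⟨hnS, hb⟩ := hn
    rw [hS] at hnS
    obtain ⟨hn3, hd1, hd2⟩ := hnS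
    have hr3 := hr n hn3
    have hk2 := hk n hn3
    generalize r n = r at *
    generalize k n = k at *
    have hr3' : (3 : ℝ) ≤ r := by exact_mod_cast hr3
    have hk2' : (2 : ℝ) ≤ k := by exact_mod_cast hk2
    have hnpos : (0 : ℝ) < n := by exact_mod_cast (by omega : 0 < n)
    have hq0 : 0 < (k : ℝ) * r - k - r := by nlinarith
    have hq1 : (k : ℝ) * r - k - r ≤ k * r := by linarith
    have hrk : (0 : ℝ) < k * r := by positivity
    rw [Real.norm_of_nonneg (by positivity), Real.norm_of_nonneg (by positivity)] at hb
    -- As `k r - k - r ≤ k r`, the hypothesis forces `n` to exceed any multiple of `r ^ 4 k ^ 2`.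
    have hb1 : 1000 * (r : ℝ) ^ 4 * k ^ 2 ≤ n := by
      have h1 : ((k : ℝ) * r - k - r) * n ≤ k * r * n := mul_le_mul_of_nonneg_right hq1 hnpos.le
      refine le_of_mul_le_mul_left ?_ hrk
      calc (k : ℝ) * r * (1000 * r ^ 4 * k ^ 2) = 1000 * ((r : ℝ) ^ 5 * k ^ 3) := by ring
        _ ≤ (k : ℝ) * r * n := by linarith
    have h24 : (r : ℝ) ^ 2 ≤ r ^ 4 := pow_le_pow_right₀ (by linarith) (by norm_num)
    have hbig : 1000 * r ^ 2 * k ^ 2 ≤ n := by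
      have h1 : (r : ℝ) ^ 2 * k ^ 2 ≤ r ^ 4 * k ^ 2 := mul_le_mul_of_nonneg_right h24 (sq_nonneg _)
      have : 1000 * (r : ℝ) ^ 2 * k ^ 2 ≤ n := by linarith
      exact_mod_cast this
    obtain ⟨hE, hF, h⟩ :=
      RandomHypertree.abs_log_expectedTauRegular_sub_le hn3 hr3 hk2 hd1 hd2 hbig
    refine ⟨hE, hF, h.trans (mul_le_mul_of_nonneg_left ?_ (by norm_num))⟩
    rw [div_le_div_iff₀ hnpos (by positivity)]
    calc (r : ℝ) ^ 2 * k ^ 2 * ((k * r - k - r) * n)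
        ≤ (r : ℝ) ^ 4 * k ^ 2 * ((k * r) * n) := by gcongr
      _ = (r : ℝ) ^ 5 * k ^ 3 * n := by ring
  refine ⟨fun n => Real.log (RandomHypertree.expectedTauRegular n (r n) (k n)) -
    Real.log (RandomHypertree.F n (r n) (k n) (k n)) -
    ((k n : ℝ) * r n - r n - 1) / (2 * ((k n : ℝ) - 1)), ?_, ?_⟩
  · rw [isBigOWith_iff]
    filter_upwards [key] with n hn
    rw [Real.norm_eq_abs]
    exact hn.2.2.trans (mul_le_mul_of_nonneg_left (Real.le_norm_self _) (by norm_num))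
  · filter_upwards [key] with n hn
    obtain ⟨hE, hF, -⟩ := hn
    rw [add_sub_cancel, Real.exp_sub, Real.exp_log hE, Real.exp_log hF,
      mul_div_cancel₀ _ hF.ne']
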